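/- Fix an integer $r\ge 2$, put $q=e^{\pi\sqrt{-1}/r}$, $q^x=e^{\pi\sqrt{-1}x/r}$, $\{x\}=q^x-q^{-x}$, $[x]=\{x\}/\{1\}$, $\{n\}!=\{n\}\cdots\{1\}$. **The category $\mathscr C$.** Let $U$ be the unrolled restricted quantum group of $\mathfrak{sl}(2)$: the $\mathbb C$-algebra with generators $E,F,K^{\pm1},H$ and relations $KK^{-1}=K^{-1}K=1$, $KEK^{-1}=q^2E$, $KFK^{-1}=q^{-2}F$, $[E,F]=\frac{K-K^{-1}}{q-q^{-1}}$, $HK=KH$, $[H,E]=2E$, $[H,F]=-2F$, $E^r=F^r=0$, with $\Delta E=1\otimes E+E\otimes K$, $\Delta F=K^{-1}\otimes F+F\otimes 1$, $\Delta K=K\otimes K$, $\Delta H=H\otimes1+1\otimes H$, $\varepsilon(E)=\varepsilon(F)=\varepsilon(H)=0$, $\varepsilon(K)=1$, $S(E)=-EK^{-1}$, $S(F)=-KF$, $S(K)=K^{-1}$, $S(H)=-H$. Let $\mathscr C$ be the category of finite-dimensional weight $U$-modules ($H$ is diagonalizable and $K=q^H$). It has the braiding $c_{V,W}=\tau\circ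 R$, where $$R=q^{H\otimes H/2}\sum_{n=0}^{r-1}\tfrac{\{1\}^{2n}}{\{n\}!}q^{n(n-1)/2}E^n\otimes F^n ,$$ the twist $\theta_V$ which is the inverse of the operator $$K^{r-1}\sum_{n=0}^{r-1}\tfrac{\{1\}^{2n}}{\{n\}!}q^{n(n-1)/2}S(F^n)q^{-H^2/2}E^n ,$$ and the duality morphisms $\mathrm{coev}_V:\mathbb C\to V\otimes V^*$, $1\mapsto\sum v_i\otimes v_i^*$, and $\mathrm{ev}_V:V^*\otimes V\to\mathbb C$, $f\otimes w\mapsto f(w)$. **The subcategory $\mathscr D$.** $\mathscr D\subset\mathscr C$ is the full subcategory whose objects are the finite direct sums of retracts of tensor products $X_1\otimes\cdots\otimes X_p$ with $X_i\in A\cup A^*$, where $$A=\{V_\alpha,\ S_n,\ P_i,\ \mathbb C^H_{ar}\ :\ \alpha\in(\mathbb R\setminus\mathbb Z)\cup r\mathbb Z,\ n,i\in\{0,\dots,r-2\},\ a\in\mathbb Z\}.$$ Here $V_\alpha$ is the $r$-dimensional module with basis $v_0,\dots,v_{r-1}$ and $Hv_i=(\alpha+r-1-2i)v_i$, $Ev_i=\frac{\{i\}\{i-\alpha\}}{\{1\}^2}v_{i-1}$,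 $Fv_i=v_{i+1}$; $S_n$ is the simple module of dimension $n+1$ and highest weight $n$; $\mathbb C^H_{ar}$ is one-dimensional with $E=F=0$ and $H=ar$; $P_i$ is the $2r$-dimensional indecomposable projective module of highest weight $2r-2-i$ (the projective cover of $S_i$). **The half twist.** A half twist on $\mathscr C$ is a natural automorphism $\sqrt\theta$ of the identity functor, by module maps, with $\sqrt\theta_V^{\,2}=\theta_V$, $\sqrt\theta_{V^*}=(\sqrt\theta_V)^*$, $\sqrt\theta_{\mathbb C}=\mathrm{Id}$. The one used here is the one that acts on $V_\alpha$, $\alpha\in(\mathbb C\setminus\mathbb Z)\cup r\mathbb Z$, by $q^{(\alpha^2-(r-1)^2)/4}$, and on $S_i\otimes\mathbb C^H_{kr}$ $(0\le i\le r-2,\ k\in\mathbb Z)$ by $q^{i(i+2-2r)/4}$ if $k$ is even and by $q^{j(j+2-2r)/4}$, $j=r-2-i$, if $k$ is odd. Put $X_{V,W}=\sqrt\theta_{W\otimes V}^{\,-1}\,c_{V,W}\,(\sqrt\theta_V\otimes\sqrt\theta_W)$. **The category $\mathscr D^\dagger$.** A Hermitian structure on $V\in\mathscr C$ is a non-degenerate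 Hermitian form (antilinear in the first variable) such that $(Fv,w)=(v,Ew)$, $(Ev,w)=(v,Fw)$, $(K^{\pm1}v,w)=(v,K^{\mp1}w)$, $(Hv,w)=(v,Hw)$. The objects of $\mathscr D^\dagger$ are the modules in $\mathscr D$ equipped with a Hermitian structure, and its morphisms are all module maps. The tensor product $V\otimes W$ carries the form $(v,v')=(v,\tau X_{V,W}v')_p$, where $(x\otimes y,x'\otimes y')_p=(x,x')(y,y')$; the unit $\mathbb C$ carries $(1,1)=1$; the dual $V^*$ carries $(\varphi,\psi)=\sum_i\overline{\varphi(e_i)}\,\psi(e_i')$, where $(e_i)$, $(e'_i)$ are bases of $V$ with $(e'_i,e_j)=\delta_{ij}$. For $g:V\to W$ let $g^\dagger:W\to V$ be the Hermitian adjoint, $(w,g(v))_W=(g^\dagger(w),v)_V$. **Theorem.** The half twist above exists. The forms above make $\mathbb C$, $V\otimes W$ and $V^*$ objects of $\mathscr D^\dagger$ for all $V,W\in\mathscr D^\dagger$, and $\mathscr D^\dagger$ with this tensor product, the above braiding, twist and duality and the Hermitian adjoint $\dagger$ is a Hermitian ribbon category in the sense of Turaev. That is: it is a ribbon category; the adjoint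 of a morphism is a morphism; $(f^\dagger)^\dagger=f$, $(f\otimes g)^\dagger=f^\dagger\otimes g^\dagger$, $(f\circ g)^\dagger=g^\dagger\circ f^\dagger$; the associativity and unit isomorphisms are unitary; and for all objects $V,W$ $$c_{V,W}^\dagger=c_{V,W}^{-1},\qquad \theta_V^\dagger=\theta_V^{-1},$$ $$\mathrm{coev}_V^\dagger=\mathrm{ev}_V\,c_{V,V^*}(\theta_V\otimes\mathrm{Id}_{V^*}),\qquad \mathrm{ev}_V^\dagger=(\mathrm{Id}_{V^*}\otimes\theta_V)\,c_{V,V^*}\,\mathrm{coev}_V .$$ -/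

import Mathlib

open CategoryTheory MonoidalCategory TensorProduct

noncomputable section

/-! ## Hermitian ribbon categories -/

/-- A ribbon structure on a monoidal category in which the dual of `V` is `dual V`: a braiding,
duality morphisms `𝟙 ⟶ V ⊗ V*` and `V* ⊗ V ⟶ 𝟙` satisfying the zigzag identities, and a twist,
i.e. a natural automorphism of the identity functor compatible with the braiding and with the
duality. -/
structure RibbonStructure (C : Type*) [Category C] [MonoidalCategory C] (dual : C → C) where
  braided : BraidedCategory C
  pairing : ∀ V : C, ExactPairing V (dual V)
  twist : ∀ V : C, V ≅ V
  twist_naturality : ∀ {V W : C} (f : V ⟶ W), f ≫ (twist W).hom = (twist V).hom ≫ f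
  twist_tensor : ∀ V W : C, (twist (V ⊗ W)).hom =
    (braided.braiding V W).hom ≫ (braided.braiding W V).hom ≫ ((twist V).hom ⊗ₘ (twist W).hom)
  twist_dual : ∀ V : C, (pairing V).coevaluation' ≫ ((twist V).hom ▷ dual V) =
    (pairing V).coevaluation' ≫ (V ◁ (twist (dual V)).hom)

/-- A Hermitian ribbon structure: a ribbon structure with a conjugation `dagger`.  The fields
`dagger_associator`, `dagger_leftUnitor`, `dagger_rightUnitor` say that the canonical isomorphisms
of the monoidal structure, which are identities in a strict category, are unitary. -/
structure HermitianRibbonStructure (C : Type*) [Category C] [MonoidalCategory C] (dual : C → C)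
    extends RibbonStructure C dual where
  dagger : ∀ {V W : C}, (V ⟶ W) → (W ⟶ V)
  dagger_dagger : ∀ {V W : C} (f : V ⟶ W), dagger (dagger f) = f
  dagger_tensor : ∀ {V W V' W' : C} (f : V ⟶ W) (g : V' ⟶ W'),
    dagger (f ⊗ₘ g) = dagger f ⊗ₘ dagger g
  dagger_comp : ∀ {U V W : C} (f : V ⟶ W) (g : U ⟶ V), dagger (g ≫ f) = dagger f ≫ dagger g
  dagger_associator : ∀ U V W : C, dagger (α_ U V W).hom = (α_ U V W).inv
  dagger_leftUnitor : ∀ V : C, dagger (λ_ V).hom = (λ_ V).inv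
  dagger_rightUnitor : ∀ V : C, dagger (ρ_ V).hom = (ρ_ V).inv
  dagger_braiding : ∀ V W : C,
    dagger (braided.braiding V W).hom = (braided.braiding V W).inv
  dagger_twist : ∀ V : C, dagger (twist V).hom = (twist V).inv
  dagger_coev : ∀ V : C, dagger (pairing V).coevaluation' =
    ((twist V).hom ▷ dual V) ≫ (braided.braiding V (dual V)).hom ≫ (pairing V).evaluation'
  dagger_ev : ∀ V : C, dagger (pairing V).evaluation' =
    (pairing V).coevaluation' ≫ (braided.braiding V (dual V)).hom ≫ (dual V ◁ (twist V).hom)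

namespace UnrolledSl2

/-! ## Scalars -/

/-- `q ^ x = exp (π i x / r)`, for `q = exp (π i / r)`. -/
def qpow (r : ℕ) (x : ℂ) : ℂ := Complex.exp (Real.pi * Complex.I * x / r)

/-- `{x} = q ^ x - q ^ (-x)`. -/
def qbr (r : ℕ) (x : ℂ) : ℂ := qpow r x - qpow r (-x)

/-- `[x] = {x} / {1}`. -/
def qnum (r : ℕ) (x : ℂ) : ℂ := qbr r x / qbr r 1

/-- `{n}! = {n} {n-1} ⋯ {1}`. -/
def qfact (r n : ℕ) : ℂ := ∏ k ∈ Finset.range n, qbr r (k + 1)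

/-- `{1}^(2n) / {n}! * q ^ (n (n-1) / 2)`. -/
def rcoef (r n : ℕ) : ℂ := qbr r 1 ^ (2 * n) / qfact r n * qpow r ((n : ℂ) * ((n : ℂ) - 1) / 2)

/-! ## Auxiliary facts on tensor products of linear maps -/

section LinearAlgebra

theorem map_comm {V V' W W' : Type} [AddCommGroup V] [Module ℂ V] [AddCommGroup V'] [Module ℂ V']
    [AddCommGroup W] [Module ℂ W] [AddCommGroup W'] [Module ℂ W']
    {f : V →ₗ[ℂ] V'} {g : W →ₗ[ℂ] W'} {a : Module.End ℂ V} {a' : Module.End ℂ V'}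
    {b : Module.End ℂ W} {b' : Module.End ℂ W'} (ha : f ∘ₗ a = a' ∘ₗ f) (hb : g ∘ₗ b = b' ∘ₗ g) :
    TensorProduct.map f g ∘ₗ TensorProduct.map a b =
      TensorProduct.map a' b' ∘ₗ TensorProduct.map f g := by
  rw [← TensorProduct.map_comp, ← TensorProduct.map_comp, ha, hb]

theorem comm_add {V V' : Type} [AddCommGroup V] [Module ℂ V] [AddCommGroup V'] [Module ℂ V']
    {f : V →ₗ[ℂ] V'} {a b : Module.End ℂ V} {a' b' : Module.End ℂ V'}
    (ha : f ∘ₗ a = a' ∘ₗ f) (hb : f ∘ₗ b = b' ∘ₗ f) : f ∘ₗ (a + b) = (a' + b') ∘ₗ f := by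
  rw [LinearMap.comp_add, LinearMap.add_comp, ha, hb]

variable {U V W : Type} [AddCommGroup U] [Module ℂ U] [AddCommGroup V] [Module ℂ V]
  [AddCommGroup W] [Module ℂ W]

theorem assoc_map (a : Module.End ℂ U) (b : Module.End ℂ V) (c : Module.End ℂ W)
    (x : (U ⊗[ℂ] V) ⊗[ℂ] W) :
    TensorProduct.assoc ℂ U V W (TensorProduct.map (TensorProduct.map a b) c x) =
      TensorProduct.map a (TensorProduct.map b c) (TensorProduct.assoc ℂ U V W x) :=
  LinearMap.congr_fun (f := (TensorProduct.assoc ℂ U V W).toLinearMap ∘ₗ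
      TensorProduct.map (TensorProduct.map a b) c)
    (g := TensorProduct.map a (TensorProduct.map b c) ∘ₗ
      (TensorProduct.assoc ℂ U V W).toLinearMap)
    (TensorProduct.ext_threefold fun _ _ _ => rfl) x

theorem assoc_E (e : Module.End ℂ U) (e' k' : Module.End ℂ V) (e'' k'' : Module.End ℂ W)
    (x : (U ⊗[ℂ] V) ⊗[ℂ] W) :
    TensorProduct.assoc ℂ U V W ((TensorProduct.map LinearMap.id e'' +
        TensorProduct.map (TensorProduct.map LinearMap.id e' + TensorProduct.map e k') k'' :
        Module.End ℂ ((U ⊗[ℂ] V) ⊗[ℂ] W)) x) =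
      (TensorProduct.map LinearMap.id
          (TensorProduct.map LinearMap.id e'' + TensorProduct.map e' k'') +
        TensorProduct.map e (TensorProduct.map k' k'') : Module.End ℂ (U ⊗[ℂ] (V ⊗[ℂ] W))) (TensorProduct.assoc ℂ U V W x) := by
  rw [← TensorProduct.map_id]
  simp only [TensorProduct.map_add_left, TensorProduct.map_add_right, LinearMap.add_apply,
    map_add, assoc_map, add_assoc]

theorem assoc_F (k f : Module.End ℂ U) (k' f' : Module.End ℂ V) (f'' : Module.End ℂ W)
    (x : (U ⊗[ℂ] V) ⊗[ℂ] W) :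
    TensorProduct.assoc ℂ U V W ((TensorProduct.map (TensorProduct.map k k') f'' +
        TensorProduct.map (TensorProduct.map k f' + TensorProduct.map f LinearMap.id)
          LinearMap.id : Module.End ℂ ((U ⊗[ℂ] V) ⊗[ℂ] W)) x) =
      (TensorProduct.map k (TensorProduct.map k' f'' + TensorProduct.map f' LinearMap.id) +
        TensorProduct.map f LinearMap.id : Module.End ℂ (U ⊗[ℂ] (V ⊗[ℂ] W)))
        (TensorProduct.assoc ℂ U V W x) := by
  rw [← TensorProduct.map_id (M := V) (N := W)]
  simp only [TensorProduct.map_add_left, TensorProduct.map_add_right, LinearMap.add_apply,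
    map_add, assoc_map, add_assoc]

theorem assoc_H (a : Module.End ℂ U) (b : Module.End ℂ V) (c : Module.End ℂ W)
    (x : (U ⊗[ℂ] V) ⊗[ℂ] W) :
    TensorProduct.assoc ℂ U V W ((TensorProduct.map (TensorProduct.map a LinearMap.id +
        TensorProduct.map LinearMap.id b) LinearMap.id + TensorProduct.map LinearMap.id c :
        Module.End ℂ ((U ⊗[ℂ] V) ⊗[ℂ] W)) x) =
      (TensorProduct.map a LinearMap.id + TensorProduct.map LinearMap.id
        (TensorProduct.map b LinearMap.id + TensorProduct.map LinearMap.id c) :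
          Module.End ℂ (U ⊗[ℂ] (V ⊗[ℂ] W)))
        (TensorProduct.assoc ℂ U V W x) := by
  rw [← TensorProduct.map_id (M := V) (N := W), ← TensorProduct.map_id (M := U) (N := V)]
  simp only [TensorProduct.map_add_left, TensorProduct.map_add_right, LinearMap.add_apply,
    map_add, assoc_map, add_assoc]

theorem lid_map (b : Module.End ℂ V) (x : ℂ ⊗[ℂ] V) :
    TensorProduct.lid ℂ V (TensorProduct.map LinearMap.id b x) = b (TensorProduct.lid ℂ V x) :=
  LinearMap.congr_fun (f := (TensorProduct.lid ℂ V).toLinearMap ∘ₗ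
      TensorProduct.map LinearMap.id b)
    (g := b ∘ₗ (TensorProduct.lid ℂ V).toLinearMap) (TensorProduct.ext' fun a y => by simp) x

theorem rid_map (b : Module.End ℂ V) (x : V ⊗[ℂ] ℂ) :
    TensorProduct.rid ℂ V (TensorProduct.map b LinearMap.id x) = b (TensorProduct.rid ℂ V x) :=
  LinearMap.congr_fun (f := (TensorProduct.rid ℂ V).toLinearMap ∘ₗ
      TensorProduct.map b LinearMap.id)
    (g := b ∘ₗ (TensorProduct.rid ℂ V).toLinearMap) (TensorProduct.ext' fun a y => by simp) x

theorem lid_map_add (b c : Module.End ℂ V) (x : ℂ ⊗[ℂ] V) :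
    TensorProduct.lid ℂ V ((TensorProduct.map LinearMap.id b + TensorProduct.map 0 c :
        Module.End ℂ (ℂ ⊗[ℂ] V)) x) =
      b (TensorProduct.lid ℂ V x) := by
  rw [TensorProduct.map_zero_left, add_zero, lid_map]

theorem lid_add_map (b c : Module.End ℂ V) (x : ℂ ⊗[ℂ] V) :
    TensorProduct.lid ℂ V ((TensorProduct.map 0 c + TensorProduct.map LinearMap.id b :
        Module.End ℂ (ℂ ⊗[ℂ] V)) x) =
      b (TensorProduct.lid ℂ V x) := by
  rw [TensorProduct.map_zero_left, zero_add, lid_map]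

theorem rid_map_add (b c : Module.End ℂ V) (x : V ⊗[ℂ] ℂ) :
    TensorProduct.rid ℂ V ((TensorProduct.map b LinearMap.id + TensorProduct.map c 0 :
        Module.End ℂ (V ⊗[ℂ] ℂ)) x) =
      b (TensorProduct.rid ℂ V x) := by
  rw [TensorProduct.map_zero_right, add_zero, rid_map]

theorem rid_add_map (b c : Module.End ℂ V) (x : V ⊗[ℂ] ℂ) :
    TensorProduct.rid ℂ V ((TensorProduct.map c 0 + TensorProduct.map b LinearMap.id :
        Module.End ℂ (V ⊗[ℂ] ℂ)) x) =
      b (TensorProduct.rid ℂ V x) := by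
  rw [TensorProduct.map_zero_right, zero_add, rid_map]

end LinearAlgebra

/-! ## Modules -/

/-- A finite dimensional complex vector space on which the generators `E, F, K, K⁻¹, H` act. -/
structure UMod : Type 1 where
  carrier : Type
  [addCommGroup : AddCommGroup carrier]
  [module : Module ℂ carrier]
  [finite : FiniteDimensional ℂ carrier]
  E : Module.End ℂ carrier
  F : Module.End ℂ carrier
  K : Module.End ℂ carrier
  Kinv : Module.End ℂ carrier
  H : Module.End ℂ carrier

namespace UMod

instance : CoeSort UMod Type := ⟨UMod.carrier⟩

attribute [instance] UMod.addCommGroup UMod.module UMod.finite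

/-- Linear maps commuting with the action of the generators. -/
structure Hom (X Y : UMod) : Type where
  map : X →ₗ[ℂ] Y
  comm_E : map ∘ₗ X.E = Y.E ∘ₗ map
  comm_F : map ∘ₗ X.F = Y.F ∘ₗ map
  comm_K : map ∘ₗ X.K = Y.K ∘ₗ map
  comm_Kinv : map ∘ₗ X.Kinv = Y.Kinv ∘ₗ map
  comm_H : map ∘ₗ X.H = Y.H ∘ₗ map

theorem Hom.ext' {X Y : UMod} {f g : Hom X Y} (h : f.map = g.map) : f = g := by
  cases f; cases g; cases h; rfl

/-- `X` is a finite dimensional weight module over the unrolled restricted quantum group: the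
defining relations hold, `H` is diagonalizable, and `K = q ^ H`. -/
structure IsWeight (r : ℕ) (X : UMod) : Prop where
  K_Kinv : X.K * X.Kinv = 1
  Kinv_K : X.Kinv * X.K = 1
  K_E : X.K * X.E * X.Kinv = qpow r 2 • X.E
  K_F : X.K * X.F * X.Kinv = qpow r (-2) • X.F
  E_F : X.E * X.F - X.F * X.E = (qpow r 1 - qpow r (-1))⁻¹ • (X.K - X.Kinv)
  H_K : X.H * X.K = X.K * X.H
  H_E : X.H * X.E - X.E * X.H = (2 : ℂ) • X.E
  H_F : X.H * X.F - X.F * X.H = (-2 : ℂ) • X.F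
  E_pow : X.E ^ r = 0
  F_pow : X.F ^ r = 0
  diag : ⨆ μ : ℂ, X.H.eigenspace μ = ⊤
  K_eq : ∀ (μ : ℂ) (v : X), X.H v = μ • v → X.K v = qpow r μ • v

/-- The tensor product, for the coproduct `Δ E = 1 ⊗ E + E ⊗ K`, `Δ F = K⁻¹ ⊗ F + F ⊗ 1`,
`Δ K = K ⊗ K`, `Δ H = H ⊗ 1 + 1 ⊗ H`. -/
def tensor (X Y : UMod) : UMod where
  carrier := X ⊗[ℂ] Y
  E := TensorProduct.map LinearMap.id Y.E + TensorProduct.map X.E Y.K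
  F := TensorProduct.map X.Kinv Y.F + TensorProduct.map X.F LinearMap.id
  K := TensorProduct.map X.K Y.K
  Kinv := TensorProduct.map X.Kinv Y.Kinv
  H := TensorProduct.map X.H LinearMap.id + TensorProduct.map LinearMap.id Y.H

/-- The trivial module, given by the counit. -/
def unit : UMod where
  carrier := ℂ
  E := 0
  F := 0
  K := LinearMap.id
  Kinv := LinearMap.id
  H := 0

/-- The dual module `V* = Hom(V, ℂ)` with `(x f)(v) = f (S x v)`, where `S E = - E K⁻¹`,
`S F = - K F`, `S K = K⁻¹`, `S H = - H`. -/
def dual (X : UMod) : UMod where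
  carrier := Module.Dual ℂ X
  E := Module.Dual.transpose (-(X.E * X.Kinv))
  F := Module.Dual.transpose (-(X.K * X.F))
  K := Module.Dual.transpose X.Kinv
  Kinv := Module.Dual.transpose X.K
  H := Module.Dual.transpose (-X.H)

instance : Category UMod where
  Hom := Hom
  id X := ⟨LinearMap.id, rfl, rfl, rfl, rfl, rfl⟩
  comp f g := ⟨g.map ∘ₗ f.map,
    by rw [LinearMap.comp_assoc, f.comm_E, ← LinearMap.comp_assoc, g.comm_E, LinearMap.comp_assoc],
    by rw [LinearMap.comp_assoc, f.comm_F, ← LinearMap.comp_assoc, g.comm_F, LinearMap.comp_assoc],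
    by rw [LinearMap.comp_assoc, f.comm_K, ← LinearMap.comp_assoc, g.comm_K, LinearMap.comp_assoc],
    by rw [LinearMap.comp_assoc, f.comm_Kinv, ← LinearMap.comp_assoc, g.comm_Kinv,
      LinearMap.comp_assoc],
    by rw [LinearMap.comp_assoc, f.comm_H, ← LinearMap.comp_assoc, g.comm_H, LinearMap.comp_assoc]⟩

@[ext] theorem hom_ext {X Y : UMod} {f g : X ⟶ Y} (h : Hom.map f = Hom.map g) : f = g :=
  Hom.ext' h

/-- The tensor product of two morphisms. -/
def tensorHom {X Y X' Y' : UMod} (f : Hom X Y) (g : Hom X' Y') :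
    Hom (X.tensor X') (Y.tensor Y') where
  map := TensorProduct.map f.map g.map
  comm_E := comm_add (map_comm rfl g.comm_E) (map_comm f.comm_E g.comm_K)
  comm_F := comm_add (map_comm f.comm_Kinv g.comm_F) (map_comm f.comm_F rfl)
  comm_K := map_comm f.comm_K g.comm_K
  comm_Kinv := map_comm f.comm_Kinv g.comm_Kinv
  comm_H := comm_add (map_comm f.comm_H rfl) (map_comm rfl g.comm_H)

/-- A linear equivalence commuting with the generators is an isomorphism. -/
def mkIso {X Y : UMod} (e : X ≃ₗ[ℂ] Y)
    (hE : ∀ v, e (X.E v) = Y.E (e v)) (hF : ∀ v, e (X.F v) = Y.F (e v))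
    (hK : ∀ v, e (X.K v) = Y.K (e v)) (hKinv : ∀ v, e (X.Kinv v) = Y.Kinv (e v))
    (hH : ∀ v, e (X.H v) = Y.H (e v)) : X ≅ Y where
  hom := ⟨e.toLinearMap, LinearMap.ext hE, LinearMap.ext hF, LinearMap.ext hK,
    LinearMap.ext hKinv, LinearMap.ext hH⟩
  inv := ⟨e.symm.toLinearMap,
    LinearMap.ext fun v => e.injective (by simp [hE]),
    LinearMap.ext fun v => e.injective (by simp [hF]),
    LinearMap.ext fun v => e.injective (by simp [hK]),
    LinearMap.ext fun v => e.injective (by simp [hKinv]),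
    LinearMap.ext fun v => e.injective (by simp [hH])⟩
  hom_inv_id := hom_ext (LinearMap.ext fun v => e.symm_apply_apply v)
  inv_hom_id := hom_ext (LinearMap.ext fun v => e.apply_symm_apply v)

/-- The canonical isomorphism `(X ⊗ Y) ⊗ Z ≅ X ⊗ (Y ⊗ Z)`. -/
def assocIso (X Y Z : UMod) : (X.tensor Y).tensor Z ≅ X.tensor (Y.tensor Z) :=
  mkIso (X := (X.tensor Y).tensor Z) (Y := X.tensor (Y.tensor Z)) (TensorProduct.assoc ℂ X Y Z)
    (assoc_E X.E Y.E Y.K Z.E Z.K) (assoc_F X.Kinv X.F Y.Kinv Y.F Z.F)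
    (assoc_map X.K Y.K Z.K) (assoc_map X.Kinv Y.Kinv Z.Kinv)
    (fun v => (assoc_H X.H Y.H Z.H v))

/-- The canonical isomorphism `ℂ ⊗ X ≅ X`. -/
def lidIso (X : UMod) : unit.tensor X ≅ X :=
  mkIso (X := unit.tensor X) (TensorProduct.lid ℂ X)
    (lid_map_add X.E X.K) (fun v => (lid_map_add X.F LinearMap.id v)) (lid_map X.K)
    (lid_map X.Kinv) (lid_add_map X.H LinearMap.id)

/-- The canonical isomorphism `X ⊗ ℂ ≅ X`. -/
def ridIso (X : UMod) : X.tensor unit ≅ X :=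
  mkIso (X := X.tensor unit) (TensorProduct.rid ℂ X)
    (rid_add_map X.E LinearMap.id) (rid_add_map X.F X.Kinv) (rid_map X.K)
    (rid_map X.Kinv) (rid_map_add X.H LinearMap.id)

instance : MonoidalCategoryStruct UMod where
  tensorObj := tensor
  whiskerLeft X _ _ f := tensorHom (𝟙 X) f
  whiskerRight f Y := tensorHom f (𝟙 Y)
  tensorHom f g := tensorHom f g
  tensorUnit := unit
  associator := assocIso
  leftUnitor := lidIso
  rightUnitor := ridIso

instance : MonoidalCategory UMod := MonoidalCategory.ofTensorHom
  (id_tensorHom_id := fun _ _ => hom_ext TensorProduct.map_id)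
  (id_tensorHom := fun _ {_ _} _ => rfl)
  (tensorHom_id := fun _ _ => rfl)
  (tensorHom_comp_tensorHom := fun _ _ _ _ =>
    hom_ext (TensorProduct.map_comp _ _ _ _).symm)
  (associator_naturality := fun _ _ _ =>
    hom_ext (TensorProduct.ext_threefold fun _ _ _ => rfl))
  (leftUnitor_naturality := fun f => hom_ext (TensorProduct.ext' fun a x =>
    ((Hom.map f).map_smul (show ℂ from a) x).symm))
  (rightUnitor_naturality := fun f => hom_ext (TensorProduct.ext' fun x a =>
    ((Hom.map f).map_smul (show ℂ from a) x).symm))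
  (pentagon := fun _ _ _ _ => hom_ext (TensorProduct.ext_fourfold fun _ _ _ _ => rfl))
  (triangle := fun _ _ => hom_ext (TensorProduct.ext_threefold fun x a y =>
    (TensorProduct.smul_tmul (show ℂ from a) x y).symm))

/-! ## Braiding and twist -/

open Classical in
/-- The weights of `X`. -/
def weights (X : UMod) : Finset ℂ := X.H.finite_hasEigenvalue.toFinset

open Classical in
/-- The operator `φ(H)`, which multiplies a vector of weight `μ` by `φ μ`. -/
def funH (X : UMod) (φ : ℂ → ℂ) : Module.End ℂ X :=
  Polynomial.aeval X.H (Lagrange.interpolate X.weights id φ)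

open Classical in
/-- The operator `q ^ (H ⊗ H / 2)`, which multiplies `v ⊗ w` by `q ^ (λ μ / 2)` for `v` of weight
`λ` and `w` of weight `μ`. -/
def qHH (r : ℕ) (X Y : UMod) : X ⊗[ℂ] Y →ₗ[ℂ] X ⊗[ℂ] Y :=
  ∑ a ∈ X.weights, TensorProduct.map (X.funH fun b => if b = a then 1 else 0)
    (Y.funH fun b => qpow r (a * b / 2))

/-- The action of the `R`-matrix. -/
def Rmat (r : ℕ) (X Y : UMod) : X ⊗[ℂ] Y →ₗ[ℂ] X ⊗[ℂ] Y :=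
  qHH r X Y ∘ₗ ∑ n ∈ Finset.range r, rcoef r n • TensorProduct.map (X.E ^ n) (Y.F ^ n)

/-- The braiding `v ⊗ w ↦ τ (R (v ⊗ w))`. -/
def braid (r : ℕ) (X Y : UMod) : X ⊗[ℂ] Y →ₗ[ℂ] Y ⊗[ℂ] X :=
  (TensorProduct.comm ℂ X Y).toLinearMap ∘ₗ Rmat r X Y

/-- The operator `θ = K^(r-1) ∑ₙ {1}^(2n) / {n}! q^(n(n-1)/2) S(Fⁿ) q^(-H²/2) Eⁿ`; the twist is
its inverse. -/
def theta (r : ℕ) (X : UMod) : Module.End ℂ X :=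
  X.K ^ (r - 1) * ∑ n ∈ Finset.range r, rcoef r n •
    ((-(X.K * X.F)) ^ n * X.funH (fun a => qpow r (-a ^ 2 / 2)) * X.E ^ n)

/-- `1 ↦ ∑ vᵢ ⊗ vᵢ*`. -/
def coev (X : UMod) : ℂ →ₗ[ℂ] X ⊗[ℂ] Module.Dual ℂ X := coevaluation ℂ X

/-- `f ⊗ w ↦ f w`. -/
def ev (X : UMod) : Module.Dual ℂ X ⊗[ℂ] X →ₗ[ℂ] ℂ := contractLeft ℂ X

/-! ## The generating modules -/

/-- `X` has a basis `b₀, …, b_{d-1}` with `H bᵢ = (top - 2 i) bᵢ`, `E bᵢ = c i bᵢ₋₁`,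
`F bᵢ = bᵢ₊₁`, where `b₋₁ = b_d = 0`. -/
def IsLadder (d : ℕ) (top : ℂ) (c : ℕ → ℂ) (X : UMod) : Prop :=
  ∃ b : Module.Basis (Fin d) ℂ X,
    (∀ i : Fin d, X.H (b i) = (top - 2 * (i : ℕ)) • b i) ∧
    (∀ i : Fin d, (i : ℕ) = 0 → X.E (b i) = 0) ∧
    (∀ i j : Fin d, (j : ℕ) + 1 = i → X.E (b i) = c i • b j) ∧
    (∀ i j : Fin d, (i : ℕ) + 1 = j → X.F (b i) = b j) ∧
    (∀ i : Fin d, (i : ℕ) + 1 = d → X.F (b i) = 0)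

/-- `X` is isomorphic to `V_α`, the `r`-dimensional module of highest weight `α + r - 1`. -/
def IsV (r : ℕ) (α : ℂ) (X : UMod) : Prop :=
  IsWeight r X ∧
    IsLadder r (α + r - 1) (fun i => qbr r i * qbr r (i - α) / qbr r 1 ^ 2) X

/-- `X` is isomorphic to the simple module `S_n` of highest weight `n` and dimension `n + 1`. -/
def IsS (r n : ℕ) (X : UMod) : Prop :=
  IsWeight r X ∧
    IsLadder (n + 1) n (fun i => qbr r i * qbr r ((n : ℂ) + 1 - i) / qbr r 1 ^ 2) X

/-- `X` is isomorphic to the one dimensional module `ℂ^H_{ar}`. -/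
def IsC (r : ℕ) (a : ℤ) (X : UMod) : Prop :=
  IsWeight r X ∧ Module.finrank ℂ X = 1 ∧ X.E = 0 ∧ X.F = 0 ∧
    ∀ v, X.H v = ((a : ℂ) * r) • v

/-- `γ_{n,k} = [k] [n - k + 1]`. -/
def gam (r n k : ℕ) : ℂ := qnum r k * qnum r ((n : ℂ) - k + 1)

/-- `X` is isomorphic to `P_i`, the indecomposable projective module of dimension `2 r` and highest
weight `2 r - 2 - i`, given by its standard basis: with `j = r - 2 - i`, the vectors `wH k` and
`wS k` (`k ≤ i`) have weight `i - 2 k`, the vectors `wL k` (`k ≤ j`) have weight `j - r - 2 k`, and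
the vectors `wR k` (`k ≤ j`) have weight `j + r - 2 k`. -/
def IsP (r i : ℕ) (X : UMod) : Prop :=
  IsWeight r X ∧ ∃ j : ℕ, i + j + 2 = r ∧ ∃ wH wS wL wR : ℕ → X,
    (∃ b : Module.Basis ((Fin (i + 1) ⊕ Fin (i + 1)) ⊕ (Fin (j + 1) ⊕ Fin (j + 1))) ℂ X,
      (∀ k : Fin (i + 1), b (Sum.inl (Sum.inl k)) = wH k ∧ b (Sum.inl (Sum.inr k)) = wS k) ∧
      (∀ k : Fin (j + 1), b (Sum.inr (Sum.inl k)) = wL k ∧ b (Sum.inr (Sum.inr k)) = wR k)) ∧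
    (∀ k ≤ i, X.H (wH k) = ((i : ℂ) - 2 * k) • wH k ∧ X.H (wS k) = ((i : ℂ) - 2 * k) • wS k) ∧
    (∀ k ≤ j, X.H (wL k) = ((j : ℂ) - r - 2 * k) • wL k ∧
      X.H (wR k) = ((j : ℂ) + r - 2 * k) • wR k) ∧
    X.E (wH 0) = wR j ∧ X.E (wS 0) = 0 ∧ X.E (wL 0) = wS i ∧ X.E (wR 0) = 0 ∧
    (∀ k < i, X.E (wH (k + 1)) = gam r i (k + 1) • wH k + wS k ∧
      X.E (wS (k + 1)) = gam r i (k + 1) • wS k) ∧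
    (∀ k < j, X.E (wL (k + 1)) = -gam r j (k + 1) • wL k ∧ X.E (wR (k + 1)) = wR k) ∧
    X.F (wH i) = wL 0 ∧ X.F (wS i) = 0 ∧ X.F (wL j) = 0 ∧ X.F (wR j) = wS 0 ∧
    (∀ k < i, X.F (wH k) = wH (k + 1) ∧ X.F (wS k) = wS (k + 1)) ∧
    (∀ k < j, X.F (wL k) = wL (k + 1) ∧ X.F (wR k) = -gam r j (k + 1) • wR (k + 1))

/-- The set `A` of generating modules (up to isomorphism). -/
inductive InA (r : ℕ) : UMod → Prop
  | V (α : ℝ) (hα : (∀ m : ℤ, α ≠ m) ∨ ∃ m : ℤ, α = r * m) (X : UMod) (h : IsV r α X) : InA r X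
  | S (n : ℕ) (hn : n + 2 ≤ r) (X : UMod) (h : IsS r n X) : InA r X
  | P (i : ℕ) (hi : i + 2 ≤ r) (X : UMod) (h : IsP r i X) : InA r X
  | C (a : ℤ) (X : UMod) (h : IsC r a X) : InA r X

/-- Tensor products `X₁ ⊗ ⋯ ⊗ X_p` (`p ≥ 1`) of modules in `A ∪ A*`. -/
inductive TensorWord (r : ℕ) : UMod → Prop
  | of (X : UMod) (h : InA r X) : TensorWord r X
  | ofDual (X : UMod) (h : InA r X) : TensorWord r X.dual
  | tensor (X Y : UMod) (hX : TensorWord r X) (hY : TensorWord r Y) : TensorWord r (X.tensor Y)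

/-- `X` is a retract of `Y`. -/
def IsRetract (X Y : UMod) : Prop :=
  ∃ (i : Hom X Y) (p : Hom Y X), p.map ∘ₗ i.map = LinearMap.id

/-- `X` lies in the subcategory generated by `A`: it is a finite direct sum of retracts of tensor
products of modules in `A ∪ A*`. -/
def InD (r : ℕ) (X : UMod) : Prop :=
  ∃ (n : ℕ) (Y : Fin n → UMod) (i : ∀ a, Hom (Y a) X) (p : ∀ a, Hom X (Y a)),
    (∀ a, ∃ W, TensorWord r W ∧ IsRetract (Y a) W) ∧
    (∀ a, (p a).map ∘ₗ (i a).map = LinearMap.id) ∧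
    (∀ a b, a ≠ b → (p a).map ∘ₗ (i b).map = 0) ∧
    ∑ a, (i a).map ∘ₗ (p a).map = LinearMap.id

end UMod

/-! ## The half twist -/

open UMod

/-- `h` is the half twist on the category of weight modules (its values on other objects of `UMod`
are irrelevant): a natural automorphism by module maps of the identity functor whose square is the
twist, compatible with duals and with the unit, and given on the simple modules `V_α` and
`S_i ⊗ ℂ^H_{kr}` by the prescribed scalars. -/
structure IsHalfTwist (r : ℕ) (h : ∀ X : UMod, X ≃ₗ[ℂ] X) : Prop where
  natural : ∀ X Y : UMod, IsWeight r X → IsWeight r Y → ∀ (f : Hom X Y) (v : X),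
    f.map (h X v) = h Y (f.map v)
  isHom : ∀ X : UMod, IsWeight r X → ∃ f : Hom X X, f.map = (h X).toLinearMap
  sq : ∀ X : UMod, IsWeight r X → ∀ v : X, theta r X (h X (h X v)) = v
  dual : ∀ X : UMod, IsWeight r X →
    (h X.dual).toLinearMap = Module.Dual.transpose (R := ℂ) (h X).toLinearMap
  unit : ∀ z : UMod.unit, h UMod.unit z = z
  typical : ∀ α : ℂ, ((∀ m : ℤ, α ≠ m) ∨ ∃ m : ℤ, α = r * m) → ∀ X : UMod, IsV r α X →
    ∀ v : X, h X v = qpow r ((α ^ 2 - ((r : ℂ) - 1) ^ 2) / 4) • v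
  atypical_even : ∀ (i : ℕ) (k : ℤ), i + 2 ≤ r → Even k → ∀ X Y : UMod, IsS r i X → IsC r k Y →
    ∀ v : X.tensor Y, h (X.tensor Y) v = qpow r ((i : ℂ) * (i + 2 - 2 * r) / 4) • v
  atypical_odd : ∀ (i j : ℕ) (k : ℤ), i + j + 2 = r → Odd k → ∀ X Y : UMod, IsS r i X →
    IsC r k Y → ∀ v : X.tensor Y,
      h (X.tensor Y) v = qpow r ((j : ℂ) * (j + 2 - 2 * r) / 4) • v

/-- The isomorphism `X_{V,W} = √θ_{W ⊗ V}⁻¹ c_{V,W} (√θ_V ⊗ √θ_W)`. -/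
def swapX (r : ℕ) (h : ∀ X : UMod, X ≃ₗ[ℂ] X) (V W : UMod) : V ⊗[ℂ] W →ₗ[ℂ] W ⊗[ℂ] V :=
  (h (W.tensor V)).symm.toLinearMap ∘ₗ braid r V W ∘ₗ
    TensorProduct.map (h V).toLinearMap (h W).toLinearMap

/-! ## Hermitian modules -/

/-- An object of `UMod` with a sesquilinear form, antilinear in the first variable. -/
structure HMod : Type 1 extends UMod where
  form : carrier →ₗ⋆[ℂ] carrier →ₗ[ℂ] ℂ

namespace HMod

/-- The form is a Hermitian structure: Hermitian, non-degenerate, and compatible with the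
antilinear anti-automorphism `E ↦ F`, `F ↦ E`, `K ↦ K⁻¹`, `H ↦ H`. -/
structure IsHermitian (X : HMod) : Prop where
  symm : ∀ v w, X.form v w = starRingEnd ℂ (X.form w v)
  nondeg : ∀ v, (∀ w, X.form v w = 0) → v = 0
  form_E : ∀ v w, X.form (X.F v) w = X.form v (X.E w)
  form_F : ∀ v w, X.form (X.E v) w = X.form v (X.F w)
  form_K : ∀ v w, X.form (X.Kinv v) w = X.form v (X.K w)
  form_Kinv : ∀ v w, X.form (X.K v) w = X.form v (X.Kinv w)
  form_H : ∀ v w, X.form (X.H v) w = X.form v (X.H w)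

/-- The form `(x ⊗ y, x' ⊗ y')_p = (x, x') (y, y')`. -/
def formP (X Y : HMod) : X.carrier ⊗[ℂ] Y.carrier →ₗ⋆[ℂ] X.carrier ⊗[ℂ] Y.carrier →ₗ[ℂ] ℂ :=
  (TensorProduct.map₂ X.form Y.form).compr₂ₛₗ (LinearMap.mul' ℂ ℂ)

/-- The tensor product, with the form `(v, v') = (v, τ (X_{V,W} v'))_p`. -/
def tensor (r : ℕ) (h : ∀ X : UMod, X ≃ₗ[ℂ] X) (X Y : HMod) : HMod where
  toUMod := X.toUMod.tensor Y.toUMod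
  form := (formP X Y).compl₂ ((TensorProduct.comm ℂ Y.carrier X.carrier).toLinearMap ∘ₗ
    swapX r h X.toUMod Y.toUMod)

/-- The form on `ℂ` with `(1, 1) = 1`. -/
def unitForm : ℂ →ₗ⋆[ℂ] ℂ →ₗ[ℂ] ℂ :=
  LinearMap.mk₂'ₛₗ (starRingEnd ℂ) (RingHom.id ℂ)
    (fun z w : ℂ => starRingEnd ℂ z * w)
    (fun z z' w => by simp [add_mul]) (fun c z w => by simp [mul_assoc])
    (fun z w w' => by simp [mul_add]) (fun c z w => by simp [mul_left_comm])

/-- The unit object. -/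
def unit : HMod where
  toUMod := UMod.unit
  form := unitForm

/-- A basis of `X`. -/
def dualBasisL (X : HMod) : Fin (Module.finrank ℂ X.carrier) → X.carrier :=
  Module.finBasis ℂ X.carrier

/-- The dual basis `e'` of `e = dualBasisL X` for the form: `(e' i, e j) = δ i j`. -/
def dualBasisR (X : HMod) (i : Fin (Module.finrank ℂ X.carrier)) : X.carrier :=
  ∑ j, starRingEnd ℂ ((Matrix.of fun a b => X.form (dualBasisL X a) (dualBasisL X b))⁻¹ i j) •
    dualBasisL X j

/-- The form `(φ, ψ) = ∑ᵢ conj (φ (eᵢ)) ψ (e'ᵢ)` on the dual space. -/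
def dualForm (X : HMod) : Module.Dual ℂ X.carrier →ₗ⋆[ℂ] Module.Dual ℂ X.carrier →ₗ[ℂ] ℂ :=
  LinearMap.mk₂'ₛₗ (starRingEnd ℂ) (RingHom.id ℂ)
    (fun φ ψ : Module.Dual ℂ X.carrier =>
      ∑ i, starRingEnd ℂ (φ (dualBasisL X i)) * ψ (dualBasisR X i))
    (fun φ φ' ψ => by simp [add_mul, Finset.sum_add_distrib])
    (fun c φ ψ => by simp [Finset.mul_sum, mul_assoc])
    (fun φ ψ ψ' => by simp [mul_add, Finset.sum_add_distrib])
    (fun c φ ψ => by simp [Finset.mul_sum, mul_left_comm])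

/-- The dual module, with the form `dualForm`. -/
def dual (X : HMod) : HMod where
  toUMod := X.toUMod.dual
  form := dualForm X

end HMod

/-! ## The category `𝒟†` -/

/-- The objects of `𝒟†`: weight modules lying in `𝒟`, with a Hermitian structure. -/
structure IsDDagger (r : ℕ) (X : HMod) : Prop where
  isWeight : IsWeight r X.toUMod
  inD : InD r X.toUMod
  isHermitian : X.IsHermitian

/-- The category `𝒟†`; its morphisms are all module maps. -/
structure DDagger (r : ℕ) : Type 1 where
  obj : HMod
  mem : IsDDagger r obj

/-- Hermitian modules in `𝒟` are closed under unit, tensor product and dual. -/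
structure ClosedUnderTensor (r : ℕ) (h : ∀ X : UMod, X ≃ₗ[ℂ] X) : Prop where
  unit : IsDDagger r HMod.unit
  tensor : ∀ X Y : HMod, IsDDagger r X → IsDDagger r Y → IsDDagger r (HMod.tensor r h X Y)
  dual : ∀ X : HMod, IsDDagger r X → IsDDagger r X.dual

namespace DDagger

instance (r : ℕ) : Category (DDagger r) where
  Hom V W := UMod.Hom V.obj.toUMod W.obj.toUMod
  id V := 𝟙 V.obj.toUMod
  comp f g := CategoryStruct.comp (obj := UMod) f g

variable {r : ℕ} {h : ∀ X : UMod, X ≃ₗ[ℂ] X}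

/-- The linear map underlying a morphism of `𝒟†`. -/
def toLin {V W : DDagger r} (f : V ⟶ W) : V.obj.carrier →ₗ[ℂ] W.obj.carrier := UMod.Hom.map f

/-- An isomorphism of underlying modules is an isomorphism in `𝒟†`. -/
def isoOf {V W : DDagger r} (e : V.obj.toUMod ≅ W.obj.toUMod) : V ≅ W where
  hom := e.hom
  inv := e.inv
  hom_inv_id := e.hom_inv_id
  inv_hom_id := e.inv_hom_id

/-- The dual object. -/
def dual (hc : ClosedUnderTensor r h) (V : DDagger r) : DDagger r :=
  ⟨V.obj.dual, hc.dual _ V.mem⟩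

/-- The monoidal structure: tensor product of Hermitian modules on objects, and the tensor product
of linear maps on morphisms, with the usual associativity and unit isomorphisms. -/
@[reducible]
def monoidalStruct (hc : ClosedUnderTensor r h) : MonoidalCategoryStruct (DDagger r) where
  tensorObj V W := ⟨HMod.tensor r h V.obj W.obj, hc.tensor _ _ V.mem W.mem⟩
  whiskerLeft V _ _ f := UMod.tensorHom (𝟙 V.obj.toUMod) f
  whiskerRight f W := UMod.tensorHom f (𝟙 W.obj.toUMod)
  tensorHom f g := UMod.tensorHom f g
  tensorUnit := ⟨HMod.unit, hc.unit⟩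
  associator U V W := isoOf (UMod.assocIso U.obj.toUMod V.obj.toUMod W.obj.toUMod)
  leftUnitor V := isoOf (UMod.lidIso V.obj.toUMod)
  rightUnitor V := isoOf (UMod.ridIso V.obj.toUMod)

/-- `𝒟†` as a monoidal category. -/
@[reducible]
def monoidal (hc : ClosedUnderTensor r h) : MonoidalCategory (DDagger r) :=
  letI := monoidalStruct hc
  MonoidalCategory.ofTensorHom
    (id_tensorHom_id := fun _ _ => UMod.Hom.ext' TensorProduct.map_id)
    (id_tensorHom := fun _ {_ _} _ => rfl)
    (tensorHom_id := fun _ _ => rfl)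
    (tensorHom_comp_tensorHom := fun _ _ _ _ =>
      UMod.Hom.ext' (TensorProduct.map_comp _ _ _ _).symm)
    (associator_naturality := fun f₁ f₂ f₃ =>
      MonoidalCategory.associator_naturality (C := UMod) f₁ f₂ f₃)
    (leftUnitor_naturality := fun f => MonoidalCategory.leftUnitor_naturality (C := UMod) f)
    (rightUnitor_naturality := fun f => MonoidalCategory.rightUnitor_naturality (C := UMod) f)
    (pentagon := fun U V W Z => MonoidalCategory.pentagon (C := UMod)
      U.obj.toUMod V.obj.toUMod W.obj.toUMod Z.obj.toUMod)
    (triangle := fun V W => MonoidalCategory.triangle (C := UMod) V.obj.toUMod W.obj.toUMod)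

end DDagger

end UnrolledSl2

end

open UnrolledSl2

/-! On vectors of a fixed weight `x`, the twist and its square root are polynomials in the Casimir
operator `C = {1}² F E + q K + q⁻¹ K⁻¹`. There `{1}^(2n) Fⁿ Eⁿ` equals `∏_{k<n} (C - cas (x + 2k))`
(`F_pow_E_pow`), so `E^r = 0` makes `blockPoly` annihilate `C`; its roots are `cas (x + 2j)` for `j
< r`. The operator `theta` acts by `twistPoly`, whose value at `cas (x + 2j)` is the scalar attached
to a highest weight `x + 2j` (`eval_twistPoly`, a `q`-binomial identity).

A half twist therefore amounts to an inverse square root of `twistPoly` modulo `blockPoly` for every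
`x`, with prescribed values at the roots. Coinciding roots belong to atypical weights, where the
prescribed values agree (`halfVal_eq_of_cas_eq`). Roots have multiplicity at most two, so one Newton
step turns an interpolating polynomial into a genuine square root. Such a root is determined by its
values (`blockPoly_dvd_sub_of_sq`). Hence its behaviour under `x ↦ -x` (duals), `x ↦ x + 2`
(commutation with `E` and `F`) and complex conjugation (unitarity for invariant forms) is read off
from the values and from the same behaviour of `twistPoly`. The latter is checked for non-integral
`x`, where the roots are distinct, and extended by continuity (`blockPoly_dvd_of_generic`).

The braiding is handled by `q`-exponential identities: conjugating the coefficients of `R` gives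
those of its inverse, and the `q`-binomial theorem gives the hexagons. The behaviour of the twist on
tensor products (`theta_tensor`) comes from a graphical argument, the Drinfeld element being
characterised by `ev ∘ c`.

The anti-automorphism defining Hermitian structures reverses the coproduct, so the product form
pairs `X ⊗ Y` invariantly with `Y ⊗ X`. Composing with the symmetry `X_{V,W}` corrects this. The
symmetry is involutive (`swap_swap`), and the resulting form is Hermitian because the half twist is
unitary and the adjoint of a braiding is an inverse braiding (`pairing_braid`). Unitarity of the
associator is the hexagon of a coboundary category (`coboundary_hexagon`). Finally evaluation and
coevaluation are adjoint for the product pairing (`pairing_coev`), and moving them through the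
symmetry produces the stated formulas. -/

noncomputable section

namespace UnrolledSl2

/-! ## Scalars -/

theorem qpow_add (r : ℕ) (x y : ℂ) : qpow r (x + y) = qpow r x * qpow r y := by
  simp only [qpow, ← Complex.exp_add]; congr 1; ring

theorem qpow_zero (r : ℕ) : qpow r 0 = 1 := by simp [qpow]

theorem qpow_ne_zero (r : ℕ) (x : ℂ) : qpow r x ≠ 0 := Complex.exp_ne_zero _

theorem qpow_neg (r : ℕ) (x : ℂ) : qpow r (-x) = (qpow r x)⁻¹ := by
  exact eq_inv_of_mul_eq_one_left (by rw [← qpow_add, neg_add_cancel, qpow_zero])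

theorem qpow_nat_mul (r n : ℕ) (x : ℂ) : qpow r (n * x) = qpow r x ^ n := by
  simp only [qpow, ← Complex.exp_nat_mul]; congr 1; ring

theorem conj_qpow (r : ℕ) (x : ℂ) :
    starRingEnd ℂ (qpow r x) = qpow r (-starRingEnd ℂ x) := by
  simp only [qpow, ← Complex.exp_conj]
  congr 1
  simp [Complex.conj_ofReal]

theorem qpow_eq_one_iff {r : ℕ} (hr : r ≠ 0) (x : ℂ) :
    qpow r x = 1 ↔ ∃ m : ℤ, x = 2 * r * m := by
  have hr' : (r : ℂ) ≠ 0 := Nat.cast_ne_zero.mpr hr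
  have hpi : (Real.pi : ℂ) ≠ 0 := Complex.ofReal_ne_zero.mpr Real.pi_ne_zero
  rw [qpow, Complex.exp_eq_one_iff]
  refine exists_congr fun m => ?_
  rw [div_eq_iff hr']
  constructor
  · intro h
    apply mul_left_cancel₀ (mul_ne_zero hpi Complex.I_ne_zero)
    rw [h]; ring
  · rintro rfl; ring

theorem qpow_two_mul_int {r : ℕ} (hr : r ≠ 0) (m : ℤ) : qpow r (2 * r * m) = 1 :=
  (qpow_eq_one_iff hr _).mpr ⟨m, rfl⟩

theorem qpow_congr {r : ℕ} (hr : r ≠ 0) {x y : ℂ} (m : ℤ) (h : x = y + 2 * r * m) :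
    qpow r x = qpow r y := by
  rw [h, qpow_add, qpow_two_mul_int hr, mul_one]

theorem continuous_qpow (r : ℕ) : Continuous (qpow r) := by
  unfold qpow; fun_prop

theorem eq_inv_iff_mul_eq_one {x y : ℂ} (hy : y ≠ 0) : x = y⁻¹ ↔ x * y = 1 :=
  ⟨fun h => by rw [h, inv_mul_cancel₀ hy], eq_inv_of_mul_eq_one_left⟩

theorem qbr_eq_zero_iff {r : ℕ} (hr : r ≠ 0) (x : ℂ) : qbr r x = 0 ↔ ∃ m : ℤ, x = r * m := by
  rw [qbr, sub_eq_zero, qpow_neg, eq_inv_iff_mul_eq_one (qpow_ne_zero r x), ← qpow_add,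
    qpow_eq_one_iff hr]
  refine exists_congr fun m => ⟨fun h => ?_, fun h => by rw [h]; ring⟩
  linear_combination h / 2

theorem qbr_natCast_ne_zero {r n : ℕ} (hn : 0 < n) (h : n < r) : qbr r n ≠ 0 := by
  rw [Ne, qbr_eq_zero_iff (by omega)]
  rintro ⟨m, hm⟩
  have hm' : (n : ℤ) = r * m := by exact_mod_cast hm
  have h1 : 0 < (r : ℤ) * m := by omega
  have h2 : 0 < m := pos_of_mul_pos_right h1 (by omega)
  nlinarith

theorem qbr_self {r : ℕ} (hr : r ≠ 0) : qbr r r = 0 :=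
  (qbr_eq_zero_iff hr _).mpr ⟨1, by simp⟩

theorem qbr_one_ne_zero {r : ℕ} (hr : 2 ≤ r) : qbr r 1 ≠ 0 := by
  have := qbr_natCast_ne_zero (r := r) (n := 1) one_pos (by omega)
  simpa using this

theorem qbr_neg (r : ℕ) (x : ℂ) : qbr r (-x) = -qbr r x := by simp [qbr]

theorem conj_qbr (r : ℕ) (x : ℂ) : starRingEnd ℂ (qbr r x) = -qbr r (starRingEnd ℂ x) := by
  simp [qbr, conj_qpow]

theorem qfact_zero (r : ℕ) : qfact r 0 = 1 := by simp [qfact]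

theorem qfact_succ (r n : ℕ) : qfact r (n + 1) = qfact r n * qbr r (n + 1) := by
  simp [qfact, Finset.prod_range_succ]

theorem qfact_ne_zero {r n : ℕ} (h : n < r) : qfact r n ≠ 0 := by
  rw [qfact, Finset.prod_ne_zero_iff]
  intro k hk
  have hk := Finset.mem_range.mp hk
  simpa using qbr_natCast_ne_zero (r := r) (n := k + 1) (by omega) (by omega)

theorem qfact_self {r : ℕ} (hr : r ≠ 0) : qfact r r = 0 := by
  obtain ⟨n, rfl⟩ := Nat.exists_eq_succ_of_ne_zero hr
  have := qbr_self hr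
  rw [Nat.succ_eq_add_one] at this ⊢
  rw [qfact_succ]
  push_cast at this
  rw [this, mul_zero]

theorem rcoef_zero (r : ℕ) : rcoef r 0 = 1 := by simp [rcoef, qfact_zero, qpow_zero]

theorem rcoef_succ {r n : ℕ} (h : n + 1 < r) :
    rcoef r (n + 1) * qbr r (n + 1) = rcoef r n * qbr r 1 ^ 2 * qpow r n := by
  have h1 := qfact_ne_zero (r := r) (n := n) (by omega)
  have h2 : qbr r ((n : ℂ) + 1) ≠ 0 := by
    simpa using qbr_natCast_ne_zero (r := r) (n := n + 1) (by omega) h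
  have : qpow r (((n + 1 : ℕ) : ℂ) * (((n + 1 : ℕ) : ℂ) - 1) / 2) =
      qpow r ((n : ℂ) * ((n : ℂ) - 1) / 2) * qpow r n := by
    rw [← qpow_add]; congr 1; push_cast; ring
  rw [rcoef, rcoef, this, qfact_succ]
  field_simp
  ring

/-- Conjugation sends `q` to `q⁻¹` and changes the sign of each bracket; the even power of `{1}` is
unaffected, which leaves one sign. -/
theorem conj_rcoef_succ {r n : ℕ} (h : n + 1 < r) :
    starRingEnd ℂ (rcoef r (n + 1)) * qbr r (n + 1) =
      -(starRingEnd ℂ (rcoef r n) * qbr r 1 ^ 2 * qpow r (-n)) := by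
  have := congrArg (starRingEnd ℂ) (rcoef_succ h)
  simp only [map_mul, map_pow, conj_qbr, conj_qpow, map_add, map_one, map_natCast] at this
  linear_combination -this

theorem qbr_add (r : ℕ) (x y : ℂ) :
    qbr r (x + y) = qpow r y * qbr r x + qpow r (-x) * qbr r y := by
  simp only [qbr, mul_sub, ← qpow_add]; ring_nf

/-- The conjugate coefficients are those of the inverse `q`-exponential. After multiplication by
`{N}`, the rule `{a + b} = q^b {a} + q^(-a) {b}` splits the sum in two; the recursions for `rcoef`
and its conjugate turn both halves into the same sum with opposite signs. This yields the inverse of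
the `R`-matrix. -/
theorem sum_antidiagonal_conj_rcoef_mul_rcoef {r N : ℕ} (h0 : 0 < N) (hN : N < r) :
    ∑ p ∈ Finset.HasAntidiagonal.antidiagonal N, starRingEnd ℂ (rcoef r p.1) * rcoef r p.2 = 0 := by
  obtain ⟨N, rfl⟩ := Nat.exists_eq_succ_of_ne_zero h0.ne'
  have hb : qbr r ((N + 1 : ℕ) : ℂ) ≠ 0 := qbr_natCast_ne_zero h0 hN
  refine (mul_eq_zero.mp ?_).resolve_left hb
  rw [Finset.mul_sum]
  have step : ∀ p ∈ Finset.HasAntidiagonal.antidiagonal (N + 1),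
      qbr r ((N + 1 : ℕ) : ℂ) * (starRingEnd ℂ (rcoef r p.1) * rcoef r p.2) =
        qpow r p.2 * rcoef r p.2 * (starRingEnd ℂ (rcoef r p.1) * qbr r p.1) +
        qpow r (-p.1) * starRingEnd ℂ (rcoef r p.1) * (rcoef r p.2 * qbr r p.2) := by
    rintro ⟨a, b⟩ hp
    have hp := Finset.HasAntidiagonal.mem_antidiagonal.mp hp
    simp only at hp ⊢
    rw [← hp]; push_cast; rw [qbr_add]; ring
  -- The boundary terms, where one index is zero, vanish because `{0} = 0`; this permits the index
  -- shift in each half.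
  have hz : qbr r ((0 : ℕ) : ℂ) = 0 := by simp [qbr]
  rw [Finset.sum_congr rfl step, Finset.sum_add_distrib, Finset.Nat.sum_antidiagonal_succ,
    Finset.Nat.sum_antidiagonal_succ']
  simp only [hz, mul_zero, zero_add]
  rw [← Finset.sum_add_distrib]
  refine Finset.sum_eq_zero ?_
  rintro ⟨a, b⟩ hp
  have hp := Finset.HasAntidiagonal.mem_antidiagonal.mp hp
  simp only at hp ⊢
  push_cast
  rw [conj_rcoef_succ (by omega), rcoef_succ (by omega)]
  have : qpow r b * qpow r (-a) = qpow r (-a) * qpow r b := mul_comm _ _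
  ring

/-! ### Gaussian binomials and the q-binomial theorem. -/

/-- The Gaussian binomial coefficient of `k + l` over `k`, in the variable `q ^ 2`. -/
def gaussBinom (r : ℕ) : ℕ → ℕ → ℂ
  | 0, _ => 1
  | _ + 1, 0 => 1
  | k + 1, l + 1 => gaussBinom r (k + 1) l + qpow r (2 * (l + 1)) * gaussBinom r k (l + 1)

theorem gaussBinom_zero_right (r k : ℕ) : gaussBinom r k 0 = 1 := by
  cases k <;> simp [gaussBinom]

/-- The factorial formula is kept free of division, since `{r}! = 0` and the case `k + l = r` is
needed. The factor `q^(kl)` converts between the variable `q²` and the symmetric brackets. -/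
theorem gaussBinom_mul_qfact (r k l : ℕ) :
    gaussBinom r k l * (qfact r k * qfact r l) = qpow r (k * l) * qfact r (k + l) := by
  induction k generalizing l with
  | zero => simp [gaussBinom, qfact_zero, qpow_zero]
  | succ k ihk =>
    induction l with
    | zero => simp [gaussBinom, qfact_zero, qpow_zero]
    | succ l ihl =>
      have h1 := ihk (l + 1)
      have e : k + 1 + (l + 1) = (k + 1 + l) + 1 := by ring
      have e2 : k + (l + 1) = k + 1 + l := by ring
      rw [e2] at h1
      rw [e, qfact_succ r (k + 1 + l)]
      rw [gaussBinom, add_mul]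
      have h2 : gaussBinom r (k + 1) l * (qfact r (k + 1) * qfact r (l + 1)) =
        qpow r ((k + 1 : ℕ) * l) * qfact r (k + 1 + l) * qbr r (l + 1) := by
        rw [← ihl, qfact_succ r l]; ring
      have h3 : qpow r (2 * (l + 1)) * gaussBinom r k (l + 1) * (qfact r (k + 1) * qfact r (l + 1)) =
        qpow r (2 * (l + 1)) * (qpow r (k * (l + 1 : ℕ)) * qfact r (k + 1 + l)) * qbr r (k + 1) := by
        rw [← h1, qfact_succ r k]; ring
      rw [h2, h3]
      have key : qpow r ((k + 1 : ℕ) * l) * qbr r (l + 1) +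
          qpow r (2 * (l + 1)) * qpow r (k * (l + 1 : ℕ)) * qbr r (k + 1) =
          qpow r ((k + 1 : ℕ) * (l + 1 : ℕ)) * qbr r ((k + 1 + l : ℕ) + 1) := by
        push_cast
        simp only [qbr, mul_sub, ← qpow_add]; ring_nf
      linear_combination (qfact r (k + 1 + l)) * key

/-- At `k + l = r` the factor `{r}!` vanishes while `{k}!` and `{l}!` do not. This is why `E^r = F^r
= 0` passes to tensor products. -/
theorem gaussBinom_eq_zero {r k l : ℕ} (hk : 0 < k) (hl : 0 < l) (h : k + l = r) :
    gaussBinom r k l = 0 := by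
  have := gaussBinom_mul_qfact r k l
  rw [h, qfact_self (by omega), mul_zero] at this
  exact (mul_eq_zero.mp this).resolve_right
    (mul_ne_zero (qfact_ne_zero (by omega)) (qfact_ne_zero (by omega)))

/-- The multiplicativity of the `q`-exponential, coefficient by coefficient; it is the combinatorial
content of both hexagons. -/
theorem rcoef_mul_gaussBinom {r k l : ℕ} (h : k + l < r) :
    rcoef r (k + l) * gaussBinom r k l = rcoef r k * rcoef r l * qpow r (2 * k * l) := by
  have h1 := gaussBinom_mul_qfact r k l
  have hk := qfact_ne_zero (r := r) (n := k) (by omega)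
  have hl := qfact_ne_zero (r := r) (n := l) (by omega)
  have hkl := qfact_ne_zero h
  have e : gaussBinom r k l = qpow r (k * l) * qfact r (k + l) / (qfact r k * qfact r l) := by
    rw [eq_div_iff (mul_ne_zero hk hl), h1]
  have e2 : qpow r (((k + l : ℕ) : ℂ) * (((k + l : ℕ) : ℂ) - 1) / 2) * qpow r (k * l) =
      qpow r ((k : ℂ) * ((k : ℂ) - 1) / 2) * qpow r ((l : ℂ) * ((l : ℂ) - 1) / 2) *
        qpow r (2 * k * l) := by
    simp only [← qpow_add]; congr 1; push_cast; ring
  rw [rcoef, rcoef, rcoef, e]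
  field_simp
  linear_combination qbr r 1 ^ (2 * (k + l)) * e2

/-- The `q`-binomial theorem. -/
theorem add_pow_of_qcomm {M : Type*} [Ring M] [Algebra ℂ M] (r : ℕ) {a b : M}
    (h : b * a = qpow r 2 • (a * b)) (n : ℕ) :
    (a + b) ^ n = ∑ p ∈ Finset.HasAntidiagonal.antidiagonal n, gaussBinom r p.1 p.2 • (a ^ p.2 * b ^ p.1) := by
  have hb : ∀ l : ℕ, b * a ^ l = qpow r (2 * l) • (a ^ l * b) := by
    intro l
    induction l with
    | zero => simp [qpow_zero]
    | succ l ih =>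
      rw [pow_succ, ← mul_assoc, ih, smul_mul_assoc, mul_assoc, h, mul_smul_comm, smul_smul,
        ← qpow_add, ← mul_assoc]
      congr 2; push_cast; ring
  induction n with
  | zero => simp [gaussBinom]
  | succ n ih =>
    -- Pascal's rule as a sum of two functions, each zero on one end of the antidiagonal so that it
    -- can be reindexed. The value `1` only serves the pair `(0, 0)`, which is not on the
    -- antidiagonal of `n + 1`.
    have e : ∀ p : ℕ × ℕ, gaussBinom r p.1 p.2 • (a ^ p.2 * b ^ p.1) =
        (match p.2 with
          | 0 => 0
          | l + 1 => gaussBinom r p.1 l • (a ^ p.2 * b ^ p.1)) +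
        (match p.1 with
          | 0 => if p.2 = 0 then 1 else 0
          | k + 1 => (qpow r (2 * p.2) * gaussBinom r k p.2) • (a ^ p.2 * b ^ p.1)) := by
      rintro ⟨k, l⟩
      rcases k with _ | k <;> rcases l with _ | l
      · simp [gaussBinom]
      · simp [gaussBinom]
      · simp [gaussBinom_zero_right, qpow_zero]
      · simp only [gaussBinom, add_smul]; push_cast; rfl
    rw [Finset.sum_congr rfl fun p _ => e p, Finset.sum_add_distrib,
      Finset.Nat.sum_antidiagonal_succ']
    rw [Finset.Nat.sum_antidiagonal_succ (f := fun p : ℕ × ℕ => (match p.1 with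
          | 0 => if p.2 = 0 then 1 else 0
          | k + 1 => (qpow r (2 * p.2) * gaussBinom r k p.2) • (a ^ p.2 * b ^ p.1) : M))]
    simp only [Nat.add_eq_zero_iff, one_ne_zero, and_false, if_false, zero_add]
    rw [pow_succ', ih, add_mul, Finset.mul_sum, Finset.mul_sum]
    congr 1
    · refine Finset.sum_congr rfl fun p _ => ?_
      rw [mul_smul_comm, ← mul_assoc, ← pow_succ']
    · refine Finset.sum_congr rfl fun p _ => ?_
      rw [mul_smul_comm, ← mul_assoc, hb, smul_mul_assoc, smul_smul, mul_assoc, ← pow_succ',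
        mul_comm (gaussBinom _ _ _)]

/-- Collects a double sum by total degree. The hypothesis will hold because total degree `r` or more
brings in `E^r = 0` or `F^r = 0`. -/
theorem sum_range_sum_range_of_eq_zero {M : Type*} [AddCommMonoid M] (r : ℕ) (f : ℕ → ℕ → M)
    (h : ∀ k l, k < r → l < r → r ≤ k + l → f k l = 0) :
    ∑ k ∈ Finset.range r, ∑ l ∈ Finset.range r, f k l =
      ∑ n ∈ Finset.range r, ∑ p ∈ Finset.HasAntidiagonal.antidiagonal n, f p.1 p.2 := by
  rw [← Finset.sum_product', Finset.sum_sigma']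
  symm
  refine Finset.sum_of_injOn (fun x => x.2) ?_ ?_ ?_ ?_
  · rintro ⟨n, a⟩ hx ⟨m, b⟩ hy hab
    simp only [Finset.coe_sigma, Set.mem_sigma_iff, Finset.mem_coe, Finset.mem_range,
      Finset.HasAntidiagonal.mem_antidiagonal] at hx hy hab
    subst hab
    have : n = m := by omega
    subst this; rfl
  · rintro ⟨n, a⟩ hx
    simp only [Finset.coe_sigma, Set.mem_sigma_iff, Finset.mem_coe, Finset.mem_range,
      Finset.HasAntidiagonal.mem_antidiagonal, Finset.mem_product] at hx ⊢
    omega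
  · rintro ⟨k, l⟩ hx hn
    simp only [Finset.mem_product, Finset.mem_range] at hx
    refine h k l hx.1 hx.2 ?_
    by_contra hlt
    refine hn ⟨⟨k + l, (k, l)⟩, ?_, rfl⟩
    simp; omega
  · intros; rfl

namespace UMod

/-- A reducible copy of `UMod.tensor`. -/
abbrev tensorR (X Y : UMod) : UMod where
  carrier := X ⊗[ℂ] Y
  E := TensorProduct.map LinearMap.id Y.E + TensorProduct.map X.E Y.K
  F := TensorProduct.map X.Kinv Y.F + TensorProduct.map X.F LinearMap.id
  K := TensorProduct.map X.K Y.K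
  Kinv := TensorProduct.map X.Kinv Y.Kinv
  H := TensorProduct.map X.H LinearMap.id + TensorProduct.map LinearMap.id Y.H

/-- A reducible copy of `UMod.unit`. -/
abbrev unitR : UMod where
  carrier := ℂ
  E := 0
  F := 0
  K := LinearMap.id
  Kinv := LinearMap.id
  H := 0

/-- A reducible copy of `UMod.dual`. -/
abbrev dualR (X : UMod) : UMod where
  carrier := Module.Dual ℂ X
  E := Module.Dual.transpose (-(X.E * X.Kinv))
  F := Module.Dual.transpose (-(X.K * X.F))
  K := Module.Dual.transpose X.Kinv
  Kinv := Module.Dual.transpose X.K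
  H := Module.Dual.transpose (-X.H)

/-! ## Weight vectors -/

theorem funH_apply (X : UMod) (φ : ℂ → ℂ) {μ : ℂ} {v : X} (hv : X.H v = μ • v) :
    X.funH φ v = φ μ • v := by
  by_cases h0 : v = 0
  · simp [h0]
  have hev : X.H.HasEigenvector μ v := ⟨Module.End.mem_eigenspace_iff.mpr hv, h0⟩
  have hmem : μ ∈ X.weights := by
    simpa [weights] using Module.End.hasEigenvalue_of_hasEigenvector hev
  rw [funH, Module.End.aeval_apply_of_hasEigenvector hev]
  congr 1
  simpa using Lagrange.eval_interpolate_at_node φ (Function.injective_id.injOn) hmem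

theorem mem_weights (X : UMod) {μ : ℂ} {v : X} (hv : X.H v = μ • v) (h0 : v ≠ 0) :
    μ ∈ X.weights := by
  have hev : X.H.HasEigenvector μ v := ⟨Module.End.mem_eigenspace_iff.mpr hv, h0⟩
  simpa [weights] using Module.End.hasEigenvalue_of_hasEigenvector hev

variable {r : ℕ} {X Y Z : UMod}

theorem weight_induction (h : ⨆ μ : ℂ, X.H.eigenspace μ = ⊤) {p : X → Prop}
    (wt : ∀ (μ : ℂ) (v : X), X.H v = μ • v → p v) (add : ∀ v w, p v → p w → p (v + w)) (v : X) :
    p v := by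
  have hv : v ∈ ⨆ μ : ℂ, X.H.eigenspace μ := by rw [h]; trivial
  refine Submodule.iSup_induction _ (motive := p) hv ?_ ?_ add
  · intro μ x hx
    exact wt μ x (Module.End.mem_eigenspace_iff.mp hx)
  · exact wt 0 0 (by simp)

/-- Stated for semilinear maps so that it also applies to the antilinear variable of a form. -/
theorem weight_ext {M : Type*} [AddCommGroup M] [Module ℂ M] {σ : ℂ →+* ℂ}
    (h : ⨆ μ : ℂ, X.H.eigenspace μ = ⊤) {f g : X →ₛₗ[σ] M}
    (wt : ∀ (μ : ℂ) (v : X), X.H v = μ • v → f v = g v) : f = g :=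
  LinearMap.ext fun v => weight_induction h wt (fun v w hv hw => by rw [map_add, map_add, hv, hw]) v

theorem tensor_weight_induction (hX : ⨆ μ : ℂ, X.H.eigenspace μ = ⊤)
    (hY : ⨆ μ : ℂ, Y.H.eigenspace μ = ⊤) {p : X ⊗[ℂ] Y → Prop}
    (wt : ∀ (a b : ℂ) (v : X) (w : Y), X.H v = a • v → Y.H w = b • w → p (v ⊗ₜ w))
    (add : ∀ v w, p v → p w → p (v + w)) (x : X ⊗[ℂ] Y) : p x := by
  induction x with
  | zero => simpa using wt 0 0 0 0 (by simp) (by simp)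
  | add x y hx hy => exact add x y hx hy
  | tmul v w =>
    refine weight_induction hX (p := fun v => p (v ⊗ₜ w)) (fun a v hv => ?_) (fun v v' h h' => ?_) v
    · refine weight_induction hY (p := fun w => p (v ⊗ₜ w)) (fun b w hw => ?_) (fun w w' h h' => ?_) w
      · exact wt a b v w hv hw
      · simpa only [tmul_add] using add _ _ h h'
    · simpa only [add_tmul] using add _ _ h h'

theorem tensor_weight_ext {M : Type*} [AddCommGroup M] [Module ℂ M] {σ : ℂ →+* ℂ}
    (hX : ⨆ μ : ℂ, X.H.eigenspace μ = ⊤)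
    (hY : ⨆ μ : ℂ, Y.H.eigenspace μ = ⊤) {f g : X ⊗[ℂ] Y →ₛₗ[σ] M}
    (wt : ∀ (a b : ℂ) (v : X) (w : Y), X.H v = a • v → Y.H w = b • w → f (v ⊗ₜ w) = g (v ⊗ₜ w)) :
    f = g :=
  LinearMap.ext fun x => tensor_weight_induction hX hY (p := fun x => f x = g x) wt
    (fun v w hv hw => by rw [map_add, map_add, hv, hw]) x

theorem tensor_weight_ext₃ {M : Type*} [AddCommGroup M] [Module ℂ M]
    (hX : ⨆ μ : ℂ, X.H.eigenspace μ = ⊤) (hY : ⨆ μ : ℂ, Y.H.eigenspace μ = ⊤)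
    (hZ : ⨆ μ : ℂ, Z.H.eigenspace μ = ⊤) {f g : (X ⊗[ℂ] Y) ⊗[ℂ] Z →ₗ[ℂ] M}
    (wt : ∀ (a b c : ℂ) (v : X) (w : Y) (z : Z), X.H v = a • v → Y.H w = b • w → Z.H z = c • z →
      f ((v ⊗ₜ w) ⊗ₜ z) = g ((v ⊗ₜ w) ⊗ₜ z)) : f = g := by
  refine TensorProduct.ext (LinearMap.ext fun x => ?_)
  refine tensor_weight_induction hX hY
    (p := fun x => (TensorProduct.mk ℂ (X ⊗[ℂ] Y) Z).compr₂ₛₗ f x =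
      (TensorProduct.mk ℂ (X ⊗[ℂ] Y) Z).compr₂ₛₗ g x)
    (fun a b v w hv hw => ?_) (fun x y hx hy => ?_) x
  · exact weight_ext hZ fun c z hz => wt a b c v w z hv hw hz
  · exact (map_add _ x y).trans ((congrArg₂ (· + ·) hx hy).trans (map_add _ x y).symm)

namespace IsWeight

section
variable (hX : IsWeight r X) {μ : ℂ} {v : X}
include hX

theorem K_apply (hv : X.H v = μ • v) : X.K v = qpow r μ • v := hX.K_eq μ v hv

theorem Kinv_apply (hv : X.H v = μ • v) : X.Kinv v = qpow r (-μ) • v := by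
  have := congrArg (fun f => f v) hX.Kinv_K
  simp only [Module.End.mul_apply, hX.K_apply hv, map_smul, Module.End.one_apply] at this
  calc X.Kinv v = (qpow r (-μ) * qpow r μ) • X.Kinv v := by
        rw [← qpow_add, neg_add_cancel, qpow_zero, one_smul]
    _ = _ := by rw [mul_smul, this]

theorem Kinv_K_apply (v : X) : X.Kinv (X.K v) = v := congrArg (fun f => f v) hX.Kinv_K

theorem K_Kinv_apply (v : X) : X.K (X.Kinv v) = v := congrArg (fun f => f v) hX.K_Kinv

theorem H_E_apply (hv : X.H v = μ • v) : X.H (X.E v) = (μ + 2) • X.E v := by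
  have := congrArg (fun f => f v) hX.H_E
  simp only [LinearMap.sub_apply, Module.End.mul_apply, hv, map_smul, LinearMap.smul_apply] at this
  rw [add_smul, ← this]; abel

theorem H_F_apply (hv : X.H v = μ • v) : X.H (X.F v) = (μ - 2) • X.F v := by
  have := congrArg (fun f => f v) hX.H_F
  simp only [LinearMap.sub_apply, Module.End.mul_apply, hv, map_smul, LinearMap.smul_apply] at this
  rw [sub_eq_iff_eq_add'.mp this, ← add_smul]; rfl

theorem H_E_pow_apply (n : ℕ) (hv : X.H v = μ • v) :
    X.H ((X.E ^ n) v) = (μ + 2 * n) • (X.E ^ n) v := by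
  induction n with
  | zero => simpa using hv
  | succ n ih =>
    rw [pow_succ', Module.End.mul_apply, hX.H_E_apply ih]; congr 1; push_cast; ring

theorem H_F_pow_apply (n : ℕ) (hv : X.H v = μ • v) :
    X.H ((X.F ^ n) v) = (μ - 2 * n) • (X.F ^ n) v := by
  induction n with
  | zero => simpa using hv
  | succ n ih =>
    rw [pow_succ', Module.End.mul_apply, hX.H_F_apply ih]; congr 1; push_cast; ring

theorem E_F_apply (hv : X.H v = μ • v) :
    X.E (X.F v) = X.F (X.E v) + (qbr r μ / qbr r 1) • v := by
  have := congrArg (fun f => f v) hX.E_F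
  simp only [LinearMap.sub_apply, Module.End.mul_apply, LinearMap.smul_apply, hX.K_apply hv,
    hX.Kinv_apply hv] at this
  rw [sub_eq_iff_eq_add'.mp this, ← sub_smul, smul_smul, inv_mul_eq_div]; rfl

theorem E_F_pow_apply (hr : 2 ≤ r) (n : ℕ) (hv : X.H v = μ • v) :
    X.E ((X.F ^ (n + 1)) v) = (X.F ^ (n + 1)) (X.E v) +
      (qbr r (n + 1) * qbr r (μ - n) / qbr r 1 ^ 2) • (X.F ^ n) v := by
  have h1 := qbr_one_ne_zero hr
  induction n with
  | zero =>
    rw [zero_add, pow_one, hX.E_F_apply hv]; simp; congr 1; field_simp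
  | succ n ih =>
    rw [pow_succ' _ (n + 1), Module.End.mul_apply, hX.E_F_apply (hX.H_F_pow_apply (n + 1) hv), ih,
      map_add, map_smul, Module.End.mul_apply, add_assoc, ← Module.End.mul_apply X.F (X.F ^ n),
      ← pow_succ', ← add_smul]
    congr 2
    field_simp
    push_cast
    simp only [qbr, mul_sub, sub_mul, ← qpow_add]; ring_nf

theorem E_pow_eq_zero {n : ℕ} (hn : r ≤ n) : X.E ^ n = 0 := pow_eq_zero_of_le hn hX.E_pow

theorem F_pow_eq_zero {n : ℕ} (hn : r ≤ n) : X.F ^ n = 0 := pow_eq_zero_of_le hn hX.F_pow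

end

/-- The relations of a weight module can be checked on a spanning set of weight vectors. -/
theorem of_span (P : ℂ → X → Prop) (hspan : Submodule.span ℂ {v | ∃ μ, P μ v} = ⊤)
    (hH : ∀ μ v, P μ v → X.H v = μ • v) (hK : ∀ μ v, P μ v → X.K v = qpow r μ • v)
    (hKinv : ∀ μ v, P μ v → X.Kinv v = qpow r (-μ) • v)
    (hE : ∀ μ v, P μ v → X.H (X.E v) = (μ + 2) • X.E v)
    (hF : ∀ μ v, P μ v → X.H (X.F v) = (μ - 2) • X.F v)
    (hEF : ∀ μ v, P μ v → X.E (X.F v) = X.F (X.E v) + (qbr r μ / qbr r 1) • v)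
    (hEr : X.E ^ r = 0) (hFr : X.F ^ r = 0) : IsWeight r X := by
  have hext : ∀ f g : Module.End ℂ X, (∀ μ v, P μ v → f v = g v) → f = g := fun f g h =>
    LinearMap.ext_on hspan (by rintro v ⟨μ, hv⟩; exact h μ v hv)
  -- An arbitrary eigenvector of `H` need not satisfy `P`, so `K = q^H` is first obtained as an
  -- identity of operators.
  have hKf : X.K = X.funH (qpow r) := hext _ _ fun μ v hv => by
    rw [hK μ v hv, funH_apply X _ (hH μ v hv)]
  have hK' : ∀ (μ : ℂ) (v : X), X.H v = μ • v → X.K v = qpow r μ • v := fun μ v hv => by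
    rw [hKf, funH_apply X _ hv]
  have hq : ∀ μ, qpow r μ * qpow r (-μ) = 1 := fun μ => by
    rw [← qpow_add, add_neg_cancel, qpow_zero]
  refine ⟨?_, ?_, ?_, ?_, ?_, ?_, ?_, ?_, hEr, hFr, ?_, hK'⟩
  · refine hext _ _ fun μ v hv => ?_
    simp [hK μ v hv, hKinv μ v hv, smul_smul, mul_comm _ (qpow r μ), hq]
  · refine hext _ _ fun μ v hv => ?_
    simp [hK μ v hv, hKinv μ v hv, smul_smul, hq]
  · refine hext _ _ fun μ v hv => ?_
    simp only [Module.End.mul_apply, hKinv μ v hv, map_smul, hK' _ _ (hE μ v hv), smul_smul,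
      ← qpow_add, LinearMap.smul_apply]
    congr 2; ring
  · refine hext _ _ fun μ v hv => ?_
    simp only [Module.End.mul_apply, hKinv μ v hv, map_smul, hK' _ _ (hF μ v hv), smul_smul,
      ← qpow_add, LinearMap.smul_apply]
    congr 2; ring
  · refine hext _ _ fun μ v hv => ?_
    simp only [LinearMap.sub_apply, Module.End.mul_apply, LinearMap.smul_apply, hEF μ v hv,
      hK μ v hv, hKinv μ v hv, ← sub_smul, smul_smul, add_sub_cancel_left, inv_mul_eq_div]
    rfl
  · refine hext _ _ fun μ v hv => ?_
    simp [hH μ v hv, hK μ v hv, smul_smul, mul_comm]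
  · refine hext _ _ fun μ v hv => ?_
    simp [hH μ v hv, hE μ v hv, add_smul]
  · refine hext _ _ fun μ v hv => ?_
    simp [hH μ v hv, hF μ v hv, sub_smul]
  · rw [eq_top_iff, ← hspan, Submodule.span_le]
    rintro v ⟨μ, hv⟩
    exact Submodule.mem_iSup_of_mem μ (Module.End.mem_eigenspace_iff.mpr (hH μ v hv))

end IsWeight

/-! ## The tensor product, the unit and the dual are weight modules -/

theorem tensor_E_tmul (v : X) (w : Y) :
    (tensorR X Y).E (v ⊗ₜ w) = v ⊗ₜ[ℂ] Y.E w + X.E v ⊗ₜ[ℂ] Y.K w := rfl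

theorem tensor_F_tmul (v : X) (w : Y) :
    (tensorR X Y).F (v ⊗ₜ w) = X.Kinv v ⊗ₜ[ℂ] Y.F w + X.F v ⊗ₜ[ℂ] w := rfl

theorem tensor_K_tmul (v : X) (w : Y) :
    (tensorR X Y).K (v ⊗ₜ w) = X.K v ⊗ₜ[ℂ] Y.K w := rfl

theorem tensor_Kinv_tmul (v : X) (w : Y) :
    (tensorR X Y).Kinv (v ⊗ₜ w) = X.Kinv v ⊗ₜ[ℂ] Y.Kinv w := rfl

theorem tensor_H_tmul (v : X) (w : Y) :
    (tensorR X Y).H (v ⊗ₜ w) = X.H v ⊗ₜ[ℂ] w + v ⊗ₜ[ℂ] Y.H w := rfl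

theorem tensor_H_weight {a b : ℂ} {v : X} {w : Y} (hv : X.H v = a • v) (hw : Y.H w = b • w) :
    (tensorR X Y).H (v ⊗ₜ w) = (a + b) • (v ⊗ₜ[ℂ] w) := by
  rw [tensor_H_tmul, hv, hw, ← smul_tmul', tmul_smul, add_smul]

theorem K_mul_E (hX : IsWeight r X) : X.K * X.E = qpow r 2 • (X.E * X.K) := by
  have := congrArg (· * X.K) hX.K_E
  simpa only [mul_assoc, hX.Kinv_K, mul_one, smul_mul_assoc] using this

theorem Kinv_mul_F (hX : IsWeight r X) : X.Kinv * X.F = qpow r 2 • (X.F * X.Kinv) := by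
  have h := congrArg (X.Kinv * ·) hX.K_F
  simp only [← mul_assoc, hX.Kinv_K, one_mul, mul_smul_comm] at h
  rw [h, smul_smul, ← qpow_add, add_neg_cancel, qpow_zero, one_smul]

/-- The two summands of `Δ E` satisfy `(E ⊗ K)(1 ⊗ E) = q² (1 ⊗ E)(E ⊗ K)`, so the `q`-binomial
theorem applies. -/
theorem tensor_E_pow (hY : IsWeight r Y) (n : ℕ) :
    (tensorR X Y).E ^ n = ∑ p ∈ Finset.HasAntidiagonal.antidiagonal n, gaussBinom r p.1 p.2 •
      TensorProduct.map (X.E ^ p.1) (Y.E ^ p.2 * Y.K ^ p.1) := by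
  have h := add_pow_of_qcomm r (M := Module.End ℂ (X ⊗[ℂ] Y))
    (a := TensorProduct.map LinearMap.id Y.E) (b := TensorProduct.map X.E Y.K) ?_ n
  · refine Eq.trans h (Finset.sum_congr rfl fun p _ => ?_)
    rw [TensorProduct.map_pow, TensorProduct.map_pow, ← TensorProduct.map_mul]
    congr 2
    exact (congrArg (· * _) (one_pow _)).trans (one_mul _)
  · rw [← TensorProduct.map_mul, ← TensorProduct.map_mul, K_mul_E hY, TensorProduct.map_smul_right]
    rfl

theorem tensor_F_pow (hX : IsWeight r X) (n : ℕ) :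
    (tensorR X Y).F ^ n = ∑ p ∈ Finset.HasAntidiagonal.antidiagonal n, gaussBinom r p.1 p.2 •
      TensorProduct.map (X.F ^ p.2 * X.Kinv ^ p.1) (Y.F ^ p.1) := by
  have h := add_pow_of_qcomm r (M := Module.End ℂ (X ⊗[ℂ] Y))
    (b := TensorProduct.map X.Kinv Y.F) (a := TensorProduct.map X.F LinearMap.id) ?_ n
  · refine Eq.trans (congrArg (· ^ n) (add_comm _ _)) (Eq.trans h (Finset.sum_congr rfl fun p _ => ?_))
    rw [TensorProduct.map_pow, TensorProduct.map_pow, ← TensorProduct.map_mul]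
    congr 2
    exact (congrArg (· * _) (one_pow _)).trans (one_mul _)
  · rw [← TensorProduct.map_mul, ← TensorProduct.map_mul, Kinv_mul_F hX, TensorProduct.map_smul_left]
    rfl

theorem IsWeight.tensor (hr : 2 ≤ r) (hX : IsWeight r X) (hY : IsWeight r Y) :
    IsWeight r (tensorR X Y) := by
  have h1 := qbr_one_ne_zero hr
  refine IsWeight.of_span
    (fun μ x => ∃ a b v w, X.H v = a • v ∧ Y.H w = b • w ∧ μ = a + b ∧ x = v ⊗ₜ[ℂ] w)
    ?_ ?_ ?_ ?_ ?_ ?_ ?_ ?_ ?_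
  · rw [eq_top_iff]
    rintro x -
    refine tensor_weight_induction hX.diag hY.diag
      (p := fun x => x ∈ Submodule.span ℂ _) (fun a b v w hv hw => ?_)
      (fun x y hx hy => Submodule.add_mem _ hx hy) x
    exact Submodule.subset_span ⟨a + b, a, b, v, w, hv, hw, rfl, rfl⟩
  · rintro _ _ ⟨a, b, v, w, hv, hw, rfl, rfl⟩
    exact tensor_H_weight hv hw
  · rintro _ _ ⟨a, b, v, w, hv, hw, rfl, rfl⟩
    rw [tensor_K_tmul, hX.K_apply hv, hY.K_apply hw, smul_tmul_smul, qpow_add]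
  · rintro _ _ ⟨a, b, v, w, hv, hw, rfl, rfl⟩
    rw [tensor_Kinv_tmul, hX.Kinv_apply hv, hY.Kinv_apply hw, smul_tmul_smul, ← qpow_add]
    congr 2; ring
  · rintro _ _ ⟨a, b, v, w, hv, hw, rfl, rfl⟩
    rw [tensor_E_tmul, map_add, hY.K_apply hw, tmul_smul, map_smul,
      tensor_H_weight hv (hY.H_E_apply hw), tensor_H_weight (hX.H_E_apply hv) hw, smul_add,
      smul_smul, smul_smul]
    congr 2 <;> ring
  · rintro _ _ ⟨a, b, v, w, hv, hw, rfl, rfl⟩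
    rw [tensor_F_tmul, map_add, hX.Kinv_apply hv, ← smul_tmul', map_smul,
      tensor_H_weight hv (hY.H_F_apply hw), tensor_H_weight (hX.H_F_apply hv) hw, smul_add,
      smul_smul, smul_smul]
    congr 2 <;> ring
  · rintro _ _ ⟨a, b, v, w, hv, hw, rfl, rfl⟩
    rw [tensor_E_tmul, tensor_F_tmul, map_add, map_add, hX.Kinv_apply hv, hY.K_apply hw,
      ← smul_tmul', tmul_smul, map_smul, map_smul]
    simp only [LinearMap.add_apply, TensorProduct.map_tmul, LinearMap.id_apply]
    rw [hY.K_apply (hY.H_F_apply hw), hX.Kinv_apply (hX.H_E_apply hv), hX.Kinv_apply hv,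
      hY.K_apply hw, hX.E_F_apply hv, hY.E_F_apply hw]
    simp only [tmul_add, add_tmul, tmul_smul, ← smul_tmul', smul_add, smul_smul]
    -- `e1` matches the mixed terms `E v ⊗ F w` on the two sides; `e2` assembles the two local
    -- commutators into the bracket of the total weight.
    have e1 : qpow r (-a) * qpow r (b - 2) = qpow r b * qpow r (-(a + 2)) := by
      rw [← qpow_add, ← qpow_add]; congr 1; ring
    have e2 : qbr r (a + b) / qbr r 1 = qpow r (-a) * (qbr r b / qbr r 1) +
        qpow r b * (qbr r a / qbr r 1) := by
      rw [qbr_add]; ring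
    rw [e1, e2, add_smul]
    abel
  -- The two extreme terms contain an `r`-th power of a nilpotent factor; the others have a
  -- vanishing Gaussian binomial.
  · rw [tensor_E_pow hY]
    refine Finset.sum_eq_zero fun p hp => ?_
    have hp := Finset.HasAntidiagonal.mem_antidiagonal.mp hp
    rcases Nat.eq_zero_or_pos p.1 with h | h
    · rw [h, zero_add] at hp
      simp [hp, hY.E_pow]
    rcases Nat.eq_zero_or_pos p.2 with h' | h'
    · rw [h', add_zero] at hp
      simp [hp, hX.E_pow]
    simp [gaussBinom_eq_zero h h' hp]
  · rw [tensor_F_pow hX]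
    refine Finset.sum_eq_zero fun p hp => ?_
    have hp := Finset.HasAntidiagonal.mem_antidiagonal.mp hp
    rcases Nat.eq_zero_or_pos p.1 with h | h
    · rw [h, zero_add] at hp
      simp [hp, hX.F_pow]
    rcases Nat.eq_zero_or_pos p.2 with h' | h'
    · rw [h', add_zero] at hp
      simp [hp, hY.F_pow]
    simp [gaussBinom_eq_zero h h' hp]

theorem IsWeight.unit (hr : 2 ≤ r) : IsWeight r unitR := by
  refine IsWeight.of_span (fun μ _ => μ = 0) ?_ ?_ ?_ ?_ ?_ ?_ ?_ ?_ ?_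
  · rw [eq_top_iff]
    rintro x -
    exact Submodule.subset_span ⟨0, rfl⟩
  · rintro μ v rfl; simp [unitR]
  · rintro μ v rfl; simp [unitR, qpow_zero]
  · rintro μ v rfl; simp [unitR, qpow_zero]
  · rintro μ v rfl; simp [unitR]
  · rintro μ v rfl; simp [unitR]
  · rintro μ v rfl; simp [unitR, qbr]
  · exact zero_pow (by omega)
  · exact zero_pow (by omega)

theorem dual_E_apply (φ : Module.Dual ℂ X) (v : X) : ((dualR X).E φ : Module.Dual ℂ X) v = -φ (X.E (X.Kinv v)) :=
  φ.map_neg _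

theorem dual_F_apply (φ : Module.Dual ℂ X) (v : X) : ((dualR X).F φ : Module.Dual ℂ X) v = -φ (X.K (X.F v)) :=
  φ.map_neg _

theorem dual_K_apply (φ : Module.Dual ℂ X) (v : X) : ((dualR X).K φ : Module.Dual ℂ X) v = φ (X.Kinv v) := rfl

theorem dual_Kinv_apply (φ : Module.Dual ℂ X) (v : X) : ((dualR X).Kinv φ : Module.Dual ℂ X) v = φ (X.K v) := rfl

theorem dual_H_apply (φ : Module.Dual ℂ X) (v : X) : ((dualR X).H φ : Module.Dual ℂ X) v = -φ (X.H v) :=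
  φ.map_neg _

theorem dual_E_pow_apply (φ : Module.Dual ℂ X) (n : ℕ) (v : X) :
    (((dualR X).E ^ n) φ : Module.Dual ℂ X) v = φ (((-(X.E * X.Kinv)) ^ n) v) := by
  induction n generalizing v with
  | zero => rfl
  | succ n ih =>
    rw [pow_succ', Module.End.mul_apply, pow_succ, Module.End.mul_apply, ← ih]; rfl

theorem dual_F_pow_apply (φ : Module.Dual ℂ X) (n : ℕ) (v : X) :
    (((dualR X).F ^ n) φ : Module.Dual ℂ X) v = φ (((-(X.K * X.F)) ^ n) v) := by
  induction n generalizing v with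
  | zero => rfl
  | succ n ih =>
    rw [pow_succ', Module.End.mul_apply, pow_succ, Module.End.mul_apply, ← ih]; rfl

/-- `(- K F)ⁿ` on a weight vector. -/
theorem IsWeight.neg_K_F_pow_apply (hX : IsWeight r X) {μ : ℂ} {v : X} (hv : X.H v = μ • v) (n : ℕ) :
    ((-(X.K * X.F)) ^ n) v = ((-1) ^ n * qpow r (n * μ - n * (n + 1))) • (X.F ^ n) v := by
  induction n with
  | zero => simp [qpow_zero]
  | succ n ih =>
    rw [pow_succ', Module.End.mul_apply, ih, map_smul, LinearMap.neg_apply, Module.End.mul_apply,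
      ← Module.End.mul_apply X.F, ← pow_succ', hX.K_apply (hX.H_F_pow_apply (n + 1) hv),
      ← neg_smul, smul_smul]
    congr 1
    have : qpow r (n * μ - n * (n + 1)) * qpow r (μ - 2 * (n + 1 : ℕ)) =
      qpow r ((n + 1 : ℕ) * μ - (n + 1 : ℕ) * ((n + 1 : ℕ) + 1)) := by
      rw [← qpow_add]; congr 1; push_cast; ring
    rw [← this]; ring

/-- `(- E K⁻¹)ⁿ` on a weight vector. -/
theorem IsWeight.neg_E_Kinv_pow_apply (hX : IsWeight r X) {μ : ℂ} {v : X} (hv : X.H v = μ • v)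
    (n : ℕ) :
    ((-(X.E * X.Kinv)) ^ n) v = ((-1) ^ n * qpow r (-(n * μ) - n * (n - 1))) • (X.E ^ n) v := by
  induction n with
  | zero => simp [qpow_zero]
  | succ n ih =>
    rw [pow_succ', Module.End.mul_apply, ih, map_smul, LinearMap.neg_apply, Module.End.mul_apply,
      hX.Kinv_apply (hX.H_E_pow_apply n hv), map_smul, ← Module.End.mul_apply X.E, ← pow_succ',
      ← neg_smul, smul_smul]
    congr 1
    have : qpow r (-(n * μ) - n * (n - 1)) * qpow r (-(μ + 2 * n)) =
      qpow r (-((n + 1 : ℕ) * μ) - (n + 1 : ℕ) * ((n + 1 : ℕ) - 1)) := by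
      rw [← qpow_add]; congr 1; push_cast; ring
    rw [← this]; ring

/-- A functional of weight `μ` kills all weight vectors of weight other than `-μ`. -/
theorem dual_weight_apply {φ : Module.Dual ℂ X} {μ a : ℂ} {v : X} (hφ : (dualR X).H φ = μ • φ)
    (hv : X.H v = a • v) : a = -μ ∨ φ v = 0 := by
  have h := congrArg (fun f : Module.Dual ℂ X => f v) hφ
  have h2 : -φ (X.H v) = μ * φ v := (dual_H_apply φ v).symm.trans h
  rw [hv, map_smul, smul_eq_mul] at h2
  by_cases h0 : φ v = 0
  · exact Or.inr h0
  · left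
    apply mul_right_cancel₀ h0
    linear_combination -h2

/-- A functional is the sum of its composites with the weight projections, and the composite with
the projection to weight `a` has weight `-a`. -/
theorem dual_diag (hX : ⨆ μ : ℂ, X.H.eigenspace μ = ⊤) :
    ⨆ μ : ℂ, (dualR X).H.eigenspace μ = ⊤ := by
  classical
  rw [eq_top_iff]
  rintro φ -
  have key : (φ : Module.Dual ℂ X) =
      ∑ a ∈ X.weights, (φ : Module.Dual ℂ X) ∘ₗ X.funH (fun b => if b = a then 1 else 0) := by
    refine weight_ext hX fun μ v hv => ?_
    by_cases h0 : v = 0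
    · simp [h0]
    rw [LinearMap.sum_apply]
    simp only [LinearMap.comp_apply, funH_apply X _ hv]
    rw [Finset.sum_eq_single μ]
    · simp
    · intro b _ hb; rw [if_neg (Ne.symm hb), zero_smul, map_zero]
    · intro h; exact absurd (mem_weights X hv h0) h
  have key' : φ = (∑ a ∈ X.weights, (φ : Module.Dual ℂ X) ∘ₗ
    X.funH (fun b => if b = a then 1 else 0) : Module.Dual ℂ X) := key
  rw [key']
  refine Submodule.sum_mem _ fun a _ => Submodule.mem_iSup_of_mem (-a) ?_
  refine Module.End.mem_eigenspace_iff.mpr ?_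
  refine weight_ext (M := ℂ) (σ := RingHom.id ℂ) hX fun μ v hv => ?_
  refine Eq.trans (dual_H_apply _ _) ?_
  change -(φ : Module.Dual ℂ X) _ = -a * (φ : Module.Dual ℂ X) (X.funH _ v)
  rw [hv, map_smul, funH_apply X _ hv]
  split_ifs with h
  · simp [h]
  · simp

theorem IsWeight.dual (hX : IsWeight r X) : IsWeight r (dualR X) := by
  have hext : ∀ f g : Module.Dual ℂ X, (∀ a v, X.H v = a • v → f v = g v) → f = g :=
    fun f g h => weight_ext (σ := RingHom.id ℂ) hX.diag h
  refine IsWeight.of_span (fun μ φ => (dualR X).H φ = μ • φ) ?_ (fun _ _ h => h) ?_ ?_ ?_ ?_ ?_ ?_ ?_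
  · rw [eq_top_iff]
    rintro x -
    refine weight_induction (dual_diag hX.diag)
      (p := fun x => x ∈ Submodule.span ℂ _) (fun a φ h => ?_)
      (fun x y hx hy => Submodule.add_mem _ hx hy) x
    exact Submodule.subset_span ⟨a, h⟩
  · intro μ φ h
    refine hext _ _ fun a v hv => ?_
    rw [dual_K_apply, hX.Kinv_apply hv, map_smul]
    rcases dual_weight_apply h hv with rfl | h0
    · rw [neg_neg]; rfl
    · rw [h0, smul_zero]; exact (mul_eq_zero_of_right _ h0).symm
  · intro μ φ h
    refine hext _ _ fun a v hv => ?_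
    rw [dual_Kinv_apply, hX.K_apply hv, map_smul]
    rcases dual_weight_apply h hv with rfl | h0
    · rfl
    · rw [h0, smul_zero]; exact (mul_eq_zero_of_right _ h0).symm
  · intro μ φ h
    refine hext _ _ fun a v hv => ?_
    have h3 : (((μ + 2) • (dualR X).E φ : (dualR X)) : Module.Dual ℂ X) v =
      (μ + 2) * ((dualR X).E φ : Module.Dual ℂ X) v := rfl
    rw [dual_H_apply, h3, hv, map_smul, dual_E_apply, hX.Kinv_apply hv, map_smul, map_smul]
    rcases dual_weight_apply h (hX.H_E_apply hv) with h1 | h0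
    · simp only [smul_eq_mul]
      linear_combination (qpow r (-a) * (φ : Module.Dual ℂ X) (X.E v)) * h1
    · rw [h0]; simp
  · intro μ φ h
    refine hext _ _ fun a v hv => ?_
    have h3 : (((μ - 2) • (dualR X).F φ : (dualR X)) : Module.Dual ℂ X) v =
      (μ - 2) * ((dualR X).F φ : Module.Dual ℂ X) v := rfl
    rw [dual_H_apply, h3, hv, map_smul, dual_F_apply, hX.K_apply (hX.H_F_apply hv), map_smul]
    rcases dual_weight_apply h (hX.H_F_apply hv) with h1 | h0
    · simp only [smul_eq_mul]
      linear_combination (qpow r (a - 2) * (φ : Module.Dual ℂ X) (X.F v)) * h1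
    · rw [h0]; simp
  · intro μ φ h
    refine hext _ _ fun a v hv => ?_
    have h3 : (((dualR X).F ((dualR X).E φ) + (qbr r μ / qbr r 1) • φ : (dualR X)) : Module.Dual ℂ X) v =
      ((dualR X).F ((dualR X).E φ) : Module.Dual ℂ X) v + (qbr r μ / qbr r 1) * (φ : Module.Dual ℂ X) v := rfl
    rw [h3, dual_E_apply, dual_F_apply, dual_F_apply, dual_E_apply, hX.Kinv_apply hv,
      hX.Kinv_K_apply, map_smul, map_smul, map_smul, hX.K_apply (hX.H_F_apply (hX.H_E_apply hv)),
      smul_smul, ← qpow_add, hX.E_F_apply hv, map_add, map_smul]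
    have : -a + (a + 2 - 2) = 0 := by ring
    rw [this, qpow_zero, one_smul]
    rcases dual_weight_apply h hv with rfl | h0
    · rw [qbr_neg]; simp; ring
    · simp [h0]
  · refine LinearMap.ext fun φ => hext _ _ fun a v hv => ?_
    rw [dual_E_pow_apply, hX.neg_E_Kinv_pow_apply hv, hX.E_pow, LinearMap.zero_apply, smul_zero,
      map_zero]; rfl
  · refine LinearMap.ext fun φ => hext _ _ fun a v hv => ?_
    rw [dual_F_pow_apply, hX.neg_K_F_pow_apply hv, hX.F_pow, LinearMap.zero_apply, smul_zero,
      map_zero]; rfl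

end UMod

namespace UMod

/-! ## The braiding -/

variable {r : ℕ} {X Y Z : UMod}

theorem IsWeight.E_pow_F_apply (hX : IsWeight r X) (hr : 2 ≤ r) (n : ℕ) {μ : ℂ} {v : X}
    (hv : X.H v = μ • v) :
    (X.E ^ (n + 1)) (X.F v) = X.F ((X.E ^ (n + 1)) v) +
      (qbr r (n + 1) * qbr r (μ + n) / qbr r 1 ^ 2) • (X.E ^ n) v := by
  have h1 := qbr_one_ne_zero hr
  induction n with
  | zero =>
    rw [zero_add, pow_one, hX.E_F_apply hv]; simp; congr 1; field_simp
  | succ n ih =>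
    rw [pow_succ' _ (n + 1), Module.End.mul_apply, ih, map_add, map_smul,
      hX.E_F_apply (hX.H_E_pow_apply (n + 1) hv), Module.End.mul_apply, add_assoc,
      ← Module.End.mul_apply X.E (X.E ^ n), ← pow_succ', ← add_smul]
    congr 2
    field_simp
    push_cast
    simp only [qbr, mul_sub, sub_mul, ← qpow_add]; ring_nf

open Classical in
/-- The operator which multiplies `v ⊗ w` by `φ λ μ` for `v` of weight `λ` and `w` of weight `μ`. -/
def funHH (X Y : UMod) (φ : ℂ → ℂ → ℂ) : X ⊗[ℂ] Y →ₗ[ℂ] X ⊗[ℂ] Y :=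
  ∑ a ∈ X.weights, TensorProduct.map (X.funH fun b => if b = a then 1 else 0) (Y.funH (φ a))

theorem funHH_tmul (φ : ℂ → ℂ → ℂ) {a b : ℂ} {v : X} {w : Y} (hv : X.H v = a • v)
    (hw : Y.H w = b • w) : funHH X Y φ (v ⊗ₜ w) = φ a b • (v ⊗ₜ[ℂ] w) := by
  classical
  by_cases h0 : v = 0
  · simp [h0]
  rw [funHH, LinearMap.sum_apply]
  simp only [TensorProduct.map_tmul, funH_apply X _ hv, funH_apply Y _ hw]
  rw [Finset.sum_eq_single a]
  · simp
  · intro c _ hc; rw [if_neg (Ne.symm hc), zero_smul, zero_tmul]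
  · intro h; exact absurd (mem_weights X hv h0) h

theorem braid_tmul (hX : IsWeight r X) (hY : IsWeight r Y) {a b : ℂ} {v : X} {w : Y}
    (hv : X.H v = a • v) (hw : Y.H w = b • w) :
    braid r X Y (v ⊗ₜ w) = ∑ n ∈ Finset.range r,
      (rcoef r n * qpow r ((a + 2 * n) * (b - 2 * n) / 2)) •
        ((Y.F ^ n) w ⊗ₜ[ℂ] (X.E ^ n) v) := by
  rw [braid, LinearMap.comp_apply, Rmat, LinearMap.comp_apply, LinearMap.sum_apply, map_sum,
    map_sum]
  refine Finset.sum_congr rfl fun n _ => ?_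
  rw [LinearMap.smul_apply, TensorProduct.map_tmul, map_smul, map_smul]
  have := funHH_tmul (fun a b => qpow r (a * b / 2)) (hX.H_E_pow_apply n hv) (hY.H_F_pow_apply n hw)
  have h2 : qHH r X Y = funHH X Y (fun a b => qpow r (a * b / 2)) := rfl
  rw [h2, this, map_smul, smul_smul]
  rfl

/-- The inverse of the braiding. -/
def braidInv (r : ℕ) (X Y : UMod) : Y ⊗[ℂ] X →ₗ[ℂ] X ⊗[ℂ] Y :=
  (∑ n ∈ Finset.range r, starRingEnd ℂ (rcoef r n) • TensorProduct.map (X.E ^ n) (Y.F ^ n)) ∘ₗ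
    funHH X Y (fun a b => qpow r (-(a * b / 2))) ∘ₗ (TensorProduct.comm ℂ Y X).toLinearMap

theorem braidInv_tmul {a b : ℂ} {v : X} {w : Y} (hv : X.H v = a • v) (hw : Y.H w = b • w) :
    braidInv r X Y (w ⊗ₜ v) = ∑ n ∈ Finset.range r,
      (starRingEnd ℂ (rcoef r n) * qpow r (-(a * b / 2))) •
        ((X.E ^ n) v ⊗ₜ[ℂ] (Y.F ^ n) w) := by
  have h : braidInv r X Y (w ⊗ₜ v) = (∑ n ∈ Finset.range r, starRingEnd ℂ (rcoef r n) •
      TensorProduct.map (X.E ^ n) (Y.F ^ n)) (funHH X Y (fun a b => qpow r (-(a * b / 2)))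
      (v ⊗ₜ w)) := rfl
  rw [h, funHH_tmul _ hv hw, map_smul, LinearMap.sum_apply, Finset.smul_sum]
  refine Finset.sum_congr rfl fun n _ => ?_
  rw [LinearMap.smul_apply, TensorProduct.map_tmul, smul_smul, mul_comm]

/-- The Cartan factors combine into a scalar depending only on the total degree `N`, so the
coefficient of `F^N w ⊗ E^N v` is an antidiagonal sum. It vanishes for `0 < N < r`, and `E^N = 0`
from `N = r` on. -/
theorem braid_braidInv (hX : IsWeight r X) (hY : IsWeight r Y) (hr : 2 ≤ r) :
    braid r X Y ∘ₗ braidInv r X Y = LinearMap.id := by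
  refine tensor_weight_ext hY.diag hX.diag fun b a w v hw hv => ?_
  rw [LinearMap.comp_apply, braidInv_tmul hv hw, map_sum, LinearMap.id_apply]
  have step : ∀ n ∈ Finset.range r, braid r X Y ((starRingEnd ℂ (rcoef r n) *
        qpow r (-(a * b / 2))) • ((X.E ^ n) v ⊗ₜ[ℂ] (Y.F ^ n) w)) =
      ∑ m ∈ Finset.range r, (starRingEnd ℂ (rcoef r n) * rcoef r m *
        qpow r ((a + 2 * (n + m : ℕ)) * (b - 2 * (n + m : ℕ)) / 2 - a * b / 2)) •
        ((Y.F ^ (n + m)) w ⊗ₜ[ℂ] (X.E ^ (n + m)) v) := by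
    intro n _
    rw [map_smul, braid_tmul hX hY (hX.H_E_pow_apply n hv) (hY.H_F_pow_apply n hw),
      Finset.smul_sum]
    refine Finset.sum_congr rfl fun m _ => ?_
    rw [smul_smul, ← Module.End.mul_apply, ← Module.End.mul_apply, ← pow_add, ← pow_add,
      add_comm m n]
    congr 1
    have : qpow r ((a + 2 * (n + m : ℕ)) * (b - 2 * (n + m : ℕ)) / 2 - a * b / 2) =
      qpow r (-(a * b / 2)) * qpow r ((a + 2 * n + 2 * m) * (b - 2 * n - 2 * m) / 2) := by
      rw [← qpow_add]; congr 1; push_cast; ring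
    rw [this]; ring
  rw [Finset.sum_congr rfl step, sum_range_sum_range_of_eq_zero, Finset.sum_eq_single 0]
  · simp [rcoef_zero, qpow_zero]
  · intro N hN h0
    have : ∀ p ∈ Finset.HasAntidiagonal.antidiagonal N, (starRingEnd ℂ (rcoef r p.1) * rcoef r p.2 *
        qpow r ((a + 2 * (p.1 + p.2 : ℕ)) * (b - 2 * (p.1 + p.2 : ℕ)) / 2 - a * b / 2)) •
        ((Y.F ^ (p.1 + p.2)) w ⊗ₜ[ℂ] (X.E ^ (p.1 + p.2)) v) =
        (starRingEnd ℂ (rcoef r p.1) * rcoef r p.2) •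
        (qpow r ((a + 2 * N) * (b - 2 * N) / 2 - a * b / 2) •
        ((Y.F ^ N) w ⊗ₜ[ℂ] (X.E ^ N) v)) := by
      intro p hp
      rw [Finset.HasAntidiagonal.mem_antidiagonal.mp hp, smul_smul]
    rw [Finset.sum_congr rfl this, ← Finset.sum_smul,
      sum_antidiagonal_conj_rcoef_mul_rcoef (Nat.pos_of_ne_zero h0) (Finset.mem_range.mp hN),
      zero_smul]
  · intro h; simp at h; omega
  · intro k l _ _ h
    rw [hX.E_pow_eq_zero h, LinearMap.zero_apply, tmul_zero, smul_zero]

/-- Composition with flips turns the two maps into endomorphisms of one finite-dimensional space,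
where a one-sided inverse is two-sided. -/
theorem braidInv_braid (hX : IsWeight r X) (hY : IsWeight r Y) (hr : 2 ≤ r) :
    braidInv r X Y ∘ₗ braid r X Y = LinearMap.id := by
  have h := braid_braidInv hX hY hr
  have h1 : (braid r X Y ∘ₗ (TensorProduct.comm ℂ Y X).toLinearMap) ∘ₗ
      ((TensorProduct.comm ℂ X Y).toLinearMap ∘ₗ braidInv r X Y) = LinearMap.id := by
    rw [← h]; ext; simp
  have h2 := mul_eq_one_comm.mp (show (braid r X Y ∘ₗ (TensorProduct.comm ℂ Y X).toLinearMap) *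
      ((TensorProduct.comm ℂ X Y).toLinearMap ∘ₗ braidInv r X Y) = 1 from h1)
  have h3 : ∀ x, (TensorProduct.comm ℂ X Y) (braidInv r X Y (braid r X Y
      ((TensorProduct.comm ℂ Y X) x))) = x := fun x => LinearMap.congr_fun h2 x
  refine LinearMap.ext fun x => ?_
  have h4 := h3 ((TensorProduct.comm ℂ X Y) x)
  exact (TensorProduct.comm ℂ X Y).injective (by simpa using h4)

/-- Moving `E` past `Fⁿ` creates a term in `F^(n-1)`. After an index shift the recursion
`rcoef_succ` matches it with the terms in which `E` and `K` act on the other factor. -/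
theorem braid_E (hX : IsWeight r X) (hY : IsWeight r Y) (hr : 2 ≤ r) :
    braid r X Y ∘ₗ (tensorR X Y).E = (tensorR Y X).E ∘ₗ braid r X Y := by
  have h1 := qbr_one_ne_zero hr
  refine tensor_weight_ext hX.diag hY.diag fun a b v w hv hw => ?_
  rw [LinearMap.comp_apply, LinearMap.comp_apply, tensor_E_tmul, map_add, hY.K_apply hw,
    tmul_smul, map_smul, braid_tmul hX hY hv (hY.H_E_apply hw),
    braid_tmul hX hY (hX.H_E_apply hv) hw, braid_tmul hX hY hv hw, map_sum]
  obtain ⟨s, rfl⟩ : ∃ s, r = s + 1 := ⟨r - 1, by omega⟩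
  set r := s + 1 with hrdef
  have hz : (X.E ^ (s + 1)) v = 0 := by
    rw [hX.E_pow_eq_zero le_rfl, LinearMap.zero_apply]
  have step : ∀ n ∈ Finset.range (s + 1), (tensorR Y X).E
      ((rcoef r n * qpow r ((a + 2 * n) * (b - 2 * n) / 2)) • ((Y.F ^ n) w ⊗ₜ[ℂ] (X.E ^ n) v)) =
      ((rcoef r n * qpow r ((a + 2 * n) * (b + 2 - 2 * n) / 2)) •
        ((Y.F ^ n) (Y.E w) ⊗ₜ[ℂ] (X.E ^ n) v)) +
      (rcoef r n * qpow r ((a + 2 * n) * (b - 2 * n) / 2)) •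
        ((Y.F ^ n) w ⊗ₜ[ℂ] (X.E ^ (n + 1)) v) +
      (rcoef r n * qpow r ((a + 2 * n) * (b + 2 - 2 * n) / 2) *
        (qbr r n * qbr r (b - n + 1) / qbr r 1 ^ 2)) •
        ((Y.F ^ (n - 1)) w ⊗ₜ[ℂ] (X.E ^ n) v) := by
    intro n _
    have hc : Y.E ((Y.F ^ n) w) = (Y.F ^ n) (Y.E w) +
        (qbr r n * qbr r (b - n + 1) / qbr r 1 ^ 2) • (Y.F ^ (n - 1)) w := by
      cases n with
      | zero => simp [qbr]
      | succ n =>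
        rw [hY.E_F_pow_apply hr n hw]; simp only [Nat.add_sub_cancel]; push_cast
        congr 5; ring
    have hq : qpow r ((a + 2 * n) * (b + 2 - 2 * n) / 2) =
        qpow r ((a + 2 * n) * (b - 2 * n) / 2) * qpow r (a + 2 * n) := by
      rw [← qpow_add]; congr 1; ring
    rw [map_smul, tensor_E_tmul, hX.K_apply (hX.H_E_pow_apply n hv), ← Module.End.mul_apply X.E,
      ← pow_succ', hc, hq, tmul_smul, add_tmul, ← smul_tmul']
    simp only [smul_add, smul_smul]
    simp only [mul_assoc]
    abel
  rw [Finset.sum_congr rfl step, Finset.sum_add_distrib, Finset.sum_add_distrib, add_assoc]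
  congr 1
  -- The top terms contain `E^r v = 0` and the commutator term at `n = 0` contains `{0} = 0`, so all
  -- the sums end up indexed by `n < r - 1`.
  rw [Finset.sum_range_succ, ← Module.End.mul_apply, ← pow_succ, hz, tmul_zero, smul_zero,
    add_zero, Finset.sum_range_succ, hz, tmul_zero, smul_zero, add_zero, Finset.sum_range_succ']
  simp only [Nat.cast_zero, Nat.add_sub_cancel]
  have hz0 : qbr r 0 = 0 := by simp [qbr]
  rw [hz0, zero_mul, zero_div, mul_zero, zero_smul, add_zero, ← Finset.sum_add_distrib,
    Finset.smul_sum]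
  refine Finset.sum_congr rfl fun n hn => ?_
  rw [← Module.End.mul_apply, ← pow_succ, smul_smul, ← add_smul]
  congr 1
  have hrc := rcoef_succ (r := r) (n := n) (by have := Finset.mem_range.mp hn; omega)
  have e1 : rcoef r (n + 1) * qpow r ((a + 2 * (n + 1 : ℕ)) * (b + 2 - 2 * (n + 1 : ℕ)) / 2) *
        (qbr r (n + 1 : ℕ) * qbr r (b - (n + 1 : ℕ) + 1) / qbr r 1 ^ 2) =
      rcoef r n * (qpow r n * qpow r ((a + 2 * (n + 1 : ℕ)) * (b + 2 - 2 * (n + 1 : ℕ)) / 2) *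
        qbr r (b - (n + 1 : ℕ) + 1)) := by
    push_cast
    field_simp
    linear_combination (qpow r ((a + 2 * (n + 1)) * (b + 2 - 2 * (n + 1)) / 2) *
      qbr r (b - (n + 1) + 1)) * hrc
  rw [e1]
  have e2 : qpow r b * qpow r ((a + 2 + 2 * n) * (b - 2 * n) / 2) =
      qpow r ((a + 2 * n) * (b - 2 * n) / 2) +
      qpow r n * qpow r ((a + 2 * (n + 1 : ℕ)) * (b + 2 - 2 * (n + 1 : ℕ)) / 2) *
        qbr r (b - (n + 1 : ℕ) + 1) := by
    push_cast
    simp only [qbr, mul_sub, ← qpow_add]; ring_nf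
  linear_combination rcoef r n * e2

/-- The mirror image of `braid_E`: now `F` is moved past `Eⁿ`, and the top terms vanish by `F^r =
0`. -/
theorem braid_F (hX : IsWeight r X) (hY : IsWeight r Y) (hr : 2 ≤ r) :
    braid r X Y ∘ₗ (tensorR X Y).F = (tensorR Y X).F ∘ₗ braid r X Y := by
  have h1 := qbr_one_ne_zero hr
  refine tensor_weight_ext hX.diag hY.diag fun a b v w hv hw => ?_
  rw [LinearMap.comp_apply, LinearMap.comp_apply, tensor_F_tmul, map_add, hX.Kinv_apply hv,
    ← smul_tmul', map_smul, braid_tmul hX hY hv (hY.H_F_apply hw),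
    braid_tmul hX hY (hX.H_F_apply hv) hw, braid_tmul hX hY hv hw, map_sum]
  obtain ⟨s, rfl⟩ : ∃ s, r = s + 1 := ⟨r - 1, by omega⟩
  set r := s + 1 with hrdef
  have hz : (Y.F ^ (s + 1)) w = 0 := by
    rw [hY.F_pow_eq_zero le_rfl, LinearMap.zero_apply]
  have step : ∀ n ∈ Finset.range (s + 1),
      (rcoef r n * qpow r ((a - 2 + 2 * n) * (b - 2 * n) / 2)) •
        ((Y.F ^ n) w ⊗ₜ[ℂ] (X.E ^ n) (X.F v)) =
      (rcoef r n * qpow r ((a - 2 + 2 * n) * (b - 2 * n) / 2)) •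
        ((Y.F ^ n) w ⊗ₜ[ℂ] X.F ((X.E ^ n) v)) +
      (rcoef r n * qpow r ((a - 2 + 2 * n) * (b - 2 * n) / 2) *
        (qbr r n * qbr r (a + n - 1) / qbr r 1 ^ 2)) •
        ((Y.F ^ n) w ⊗ₜ[ℂ] (X.E ^ (n - 1)) v) := by
    intro n _
    have hc : (X.E ^ n) (X.F v) = X.F ((X.E ^ n) v) +
        (qbr r n * qbr r (a + n - 1) / qbr r 1 ^ 2) • (X.E ^ (n - 1)) v := by
      cases n with
      | zero => simp [qbr]
      | succ n =>
        rw [hX.E_pow_F_apply hr n hv]; simp only [Nat.add_sub_cancel]; push_cast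
        congr 5; ring
    rw [hc, tmul_add, smul_add, tmul_smul, smul_smul]
  have step2 : ∀ n ∈ Finset.range (s + 1), (tensorR Y X).F
      ((rcoef r n * qpow r ((a + 2 * n) * (b - 2 * n) / 2)) • ((Y.F ^ n) w ⊗ₜ[ℂ] (X.E ^ n) v)) =
      (rcoef r n * qpow r ((a - 2 + 2 * n) * (b - 2 * n) / 2)) •
        ((Y.F ^ n) w ⊗ₜ[ℂ] X.F ((X.E ^ n) v)) +
      (rcoef r n * qpow r ((a + 2 * n) * (b - 2 * n) / 2)) •
        ((Y.F ^ (n + 1)) w ⊗ₜ[ℂ] (X.E ^ n) v) := by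
    intro n _
    have hq : qpow r ((a - 2 + 2 * n) * (b - 2 * n) / 2) =
        qpow r ((a + 2 * n) * (b - 2 * n) / 2) * qpow r (-(b - 2 * n)) := by
      rw [← qpow_add]; congr 1; ring
    rw [map_smul, tensor_F_tmul, hY.Kinv_apply (hY.H_F_pow_apply n hw),
      ← Module.End.mul_apply Y.F, ← pow_succ', hq, ← smul_tmul', smul_add, smul_smul, mul_assoc]
  rw [Finset.sum_congr rfl step, Finset.sum_congr rfl step2, Finset.sum_add_distrib,
    Finset.sum_add_distrib, add_left_comm]
  congr 1
  rw [Finset.sum_range_succ, ← Module.End.mul_apply, ← pow_succ, hz, zero_tmul, smul_zero,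
    add_zero, Finset.sum_range_succ', Finset.sum_range_succ, hz, zero_tmul, smul_zero, add_zero]
  simp only [Nat.cast_zero, Nat.add_sub_cancel]
  have hz0 : qbr r 0 = 0 := by simp [qbr]
  rw [hz0, zero_mul, zero_div, mul_zero, zero_smul, add_zero, Finset.smul_sum,
    ← Finset.sum_add_distrib]
  refine Finset.sum_congr rfl fun n hn => ?_
  rw [← Module.End.mul_apply, ← pow_succ, smul_smul, ← add_smul]
  congr 1
  have hrc := rcoef_succ (r := r) (n := n) (by have := Finset.mem_range.mp hn; omega)
  have e1 : rcoef r (n + 1) * qpow r ((a - 2 + 2 * (n + 1 : ℕ)) * (b - 2 * (n + 1 : ℕ)) / 2) *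
        (qbr r (n + 1 : ℕ) * qbr r (a + (n + 1 : ℕ) - 1) / qbr r 1 ^ 2) =
      rcoef r n * (qpow r n * qpow r ((a - 2 + 2 * (n + 1 : ℕ)) * (b - 2 * (n + 1 : ℕ)) / 2) *
        qbr r (a + (n + 1 : ℕ) - 1)) := by
    push_cast
    field_simp
    linear_combination (qpow r ((a - 2 + 2 * (n + 1)) * (b - 2 * (n + 1)) / 2) *
      qbr r (a + (n + 1) - 1)) * hrc
  rw [e1]
  have e2 : qpow r (-a) * qpow r ((a + 2 * n) * (b - 2 - 2 * n) / 2) +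
      qpow r n * qpow r ((a - 2 + 2 * (n + 1 : ℕ)) * (b - 2 * (n + 1 : ℕ)) / 2) *
        qbr r (a + (n + 1 : ℕ) - 1) = qpow r ((a + 2 * n) * (b - 2 * n) / 2) := by
    push_cast
    simp only [qbr, mul_sub, ← qpow_add]; ring_nf
  linear_combination rcoef r n * e2

theorem braid_weight (hX : IsWeight r X) (hY : IsWeight r Y) {a b : ℂ} {v : X} {w : Y}
    (hv : X.H v = a • v) (hw : Y.H w = b • w) :
    (tensorR Y X).H (braid r X Y (v ⊗ₜ w)) = (a + b) • braid r X Y (v ⊗ₜ w) := by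
  rw [braid_tmul hX hY hv hw, map_sum, Finset.smul_sum]
  refine Finset.sum_congr rfl fun n _ => ?_
  rw [map_smul, tensor_H_weight (hY.H_F_pow_apply n hw) (hX.H_E_pow_apply n hv), smul_comm,
    show b - 2 * n + (a + 2 * n) = a + b by ring]

/-- The braiding as a morphism. -/
def braidHom (hr : 2 ≤ r) (hX : IsWeight r X) (hY : IsWeight r Y) :
    Hom (tensorR X Y) (tensorR Y X) where
  map := braid r X Y
  comm_E := braid_E hX hY hr
  comm_F := braid_F hX hY hr
  comm_K := tensor_weight_ext hX.diag hY.diag fun a b v w hv hw => by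
    rw [LinearMap.comp_apply, LinearMap.comp_apply,
      (hX.tensor hr hY).K_apply (X := tensorR X Y) (tensor_H_weight hv hw),
      (hY.tensor hr hX).K_apply (X := tensorR Y X) (braid_weight hX hY hv hw), map_smul]
  comm_Kinv := tensor_weight_ext hX.diag hY.diag fun a b v w hv hw => by
    rw [LinearMap.comp_apply, LinearMap.comp_apply,
      (hX.tensor hr hY).Kinv_apply (X := tensorR X Y) (tensor_H_weight hv hw),
      (hY.tensor hr hX).Kinv_apply (X := tensorR Y X) (braid_weight hX hY hv hw), map_smul]
  comm_H := tensor_weight_ext hX.diag hY.diag fun a b v w hv hw => by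
    rw [LinearMap.comp_apply, LinearMap.comp_apply,
      tensor_H_weight hv hw, braid_weight hX hY hv hw, map_smul]

theorem Hom.map_weight (f : Hom X Y) {a : ℂ} {v : X} (hv : X.H v = a • v) :
    Y.H (f.map v) = a • f.map v := by
  have := LinearMap.congr_fun f.comm_H v
  rw [LinearMap.comp_apply, LinearMap.comp_apply, hv, map_smul] at this
  exact this.symm

theorem Hom.map_E_pow (f : Hom X Y) (n : ℕ) (v : X) : f.map ((X.E ^ n) v) = (Y.E ^ n) (f.map v) := by
  induction n with
  | zero => rfl
  | succ n ih =>
    rw [pow_succ', Module.End.mul_apply, pow_succ', Module.End.mul_apply, ← ih]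
    exact LinearMap.congr_fun f.comm_E _

theorem Hom.map_F_pow (f : Hom X Y) (n : ℕ) (v : X) : f.map ((X.F ^ n) v) = (Y.F ^ n) (f.map v) := by
  induction n with
  | zero => rfl
  | succ n ih =>
    rw [pow_succ', Module.End.mul_apply, pow_succ', Module.End.mul_apply, ← ih]
    exact LinearMap.congr_fun f.comm_F _

theorem braid_naturality {X' Y' : UMod} (hX : IsWeight r X) (hY : IsWeight r Y)
    (hX' : IsWeight r X') (hY' : IsWeight r Y') (f : Hom X X') (g : Hom Y Y') :
    braid r X' Y' ∘ₗ TensorProduct.map f.map g.map =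
      TensorProduct.map g.map f.map ∘ₗ braid r X Y := by
  refine tensor_weight_ext hX.diag hY.diag fun a b v w hv hw => ?_
  rw [LinearMap.comp_apply, LinearMap.comp_apply, TensorProduct.map_tmul,
    braid_tmul hX' hY' (f.map_weight hv) (g.map_weight hw), braid_tmul hX hY hv hw, map_sum]
  refine Finset.sum_congr rfl fun n _ => ?_
  rw [map_smul, TensorProduct.map_tmul, f.map_E_pow, g.map_F_pow]

theorem Kinv_pow_apply (hX : IsWeight r X) {a : ℂ} {v : X} (hv : X.H v = a • v) (n : ℕ) :
    (X.Kinv ^ n) v = qpow r (-(n * a)) • v := by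
  induction n with
  | zero => simp [qpow_zero]
  | succ n ih =>
    rw [pow_succ', Module.End.mul_apply, ih, map_smul, hX.Kinv_apply hv, smul_smul, ← qpow_add]
    congr 2; push_cast; ring

theorem K_pow_apply (hX : IsWeight r X) {a : ℂ} {v : X} (hv : X.H v = a • v) (n : ℕ) :
    (X.K ^ n) v = qpow r (n * a) • v := by
  induction n with
  | zero => simp [qpow_zero]
  | succ n ih =>
    rw [pow_succ', Module.End.mul_apply, ih, map_smul, hX.K_apply hv, smul_smul, ← qpow_add]
    congr 2; push_cast; ring

/-- This is `(1 ⊗ Δ) R = R₁₃ R₁₂`. Expanding `Fⁿ` on `Y ⊗ Z` by the `q`-binomial theorem reduces it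
to `rcoef_mul_gaussBinom`, the leftover powers of `q` being absorbed by the Cartan part. -/
theorem braid_tensor_right (hr : 2 ≤ r) (hX : IsWeight r X) (hY : IsWeight r Y)
    (hZ : IsWeight r Z) :
    (TensorProduct.assoc ℂ Y Z X).toLinearMap ∘ₗ braid r X (tensorR Y Z) ∘ₗ
        (TensorProduct.assoc ℂ X Y Z).toLinearMap =
      TensorProduct.map LinearMap.id (braid r X Z) ∘ₗ (TensorProduct.assoc ℂ Y X Z).toLinearMap ∘ₗ
        TensorProduct.map (braid r X Y) LinearMap.id := by
  refine tensor_weight_ext₃ hX.diag hY.diag hZ.diag fun a b c x y z hx hy hz => ?_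
  simp only [LinearMap.comp_apply, LinearEquiv.coe_coe, TensorProduct.assoc_tmul,
    TensorProduct.map_tmul, LinearMap.id_apply]
  rw [braid_tmul hX (hY.tensor hr hZ) hx (tensor_H_weight hy hz), braid_tmul hX hY hx hy,
    sum_tmul, map_sum, map_sum, map_sum]
  have rhs : ∀ k ∈ Finset.range r, TensorProduct.map LinearMap.id (braid r X Z)
      (TensorProduct.assoc ℂ Y X Z (((rcoef r k * qpow r ((a + 2 * k) * (b - 2 * k) / 2)) •
        ((Y.F ^ k) y ⊗ₜ[ℂ] (X.E ^ k) x)) ⊗ₜ[ℂ] z)) =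
      ∑ l ∈ Finset.range r, (rcoef r k * qpow r ((a + 2 * k) * (b - 2 * k) / 2) *
        (rcoef r l * qpow r ((a + 2 * k + 2 * l) * (c - 2 * l) / 2))) •
        ((Y.F ^ k) y ⊗ₜ[ℂ] ((Z.F ^ l) z ⊗ₜ[ℂ] (X.E ^ (k + l)) x)) := by
    intro k _
    rw [← smul_tmul', map_smul, map_smul, TensorProduct.assoc_tmul, TensorProduct.map_tmul,
      braid_tmul hX hZ (hX.H_E_pow_apply k hx) hz, tmul_sum, Finset.smul_sum]
    refine Finset.sum_congr rfl fun l _ => ?_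
    have hE : (X.E ^ l) ((X.E ^ k) x) = (X.E ^ (k + l)) x := by
      rw [← Module.End.mul_apply, ← pow_add, add_comm]
    rw [tmul_smul, smul_smul, hE]; rfl
  rw [Finset.sum_congr rfl rhs, sum_range_sum_range_of_eq_zero]
  · refine Finset.sum_congr rfl fun n hn => ?_
    have hn := Finset.mem_range.mp hn
    rw [tensor_F_pow hY, LinearMap.sum_apply, sum_tmul, Finset.smul_sum, map_sum,
      -- After the swap, `k` is the exponent of `F` on `Y` and `l` the exponent on `Z`, as on the
      -- other side.
      ← Finset.Nat.sum_antidiagonal_swap]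
    refine Finset.sum_congr rfl fun p hp => ?_
    obtain ⟨k, l⟩ := p
    have hp : k + l = n := Finset.HasAntidiagonal.mem_antidiagonal.mp hp
    subst hp
    simp only [Prod.fst_swap, Prod.snd_swap]
    rw [LinearMap.smul_apply, TensorProduct.map_tmul, Module.End.mul_apply,
      Kinv_pow_apply hY hy, map_smul (Y.F ^ k), ← smul_tmul', ← smul_tmul', ← smul_tmul', map_smul, map_smul,
      map_smul, TensorProduct.assoc_tmul, smul_smul, smul_smul]
    congr 1
    have hg := rcoef_mul_gaussBinom (r := r) (k := l) (l := k) (by omega)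
    rw [add_comm l k] at hg
    have hq : qpow r (2 * l * k) * qpow r ((a + 2 * (k + l : ℕ)) * (b + c - 2 * (k + l : ℕ)) / 2) *
        qpow r (-(l * b)) = qpow r ((a + 2 * k) * (b - 2 * k) / 2) *
          qpow r ((a + 2 * k + 2 * l) * (c - 2 * l) / 2) := by
      simp only [← qpow_add]; congr 1; push_cast; ring
    linear_combination (qpow r ((a + 2 * (k + l : ℕ)) * (b + c - 2 * (k + l : ℕ)) / 2) *
        qpow r (-(l * b))) * hg + (rcoef r l * rcoef r k) * hq
  · intro k l _ _ h
    rw [hX.E_pow_eq_zero h, LinearMap.zero_apply, tmul_zero, tmul_zero, smul_zero]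

/-- This is `(Δ ⊗ 1) R = R₁₃ R₂₃`, now with the expansion of `Eⁿ` on `X ⊗ Y`. -/
theorem braid_tensor_left (hr : 2 ≤ r) (hX : IsWeight r X) (hY : IsWeight r Y)
    (hZ : IsWeight r Z) :
    (TensorProduct.assoc ℂ Z X Y).symm.toLinearMap ∘ₗ braid r (tensorR X Y) Z =
      TensorProduct.map (braid r X Z) LinearMap.id ∘ₗ
        (TensorProduct.assoc ℂ X Z Y).symm.toLinearMap ∘ₗ
        TensorProduct.map LinearMap.id (braid r Y Z) ∘ₗ
        (TensorProduct.assoc ℂ X Y Z).toLinearMap := by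
  refine tensor_weight_ext₃ hX.diag hY.diag hZ.diag fun a b c x y z hx hy hz => ?_
  simp only [LinearMap.comp_apply, LinearEquiv.coe_coe, TensorProduct.assoc_tmul,
    TensorProduct.map_tmul, LinearMap.id_apply]
  rw [braid_tmul (hX.tensor hr hY) hZ (tensor_H_weight hx hy) hz, braid_tmul hY hZ hy hz,
    tmul_sum, map_sum, map_sum, map_sum]
  have rhs : ∀ k ∈ Finset.range r, TensorProduct.map (braid r X Z) LinearMap.id
      ((TensorProduct.assoc ℂ X Z Y).symm (x ⊗ₜ[ℂ] ((rcoef r k *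
        qpow r ((b + 2 * k) * (c - 2 * k) / 2)) • ((Z.F ^ k) z ⊗ₜ[ℂ] (Y.E ^ k) y)))) =
      ∑ l ∈ Finset.range r, (rcoef r k * qpow r ((b + 2 * k) * (c - 2 * k) / 2) *
        (rcoef r l * qpow r ((a + 2 * l) * (c - 2 * k - 2 * l) / 2))) •
        (((Z.F ^ (k + l)) z ⊗ₜ[ℂ] (X.E ^ l) x) ⊗ₜ[ℂ] (Y.E ^ k) y) := by
    intro k _
    rw [tmul_smul, map_smul, map_smul, TensorProduct.assoc_symm_tmul, TensorProduct.map_tmul,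
      braid_tmul hX hZ hx (hZ.H_F_pow_apply k hz), sum_tmul, Finset.smul_sum]
    refine Finset.sum_congr rfl fun l _ => ?_
    have hF : (Z.F ^ l) ((Z.F ^ k) z) = (Z.F ^ (k + l)) z := by
      rw [← Module.End.mul_apply, ← pow_add, add_comm]
    rw [← smul_tmul', smul_smul, hF]; rfl
  rw [Finset.sum_congr rfl rhs, sum_range_sum_range_of_eq_zero]
  · refine Finset.sum_congr rfl fun n hn => ?_
    have hn := Finset.mem_range.mp hn
    rw [tensor_E_pow hY, LinearMap.sum_apply, tmul_sum, Finset.smul_sum, map_sum,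
      ← Finset.Nat.sum_antidiagonal_swap]
    refine Finset.sum_congr rfl fun p hp => ?_
    obtain ⟨k, l⟩ := p
    have hp : k + l = n := Finset.HasAntidiagonal.mem_antidiagonal.mp hp
    subst hp
    simp only [Prod.fst_swap, Prod.snd_swap]
    rw [LinearMap.smul_apply, TensorProduct.map_tmul, Module.End.mul_apply,
      K_pow_apply hY hy, map_smul (Y.E ^ k), tmul_smul, tmul_smul, tmul_smul, map_smul, map_smul,
      map_smul, TensorProduct.assoc_symm_tmul, smul_smul, smul_smul]
    congr 1
    have hg := rcoef_mul_gaussBinom (r := r) (k := l) (l := k) (by omega)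
    rw [add_comm l k] at hg
    have hq : qpow r (2 * l * k) * qpow r ((a + b + 2 * (k + l : ℕ)) * (c - 2 * (k + l : ℕ)) / 2) *
        qpow r (l * b) = qpow r ((b + 2 * k) * (c - 2 * k) / 2) *
          qpow r ((a + 2 * l) * (c - 2 * k - 2 * l) / 2) := by
      simp only [← qpow_add]; congr 1; push_cast; ring
    linear_combination (qpow r ((a + b + 2 * (k + l : ℕ)) * (c - 2 * (k + l : ℕ)) / 2) *
        qpow r (l * b)) * hg + (rcoef r l * rcoef r k) * hq
  · intro k l _ _ h
    rw [hZ.F_pow_eq_zero h, LinearMap.zero_apply, zero_tmul, zero_tmul, smul_zero]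

end UMod

/-! ## The braided category of weight modules -/

section Braided

open BraidedCategory

variable {C : Type*} [Category C] [MonoidalCategory C] [BraidedCategory C]

/-- Given pairings `V' ⊗ V ⟶ 𝟙` and `W' ⊗ W ⟶ 𝟙`, the induced pairing of `W' ⊗ V'` and `V ⊗ W`,
precomposed with the double braiding of `V` and `W`. -/
theorem double_braiding_comp_pairing {V W V' W' : C} (f : V' ⊗ V ⟶ 𝟙_ C) (g : W' ⊗ W ⟶ 𝟙_ C) :
    ((β_ V W).hom ≫ (β_ W V).hom) ▷ (W' ⊗ V') ≫ (β_ (V ⊗ W) (W' ⊗ V')).hom ≫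
        (α_ W' V' (V ⊗ W)).hom ≫ W' ◁ ((α_ V' V W).inv ≫ f ▷ W ≫ (λ_ W).hom) ≫ g =
      (α_ V W (W' ⊗ V')).hom ≫
        V ◁ ((α_ W W' V').inv ≫ ((β_ W W').hom ≫ g) ▷ V' ≫ (λ_ V').hom) ≫ (β_ V V').hom ≫ f := by
  -- In strands, `k` carries `V` across `W'` and then closes it up with `V'`.
  set k : V ⊗ (W' ⊗ V') ⟶ W' := (α_ V W' V').inv ≫ (β_ V W').hom ▷ V' ≫ (α_ W' V V').hom ≫
    W' ◁ ((β_ V V').hom ≫ f) ≫ (ρ_ W').hom with hk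
  have h1 : (β_ V (W' ⊗ V')).hom ▷ W ≫ (α_ (W' ⊗ V') V W).hom ≫
      (α_ W' V' (V ⊗ W)).hom ≫ W' ◁ ((α_ V' V W).inv ≫ f ▷ W ≫ (λ_ W).hom) ≫ g = k ▷ W ≫ g := by
    rw [hk, braiding_tensor_right_hom]
    monoidal
  -- Regrouping the crossings lets `W` pass all of `V ⊗ (W' ⊗ V')` at once, so that naturality can
  -- slide `k` through it.
  have h2 : (β_ W V).hom ▷ (W' ⊗ V') ≫ (β_ (V ⊗ W) (W' ⊗ V')).hom =
      (α_ W V (W' ⊗ V')).hom ≫ (β_ W (V ⊗ (W' ⊗ V'))).hom ≫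
        (β_ V (W' ⊗ V')).hom ▷ W ≫ (α_ (W' ⊗ V') V W).hom := by
    rw [braiding_tensor_left_hom, braiding_tensor_right_hom W V (W' ⊗ V')]
    monoidal
  have h3 : (β_ V W).hom ▷ (W' ⊗ V') ≫ (α_ W V (W' ⊗ V')).hom ≫ W ◁ ((α_ V W' V').inv ≫
      (β_ V W').hom ▷ V' ≫ (α_ W' V V').hom) =
      (α_ V W (W' ⊗ V')).hom ≫ V ◁ (α_ W W' V').inv ≫ (α_ V (W ⊗ W') V').inv ≫
        (β_ V (W ⊗ W')).hom ▷ V' ≫ (α_ (W ⊗ W') V V').hom ≫ (α_ W W' (V ⊗ V')).hom := by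
    rw [braiding_tensor_right_hom V W W']
    monoidal
  have h4 : W ◁ (W' ◁ ((β_ V V').hom ≫ f) ≫ (ρ_ W').hom) ≫ (β_ W W').hom ≫ g =
      (α_ W W' (V ⊗ V')).inv ≫ ((β_ W W').hom ≫ g) ▷ (V ⊗ V') ≫ (λ_ _).hom ≫ (β_ V V').hom ≫ f := by
    rw [← leftUnitor_naturality, ← whisker_exchange_assoc]
    monoidal
  -- The strand `V` crosses a closed cap, hence can be pulled off it.
  have h5 : (β_ V (W ⊗ W')).hom ≫ ((β_ W W').hom ≫ g) ▷ V =
      V ◁ ((β_ W W').hom ≫ g) ≫ (ρ_ V).hom ≫ (λ_ V).inv := by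
    rw [← braiding_naturality_right, braiding_tensorUnit_right]
  calc _ = (β_ V W).hom ▷ (W' ⊗ V') ≫ ((β_ W V).hom ▷ (W' ⊗ V') ≫ (β_ (V ⊗ W) (W' ⊗ V')).hom) ≫
        (α_ W' V' (V ⊗ W)).hom ≫ W' ◁ ((α_ V' V W).inv ≫ f ▷ W ≫ (λ_ W).hom) ≫ g := by
        simp only [comp_whiskerRight, Category.assoc]
    _ = (β_ V W).hom ▷ (W' ⊗ V') ≫ (α_ W V (W' ⊗ V')).hom ≫ (β_ W (V ⊗ (W' ⊗ V'))).hom ≫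
        (β_ V (W' ⊗ V')).hom ▷ W ≫ (α_ (W' ⊗ V') V W).hom ≫
        (α_ W' V' (V ⊗ W)).hom ≫ W' ◁ ((α_ V' V W).inv ≫ f ▷ W ≫ (λ_ W).hom) ≫ g := by
        rw [h2]; simp only [Category.assoc]
    _ = (β_ V W).hom ▷ (W' ⊗ V') ≫ (α_ W V (W' ⊗ V')).hom ≫ W ◁ k ≫ (β_ W W').hom ≫ g := by
        rw [h1, braiding_naturality_right_assoc]
    _ = ((β_ V W).hom ▷ (W' ⊗ V') ≫ (α_ W V (W' ⊗ V')).hom ≫ W ◁ ((α_ V W' V').inv ≫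
          (β_ V W').hom ▷ V' ≫ (α_ W' V V').hom)) ≫
          W ◁ (W' ◁ ((β_ V V').hom ≫ f) ≫ (ρ_ W').hom) ≫ (β_ W W').hom ≫ g := by
        rw [hk]; simp only [MonoidalCategory.whiskerLeft_comp, Category.assoc]
    _ = (α_ V W (W' ⊗ V')).hom ≫ V ◁ (α_ W W' V').inv ≫ (α_ V (W ⊗ W') V').inv ≫
        ((β_ V (W ⊗ W')).hom ≫ ((β_ W W').hom ≫ g) ▷ V) ▷ V' ≫ (α_ (𝟙_ C) V V').hom ≫
        (λ_ _).hom ≫ (β_ V V').hom ≫ f := by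
        rw [h3, h4]; monoidal
    _ = _ := by
        rw [h5]; monoidal

end Braided

namespace UMod

variable {r : ℕ} {X Y Z : UMod}

/-- The braiding as an isomorphism. -/
def braidIso (hr : 2 ≤ r) (hX : IsWeight r X) (hY : IsWeight r Y) : X ⊗ Y ≅ Y ⊗ X :=
  mkIso (X := tensorR X Y) (Y := tensorR Y X)
    (LinearEquiv.ofLinearMap (braid r X Y) (braidInv r X Y) (braid_braidInv hX hY hr)
      (braidInv_braid hX hY hr))
    (LinearMap.congr_fun (braid_E hX hY hr)) (LinearMap.congr_fun (braid_F hX hY hr))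
    (LinearMap.congr_fun (braidHom hr hX hY).comm_K)
    (LinearMap.congr_fun (braidHom hr hX hY).comm_Kinv)
    (LinearMap.congr_fun (braidHom hr hX hY).comm_H)

theorem braidIso_naturality_right (hr : 2 ≤ r) (hX : IsWeight r X) (hY : IsWeight r Y)
    (hZ : IsWeight r Z) (f : Y ⟶ Z) :
    X ◁ f ≫ (braidIso hr hX hZ).hom = (braidIso hr hX hY).hom ≫ f ▷ X :=
  hom_ext (braid_naturality hX hY hX hZ (𝟙 X : X ⟶ X) f)

theorem braidIso_naturality_left (hr : 2 ≤ r) (hX : IsWeight r X) (hY : IsWeight r Y)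
    (hZ : IsWeight r Z) (f : X ⟶ Y) :
    f ▷ Z ≫ (braidIso hr hY hZ).hom = (braidIso hr hX hZ).hom ≫ Z ◁ f :=
  hom_ext (braid_naturality hX hZ hY hZ f (𝟙 Z : Z ⟶ Z))

theorem braidIso_hexagon_forward (hr : 2 ≤ r) (hX : IsWeight r X) (hY : IsWeight r Y)
    (hZ : IsWeight r Z) :
    (α_ X Y Z).hom ≫ (braidIso (Y := Y ⊗ Z) hr hX (hY.tensor hr hZ)).hom ≫ (α_ Y Z X).hom =
      ((braidIso hr hX hY).hom ▷ Z) ≫ (α_ Y X Z).hom ≫ (Y ◁ (braidIso hr hX hZ).hom) :=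
  hom_ext (braid_tensor_right hr hX hY hZ)

theorem braidIso_hexagon_reverse (hr : 2 ≤ r) (hX : IsWeight r X) (hY : IsWeight r Y)
    (hZ : IsWeight r Z) :
    (α_ X Y Z).inv ≫ (braidIso (X := X ⊗ Y) hr (hX.tensor hr hY) hZ).hom ≫ (α_ Z X Y).inv =
      (X ◁ (braidIso hr hY hZ).hom) ≫ (α_ X Z Y).inv ≫ ((braidIso hr hX hZ).hom ▷ Y) := by
  rw [Iso.inv_comp_eq]
  exact hom_ext (braid_tensor_left hr hX hY hZ)

/-- The category of finite dimensional weight modules. -/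
structure WMod (r : ℕ) : Type 1 where
  obj : UMod
  isWeight : IsWeight r obj

namespace WMod

instance : Category (WMod r) where
  Hom V W := UMod.Hom V.obj W.obj
  id V := 𝟙 V.obj
  comp f g := CategoryStruct.comp (obj := UMod) f g

variable [hr : Fact (2 ≤ r)]

/-- An isomorphism of underlying modules is an isomorphism of weight modules. -/
def isoOf {V W : WMod r} (e : V.obj ≅ W.obj) : V ≅ W where
  hom := e.hom
  inv := e.inv
  hom_inv_id := e.hom_inv_id
  inv_hom_id := e.inv_hom_id

instance : MonoidalCategoryStruct (WMod r) where
  tensorObj V W := ⟨V.obj.tensor W.obj, V.isWeight.tensor hr.out W.isWeight⟩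
  whiskerLeft V _ _ f := UMod.tensorHom (𝟙 V.obj) f
  whiskerRight f W := UMod.tensorHom f (𝟙 W.obj)
  tensorHom f g := UMod.tensorHom f g
  tensorUnit := ⟨UMod.unit, IsWeight.unit hr.out⟩
  associator U V W := isoOf (UMod.assocIso U.obj V.obj W.obj)
  leftUnitor V := isoOf (UMod.lidIso V.obj)
  rightUnitor V := isoOf (UMod.ridIso V.obj)

instance : MonoidalCategory (WMod r) := MonoidalCategory.ofTensorHom
  (id_tensorHom_id := fun _ _ => UMod.Hom.ext' TensorProduct.map_id)
  (id_tensorHom := fun _ {_ _} _ => rfl)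
  (tensorHom_id := fun _ _ => rfl)
  (tensorHom_comp_tensorHom := fun _ _ _ _ =>
    UMod.Hom.ext' (TensorProduct.map_comp _ _ _ _).symm)
  (associator_naturality := fun f₁ f₂ f₃ =>
    MonoidalCategory.associator_naturality (C := UMod) f₁ f₂ f₃)
  (leftUnitor_naturality := fun f => MonoidalCategory.leftUnitor_naturality (C := UMod) f)
  (rightUnitor_naturality := fun f => MonoidalCategory.rightUnitor_naturality (C := UMod) f)
  (pentagon := fun U V W Z => MonoidalCategory.pentagon (C := UMod) U.obj V.obj W.obj Z.obj)
  (triangle := fun V W => MonoidalCategory.triangle (C := UMod) V.obj W.obj)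

instance : BraidedCategory (WMod r) where
  braiding V W := isoOf (braidIso hr.out V.isWeight W.isWeight)
  braiding_naturality_right X _ _ f :=
    braidIso_naturality_right hr.out X.isWeight (isWeight _) (isWeight _) f
  braiding_naturality_left f Z :=
    braidIso_naturality_left hr.out (isWeight _) (isWeight _) Z.isWeight f
  hexagon_forward X Y Z := braidIso_hexagon_forward hr.out X.isWeight Y.isWeight Z.isWeight
  hexagon_reverse X Y Z := braidIso_hexagon_reverse hr.out X.isWeight Y.isWeight Z.isWeight

end WMod

end UMod

namespace UMod

/-! ## The twist -/

variable {r : ℕ} {X Y Z : UMod}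

theorem ev_comp (v : X) (φ : Module.Dual ℂ X) : ev X (φ ⊗ₜ v) = φ v := by
  simp [ev]

/-- The evaluation as a morphism. -/
def evHom (hX : IsWeight r X) : Hom (tensorR (dualR X) X) unitR where
  map := ev X
  comm_E := by
    refine TensorProduct.ext' fun φ v => ?_
    rw [LinearMap.comp_apply, tensor_E_tmul, map_add, ev_comp, ev_comp, dual_E_apply,
      hX.Kinv_K_apply]
    exact add_neg_cancel _
  comm_F := by
    refine TensorProduct.ext' fun φ v => ?_
    rw [LinearMap.comp_apply, tensor_F_tmul, map_add, ev_comp, ev_comp, dual_F_apply,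
      dual_Kinv_apply]
    exact add_neg_cancel _
  comm_K := by
    refine TensorProduct.ext' fun φ v => ?_
    rw [LinearMap.comp_apply, tensor_K_tmul, ev_comp, dual_K_apply, hX.Kinv_K_apply]
    exact (ev_comp _ _).symm
  comm_Kinv := by
    refine TensorProduct.ext' fun φ v => ?_
    rw [LinearMap.comp_apply, tensor_Kinv_tmul, ev_comp, dual_Kinv_apply, hX.K_Kinv_apply]
    exact (ev_comp _ _).symm
  comm_H := by
    refine TensorProduct.ext' fun φ v => ?_
    rw [LinearMap.comp_apply, tensor_H_tmul, map_add, ev_comp, ev_comp, dual_H_apply]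
    exact neg_add_cancel _

/-- The operator of the Drinfeld element. -/
def drinfeld (r : ℕ) (X : UMod) : Module.End ℂ X :=
  ∑ n ∈ Finset.range r, rcoef r n •
    ((-(X.K * X.F)) ^ n * X.funH (fun a => qpow r (-a ^ 2 / 2)) * X.E ^ n)

theorem theta_eq (r : ℕ) (X : UMod) : theta r X = X.K ^ (r - 1) * drinfeld r X := rfl

theorem drinfeld_apply (hX : IsWeight r X) {a : ℂ} {v : X} (hv : X.H v = a • v) :
    drinfeld r X v = ∑ n ∈ Finset.range r, (rcoef r n * qpow r (-(a + 2 * n) ^ 2 / 2)) •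
      ((-(X.K * X.F)) ^ n) ((X.E ^ n) v) := by
  rw [drinfeld, LinearMap.sum_apply]
  refine Finset.sum_congr rfl fun n _ => ?_
  rw [LinearMap.smul_apply, Module.End.mul_apply, Module.End.mul_apply,
    funH_apply X _ (hX.H_E_pow_apply n hv), map_smul, smul_smul]

theorem neg_K_F_weight (hX : IsWeight r X) {a : ℂ} {v : X} (hv : X.H v = a • v) (n : ℕ) :
    X.H (((-(X.K * X.F)) ^ n) v) = (a - 2 * n) • ((-(X.K * X.F)) ^ n) v := by
  rw [hX.neg_K_F_pow_apply hv, map_smul, hX.H_F_pow_apply n hv, smul_comm]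

/-- The characterisation of the Drinfeld element through the braiding: `Fⁿ` acting on `φ` becomes
`S(Fⁿ)` acting on the vector, and `q^(H ⊗ H / 2)` becomes `q^(-H² / 2)`. -/
theorem ev_braid (hX : IsWeight r X) (v : X) (φ : Module.Dual ℂ X) :
    ev X (braid r X (dualR X) (v ⊗ₜ φ)) = φ (drinfeld r X v) := by
  have key : ev X ∘ₗ braid r X (dualR X) = ev X ∘ₗ (TensorProduct.comm ℂ X (dualR X)).toLinearMap ∘ₗ
      TensorProduct.map (drinfeld r X) LinearMap.id := by
    refine tensor_weight_ext hX.diag hX.dual.diag fun a b v φ hv hφ => ?_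
    rw [LinearMap.comp_apply, LinearMap.comp_apply, LinearMap.comp_apply,
      braid_tmul hX hX.dual hv hφ, TensorProduct.map_tmul, LinearEquiv.coe_coe,
      TensorProduct.comm_tmul, ev_comp, drinfeld_apply hX hv, map_sum, map_sum]
    refine Finset.sum_congr rfl fun n _ => ?_
    rw [map_smul, ev_comp, dual_F_pow_apply, LinearMap.id_apply, map_smul]
    -- Raising and lowering by `n` restores the weight `a`, so only functionals of weight `b = -a`
    -- contribute.
    rcases dual_weight_apply hφ (neg_K_F_weight hX (hX.H_E_pow_apply n hv) n) with h | h
    · have : b = -a := by linear_combination h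
      rw [this]; congr 3; ring
    · rw [h, smul_zero, smul_zero]
  have := LinearMap.congr_fun key (v ⊗ₜ φ)
  simpa only [LinearMap.comp_apply, TensorProduct.map_tmul, LinearEquiv.coe_coe,
      TensorProduct.comm_tmul, ev_comp, LinearMap.id_apply] using this

theorem dual_ext {V : Type} [AddCommGroup V] [Module ℂ V] {v w : V}
    (h : ∀ φ : Module.Dual ℂ V, φ v = φ w) : v = w := by
  rw [← sub_eq_zero, ← Module.forall_dual_apply_eq_zero_iff ℂ]
  intro φ; rw [map_sub, h, sub_self]

/-! ### The dual of a tensor product -/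

/-- The map `g ⊗ f ↦ (v ⊗ w ↦ f v * g w)`. -/
def dualTensorMap (X Y : UMod) : Module.Dual ℂ Y ⊗[ℂ] Module.Dual ℂ X →ₗ[ℂ]
    Module.Dual ℂ (X ⊗[ℂ] Y) :=
  TensorProduct.dualDistrib ℂ X Y ∘ₗ (TensorProduct.comm ℂ _ _).toLinearMap

theorem dualTensorMap_tmul (f : Module.Dual ℂ X) (g : Module.Dual ℂ Y) (v : X) (w : Y) :
    dualTensorMap X Y (g ⊗ₜ f) (v ⊗ₜ w) = f v * g w := by
  simp [dualTensorMap]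

/-- `Y* ⊗ X* ≃ (X ⊗ Y)*`. -/
def dualTensorEquiv (X Y : UMod) : Module.Dual ℂ Y ⊗[ℂ] Module.Dual ℂ X ≃ₗ[ℂ]
    Module.Dual ℂ (X ⊗[ℂ] Y) :=
  (TensorProduct.comm ℂ _ _).trans (TensorProduct.dualDistribEquiv ℂ X Y)

theorem dualTensorEquiv_apply (x : Module.Dual ℂ Y ⊗[ℂ] Module.Dual ℂ X) :
    dualTensorEquiv X Y x = dualTensorMap X Y x := rfl

theorem dual_tensor_ext {Φ Ψ : Module.Dual ℂ Y ⊗[ℂ] Module.Dual ℂ X →ₗ[ℂ] Module.Dual ℂ (X ⊗[ℂ] Y)}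
    (h : ∀ f g v w, Φ (g ⊗ₜ f) (v ⊗ₜ w) = Ψ (g ⊗ₜ f) (v ⊗ₜ w)) : Φ = Ψ :=
  TensorProduct.ext' fun g f => TensorProduct.ext' fun v w => h f g v w

/-- The morphism `Y* ⊗ X* ⟶ (X ⊗ Y)*`. -/
def dualTensorHom (hX : IsWeight r X) (hY : IsWeight r Y) :
    Hom (tensorR (dualR Y) (dualR X)) (dualR (tensorR X Y)) where
  map := dualTensorMap X Y
  comm_E := dual_tensor_ext fun f g v w => by
    rw [LinearMap.comp_apply, LinearMap.comp_apply, dual_E_apply, tensor_E_tmul, map_add,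
      LinearMap.add_apply, tensor_Kinv_tmul, tensor_E_tmul, map_add, dualTensorMap_tmul,
      dualTensorMap_tmul, dualTensorMap_tmul, dualTensorMap_tmul, dual_E_apply, dual_E_apply,
      dual_K_apply, hY.K_Kinv_apply]
    ring
  comm_F := dual_tensor_ext fun f g v w => by
    rw [LinearMap.comp_apply, LinearMap.comp_apply, dual_F_apply, tensor_F_tmul, map_add,
      LinearMap.add_apply, tensor_F_tmul, map_add, tensor_K_tmul, tensor_K_tmul, map_add,
      dualTensorMap_tmul,
      dualTensorMap_tmul, dualTensorMap_tmul, dualTensorMap_tmul, dual_F_apply, dual_F_apply,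
      dual_Kinv_apply, hX.K_Kinv_apply]
    ring
  comm_K := dual_tensor_ext fun f g v w => by
    rw [LinearMap.comp_apply, LinearMap.comp_apply, dual_K_apply, tensor_K_tmul,
      tensor_Kinv_tmul, dualTensorMap_tmul, dualTensorMap_tmul, dual_K_apply, dual_K_apply]
  comm_Kinv := dual_tensor_ext fun f g v w => by
    rw [LinearMap.comp_apply, LinearMap.comp_apply, dual_Kinv_apply, tensor_K_tmul,
      tensor_Kinv_tmul, dualTensorMap_tmul, dualTensorMap_tmul, dual_Kinv_apply, dual_Kinv_apply]
  comm_H := dual_tensor_ext fun f g v w => by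
    rw [LinearMap.comp_apply, LinearMap.comp_apply, dual_H_apply, tensor_H_tmul, map_add,
      LinearMap.add_apply, tensor_H_tmul, map_add, dualTensorMap_tmul,
      dualTensorMap_tmul, dualTensorMap_tmul, dualTensorMap_tmul, dual_H_apply, dual_H_apply]
    ring

/-- In finite dimension products of functionals span the dual of a tensor product. -/
theorem dualTensorMap_separates {x y : X ⊗[ℂ] Y}
    (h : ∀ f g, dualTensorMap X Y (g ⊗ₜ f) x = dualTensorMap X Y (g ⊗ₜ f) y) : x = y := by
  refine dual_ext fun φ => ?_
  obtain ⟨z, rfl⟩ := (dualTensorEquiv X Y).surjective φ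
  rw [dualTensorEquiv_apply]
  induction z with
  | zero => simp
  | add a b ha hb => rw [map_add, LinearMap.add_apply, LinearMap.add_apply, ha, hb]
  | tmul g f => exact h f g

theorem ev_tensorR_tmul (f : Module.Dual ℂ X) (g : Module.Dual ℂ Y) (v : X) (w : Y) :
    ev (tensorR X Y) (dualTensorMap X Y (g ⊗ₜ f) ⊗ₜ (v ⊗ₜ w)) =
      ev Y (g ⊗ₜ (ev X (f ⊗ₜ v) • w)) := by
  rw [tmul_smul, map_smul, ev_comp, ev_comp, ev_comp, dualTensorMap_tmul, smul_eq_mul]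

/-- Both sides are tested on `f ⊗ g`. Through `ev_braid` and naturality along `Y* ⊗ X* ⟶ (X ⊗ Y)*`
the claim becomes `double_braiding_comp_pairing` for the two evaluations, so the coproduct of the
Drinfeld element is never expanded. -/
theorem drinfeld_tensor (hr : 2 ≤ r) (hX : IsWeight r X) (hY : IsWeight r Y) (v : X) (w : Y) :
    drinfeld r (tensorR X Y) (braid r Y X (braid r X Y (v ⊗ₜ w))) =
      drinfeld r X v ⊗ₜ drinfeld r Y w := by
  have : Fact (2 ≤ r) := ⟨hr⟩
  refine dualTensorMap_separates fun f g => ?_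
  rw [dualTensorMap_tmul]
  have hXY := hX.tensor hr hY
  rw [← ev_braid hXY, ← ev_braid hX, ← ev_braid hY]
  have nat := LinearMap.congr_fun (braid_naturality hXY (hY.dual.tensor hr hX.dual) hXY hXY.dual
    (𝟙 (tensorR X Y) : tensorR X Y ⟶ tensorR X Y) (dualTensorHom hX hY))
    (braid r Y X (braid r X Y (v ⊗ₜ w)) ⊗ₜ (g ⊗ₜ f))
  have nat' : braid r (tensorR X Y) (dualR (tensorR X Y))
      (braid r Y X (braid r X Y (v ⊗ₜ w)) ⊗ₜ dualTensorMap X Y (g ⊗ₜ f)) =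
      TensorProduct.map (dualTensorMap X Y) LinearMap.id (braid r (tensorR X Y)
        (tensorR (dualR Y) (dualR X)) (braid r Y X (braid r X Y (v ⊗ₜ w)) ⊗ₜ (g ⊗ₜ f))) := nat
  rw [nat']
  let V : WMod r := ⟨X, hX⟩
  let W : WMod r := ⟨Y, hY⟩
  let V' : WMod r := ⟨X.dual, hX.dual⟩
  let W' : WMod r := ⟨Y.dual, hY.dual⟩
  let p : V' ⊗ V ⟶ 𝟙_ (WMod r) := evHom hX
  let q : W' ⊗ W ⟶ 𝟙_ (WMod r) := evHom hY
  have main := congrArg Hom.map (double_braiding_comp_pairing p q)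
  have main2 := LinearMap.congr_fun main ((v ⊗ₜ[ℂ] w) ⊗ₜ[ℂ] (g ⊗ₜ[ℂ] f))
  have rhs : Hom.map ((α_ V W (W' ⊗ V')).hom ≫
        V ◁ ((α_ W W' V').inv ≫ ((β_ W W').hom ≫ q) ▷ V' ≫ (λ_ V').hom) ≫ (β_ V V').hom ≫ p)
        ((v ⊗ₜ[ℂ] w) ⊗ₜ[ℂ] (g ⊗ₜ[ℂ] f)) =
      ev X (braid r X (dualR X) (v ⊗ₜ (ev Y (braid r Y (dualR Y) (w ⊗ₜ g)) • f))) := rfl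
  rw [rhs] at main2
  rw [tmul_smul, map_smul, map_smul, smul_eq_mul] at main2
  rw [mul_comm, ← main2]
  have lhs : ∀ x : (Module.Dual ℂ Y ⊗[ℂ] Module.Dual ℂ X) ⊗[ℂ] (X ⊗[ℂ] Y),
      Hom.map ((α_ W' V' (V ⊗ W)).hom ≫ W' ◁ ((α_ V' V W).inv ≫ p ▷ W ≫ (λ_ W).hom) ≫ q) x =
      ev (tensorR X Y) (TensorProduct.map (dualTensorMap X Y) LinearMap.id x) := by
    refine LinearMap.congr_fun (?_ : Hom.map ((α_ W' V' (V ⊗ W)).hom ≫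
      W' ◁ ((α_ V' V W).inv ≫ p ▷ W ≫ (λ_ W).hom) ≫ q) =
      ev (tensorR X Y) ∘ₗ (TensorProduct.map (dualTensorMap X Y) LinearMap.id))
    refine TensorProduct.ext_fourfold' fun g f v w => ?_
    exact (ev_tensorR_tmul f g v w).symm
  rw [← lhs]
  rfl

theorem K_pow_tensor (n : ℕ) : (tensorR X Y).K ^ n = TensorProduct.map (X.K ^ n) (Y.K ^ n) :=
  TensorProduct.map_pow _ _ _

/-- The factor `K^(r-1)` is group-like, so it turns the identity for the Drinfeld element into one
for the inverse twist. -/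
theorem theta_tensor (hr : 2 ≤ r) (hX : IsWeight r X) (hY : IsWeight r Y) :
    theta r (tensorR X Y) ∘ₗ braid r Y X ∘ₗ braid r X Y =
      TensorProduct.map (theta r X) (theta r Y) := by
  refine TensorProduct.ext' fun v w => ?_
  rw [LinearMap.comp_apply, LinearMap.comp_apply, theta_eq, Module.End.mul_apply,
    drinfeld_tensor hr hX hY, K_pow_tensor, TensorProduct.map_tmul]
  rfl

end UMod

/-! ## Eigenvalues of the Casimir operator -/

/-- The eigenvalue of the Casimir operator on a highest weight vector of weight `x`. -/
def cas (r : ℕ) (x : ℂ) : ℂ := qpow r (x + 1) + qpow r (-(x + 1))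

/-- The factorisation shows when two Casimir eigenvalues coincide: for `x - y` or `x + y + 2` in
`2rℤ`, when `r ≠ 0`. -/
theorem cas_sub_cas (r : ℕ) (x y : ℂ) :
    cas r x - cas r y = qbr r ((x - y) / 2) * qbr r ((x + y + 2) / 2) := by
  simp only [cas, qbr, mul_sub, sub_mul, ← qpow_add]; ring_nf

theorem continuous_cas (r : ℕ) : Continuous (cas r) := by
  unfold cas
  exact ((continuous_qpow r).comp (by fun_prop)).add ((continuous_qpow r).comp (by fun_prop))

theorem conj_cas (r : ℕ) (x : ℂ) : starRingEnd ℂ (cas r x) = cas r (starRingEnd ℂ x) := by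
  simp only [cas, map_add, conj_qpow, map_neg, map_one, neg_neg]; ring

theorem cas_eq_of_add {r : ℕ} (hr : r ≠ 0) {x y : ℂ} (m : ℤ) (h : x + y + 2 = 2 * r * m) :
    cas r x = cas r y := by
  rw [← sub_eq_zero, cas_sub_cas]
  exact mul_eq_zero_of_right _ ((qbr_eq_zero_iff hr _).mpr ⟨m, by rw [h]; ring⟩)

/-! ### The q-binomial identity behind the eigenvalues of the twist. -/

theorem gaussBinom_comm {r k l : ℕ} (h : k + l < r) : gaussBinom r k l = gaussBinom r l k := by
  have h1 := gaussBinom_mul_qfact r k l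
  have h2 := gaussBinom_mul_qfact r l k
  have hk := qfact_ne_zero (r := r) (n := k) (by omega)
  have hl := qfact_ne_zero (r := r) (n := l) (by omega)
  refine mul_right_cancel₀ (mul_ne_zero hk hl) ?_
  rw [h1, mul_comm (qfact r k), h2, mul_comm (l : ℂ), add_comm]

/-- A `q`-analogue of `(1 - (1 - b)) ^ j = b ^ j`. -/
theorem sum_antidiagonal_gaussBinom_mul_prod {r j : ℕ} (hj : j < r) (b : ℂ) :
    ∑ p ∈ Finset.HasAntidiagonal.antidiagonal j,
      (-1) ^ p.1 * qpow r (p.1 * (p.1 - 1)) * gaussBinom r p.2 p.1 *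
        ∏ k ∈ Finset.range p.1, (1 - b * qpow r (-(2 * (k + 1)))) = b ^ j * qpow r (-(2 * j)) := by
  induction j generalizing b with
  | zero => simp [gaussBinom, qpow_zero]
  | succ j ih =>
    set t : ℂ → ℕ × ℕ → ℂ := fun b p => (-1) ^ p.1 * qpow r (p.1 * (p.1 - 1)) *
      gaussBinom r p.2 p.1 * ∏ k ∈ Finset.range p.1, (1 - b * qpow r (-(2 * (k + 1)))) with ht
    have hprod : ∀ l : ℕ, ∏ k ∈ Finset.range (l + 1), (1 - b * qpow r (-(2 * (k + 1)))) =
        (1 - b * qpow r (-2)) *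
          ∏ k ∈ Finset.range l, (1 - b * qpow r (-2) * qpow r (-(2 * (k + 1)))) := by
      intro l
      rw [Finset.prod_range_succ', mul_comm]
      congr 1
      · norm_num
      · refine Finset.prod_congr rfl fun k _ => ?_
        rw [mul_assoc, ← qpow_add]; congr 3; push_cast; ring
    -- Pascal's rule in its reflected form: the first part is the sum for `j` at the same `b`, the
    -- second the sum for `j` at `b q⁻²`, with the first factor of the product taken out.
    have e : ∀ p ∈ Finset.HasAntidiagonal.antidiagonal (j + 1), t b p =
        (match p.2 with
          | 0 => 0
          | k + 1 => t b (p.1, k)) +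
        (match p.1 with
          | 0 => 0
          | l + 1 => -(1 - b * qpow r (-2)) * qpow r (2 * j) * t (b * qpow r (-2)) (l, p.2)) := by
      rintro ⟨l, k⟩ hp
      rw [Finset.HasAntidiagonal.mem_antidiagonal] at hp
      simp only at hp
      rcases k with _ | k <;> rcases l with _ | l
      · omega
      · obtain rfl : l = j := by omega
        have hq : qpow r ((l + 1 : ℕ) * ((l + 1 : ℕ) - 1)) = qpow r (2 * l) * qpow r (l * (l - 1)) := by
          rw [← qpow_add]; congr 1; push_cast; ring
        simp only [ht, hprod, hq, gaussBinom]; ring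
      · simp [ht, gaussBinom_zero_right, qpow_zero]
      · have hjl : (j : ℂ) = l + k + 1 := by rw [show j = l + k + 1 by omega]; push_cast; ring
        have hp1 : gaussBinom r (k + 1) (l + 1) = gaussBinom r k (l + 1) +
            qpow r (2 * (k + 1)) * gaussBinom r (k + 1) l := by
          rw [gaussBinom_comm (by omega), gaussBinom, gaussBinom_comm (k := l + 1) (by omega),
            gaussBinom_comm (k := l) (by omega)]
        have hq : qpow r ((l + 1 : ℕ) * ((l + 1 : ℕ) - 1)) * qpow r (2 * (k + 1)) =
            qpow r (2 * j) * qpow r (l * (l - 1)) := by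
          rw [← qpow_add, ← qpow_add]; congr 1; push_cast; rw [hjl]; ring
        simp only [ht, hprod, hp1]
        linear_combination (-1) ^ (l + 1) * gaussBinom r (k + 1) l * ((1 - b * qpow r (-2)) *
          ∏ k ∈ Finset.range l, (1 - b * qpow r (-2) * qpow r (-(2 * (k + 1))))) * hq
    have key : ∑ p ∈ Finset.HasAntidiagonal.antidiagonal (j + 1), t b p =
        b ^ (j + 1) * qpow r (-(2 * (j + 1))) := by
      rw [Finset.sum_congr rfl e, Finset.sum_add_distrib, Finset.Nat.sum_antidiagonal_succ',
        Finset.Nat.sum_antidiagonal_succ (f := fun p : ℕ × ℕ => (match p.1 with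
          | 0 => 0
          | l + 1 => -(1 - b * qpow r (-2)) * qpow r (2 * j) * t (b * qpow r (-2)) (l, p.2) : ℂ))]
      simp only [zero_add, ← Finset.mul_sum]
      have h1 : ∑ p ∈ Finset.HasAntidiagonal.antidiagonal j, t b (p.1, p.2) =
        b ^ j * qpow r (-(2 * j)) := ih (by omega) b
      have h2 : ∑ p ∈ Finset.HasAntidiagonal.antidiagonal j, t (b * qpow r (-2)) (p.1, p.2) =
        (b * qpow r (-2)) ^ j * qpow r (-(2 * j)) := ih (by omega) _
      rw [h1, h2, mul_pow, ← qpow_nat_mul]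
      have e1 : qpow r (2 * j) * (qpow r (j * -2)) = 1 := by
        rw [← qpow_add, ← qpow_zero r]; congr 1; ring
      have e2 : qpow r (-(2 * (j + 1))) = qpow r (-(2 * j)) * qpow r (-2) := by
        rw [← qpow_add]; congr 1; ring
      rw [e2]
      linear_combination -(1 - b * qpow r (-2)) * b ^ j * qpow r (-(2 * j)) * e1
    simpa only [ht, Nat.cast_add, Nat.cast_one] using key

theorem prod_range_qbr_add (r n : ℕ) (x : ℂ) :
    ∏ k ∈ Finset.range n, qbr r (x + k + 1) = qpow r (n * x + n * (n + 1) / 2) *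
      ∏ k ∈ Finset.range n, (1 - qpow r (-(2 * x)) * qpow r (-(2 * (k + 1)))) := by
  induction n with
  | zero => simp [qpow_zero]
  | succ n ih =>
    rw [Finset.prod_range_succ, Finset.prod_range_succ, ih]
    have h : qpow r (n * x + n * (n + 1) / 2) * qbr r (x + n + 1) =
        qpow r ((n + 1 : ℕ) * x + (n + 1 : ℕ) * ((n + 1 : ℕ) + 1) / 2) *
          (1 - qpow r (-(2 * x)) * qpow r (-(2 * (n + 1)))) := by
      simp only [qbr, mul_sub, mul_one, ← qpow_add]; push_cast; ring_nf
    linear_combination h * ∏ k ∈ Finset.range n, (1 - qpow r (-(2 * x)) * qpow r (-(2 * (k + 1))))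

theorem prod_range_qbr_sub_mul_qfact (r k n : ℕ) :
    (∏ i ∈ Finset.range n, qbr r ((k + n : ℕ) - i)) * qfact r k = qfact r (k + n) := by
  induction n with
  | zero => simp
  | succ n ih =>
    rw [Finset.prod_range_succ', ← add_assoc k n 1, qfact_succ, ← ih]
    have : ∀ i ∈ Finset.range n, qbr r ((k + n + 1 : ℕ) - (i + 1 : ℕ)) = qbr r ((k + n : ℕ) - i) :=
      fun i _ => by congr 1; push_cast; ring
    rw [Finset.prod_congr rfl this]
    push_cast
    rw [sub_zero]
    ring

/-- The exponent of the eigenvalue of the twist on a highest weight vector of weight `x`. -/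
def twistVal (r : ℕ) (x : ℂ) : ℂ := qpow r ((r - 1) * x - x ^ 2 / 2)

/-- The coefficients of the twist as a polynomial in the Casimir operator on vectors of weight
`x`. -/
def twistCoeff (r n : ℕ) (x : ℂ) : ℂ :=
  (-1) ^ n * (rcoef r n / qbr r 1 ^ (2 * n)) * qpow r ((r - 1) * x - x ^ 2 / 2 - n * x - n * (n + 1))

/-- The differences factor as `{j - k} {x + j + k + 1}`. Terms with `n > j` vanish, the first
factors build a Gaussian binomial, and the remaining sum is `sum_antidiagonal_gaussBinom_mul_prod`
at `b = q^(-2(x + j))`. -/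
theorem sum_twistCoeff_mul_prod {r : ℕ} (hr : 2 ≤ r) {j : ℕ} (hj : j < r) (x : ℂ) :
    ∑ n ∈ Finset.range r, twistCoeff r n x *
      ∏ k ∈ Finset.range n, (cas r (x + 2 * j) - cas r (x + 2 * k)) = twistVal r (x + 2 * j) := by
  have h1 := qbr_one_ne_zero hr
  have hprod : ∀ n : ℕ, ∏ k ∈ Finset.range n, (cas r (x + 2 * j) - cas r (x + 2 * k)) =
      (∏ k ∈ Finset.range n, qbr r (j - k)) * ∏ k ∈ Finset.range n, qbr r (x + j + k + 1) := by
    intro n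
    rw [← Finset.prod_mul_distrib]
    refine Finset.prod_congr rfl fun k _ => ?_
    rw [cas_sub_cas]; congr 2 <;> ring
  rw [← Finset.sum_subset (s₁ := Finset.range (j + 1))]
  rotate_left
  · intro n hn; rw [Finset.mem_range] at hn ⊢; omega
  · intro n _ hn
    rw [Finset.mem_range] at hn
    refine mul_eq_zero_of_right _ (Finset.prod_eq_zero (i := j) (by simp; omega) (sub_self _))
  have key := sum_antidiagonal_gaussBinom_mul_prod hj (qpow r (-(2 * (x + j))))
  rw [Finset.Nat.sum_antidiagonal_eq_sum_range_succ_mk] at key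
  -- The exponents on the two sides differ by `2 r j`: here `q^(2r) = 1` is used.
  have e : twistVal r (x + 2 * j) = qpow r ((r - 1) * x - x ^ 2 / 2) *
      (qpow r (-(2 * (x + j))) ^ j * qpow r (-(2 * j))) := by
    rw [twistVal, ← qpow_nat_mul, ← qpow_add, ← qpow_add]
    refine qpow_congr (by omega) j ?_
    push_cast; ring
  rw [e, ← key, Finset.mul_sum]
  refine Finset.sum_congr rfl fun n hn => ?_
  rw [Finset.mem_range] at hn
  obtain ⟨k, rfl⟩ : ∃ k, j = k + n := ⟨j - n, by omega⟩
  simp only [Nat.add_sub_cancel]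
  rw [hprod, prod_range_qbr_add]
  have hk := qfact_ne_zero (r := r) (n := k) (by omega)
  have hn0 := qfact_ne_zero (r := r) (n := n) (by omega)
  have g1 := gaussBinom_mul_qfact r k n
  rw [← prod_range_qbr_sub_mul_qfact] at g1
  have g2 : gaussBinom r k n * qfact r n = qpow r (k * n) *
      ∏ i ∈ Finset.range n, qbr r ((k + n : ℕ) - i) := by
    refine mul_right_cancel₀ hk ?_
    linear_combination g1
  have g3 : rcoef r n / qbr r 1 ^ (2 * n) * ∏ i ∈ Finset.range n, qbr r ((k + n : ℕ) - i) =
      qpow r (n * (n - 1) / 2) * qpow r (-(k * n)) * gaussBinom r k n := by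
    have : ∏ i ∈ Finset.range n, qbr r ((k + n : ℕ) - i) =
        qpow r (-(k * n)) * (gaussBinom r k n * qfact r n) := by
      rw [g2, ← mul_assoc, ← qpow_add, neg_add_cancel, qpow_zero, one_mul]
    rw [this, rcoef]
    field_simp
  have g4 : qpow r ((r - 1) * x - x ^ 2 / 2 - n * x - n * (n + 1)) * (qpow r (n * (n - 1) / 2) *
      qpow r (-(k * n))) * qpow r (n * (x + (k + n : ℕ)) + n * (n + 1) / 2) =
      qpow r ((r - 1) * x - x ^ 2 / 2) * qpow r (n * (n - 1)) := by
    simp only [← qpow_add]; congr 1; push_cast; ring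
  rw [twistCoeff]
  set Q := ∏ k_1 ∈ Finset.range n, (1 - qpow r (-(2 * (x + (k + n : ℕ)))) * qpow r (-(2 * (k_1 + 1))))
  linear_combination (-1) ^ n * qpow r ((r - 1) * x - x ^ 2 / 2 - n * x - n * (n + 1)) *
    qpow r (n * (x + (k + n : ℕ)) + n * (n + 1) / 2) * Q * g3 + (-1) ^ n * gaussBinom r k n * Q * g4

/-! ## Eigenvalues of the half twist -/

/-- `x` is congruent modulo `2 r` to `i` or `-2 - i`. -/
def IsAtypical (r i : ℕ) (x : ℂ) : Prop :=
  i + 2 ≤ r ∧ ∃ m : ℤ, x = i + 2 * r * m ∨ x = -2 - i + 2 * r * m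

variable {r : ℕ}

theorem eq_of_sub_eq_mul {j k : ℕ} (hj : j < r) (hk : k < r) (m : ℤ) (h : (j - k : ℂ) = r * m) :
    j = k := by
  have h1 : (j - k : ℤ) = r * m := by exact_mod_cast h
  by_contra hjk
  have hm0 : m ≠ 0 := by rintro rfl; simp at h1; omega
  have h2 : (1 : ℤ) ≤ |m| := Int.one_le_abs hm0
  have h3 : |(j - k : ℤ)| < r := by rw [abs_lt]; omega
  rw [h1, abs_mul, Nat.abs_cast] at h3
  nlinarith

/-- For indices between `0` and `r - 2`, the residues `i` and `-2 - i` modulo `2r` are pairwise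
distinct, their differences being smaller than `2r` in absolute value. -/
theorem IsAtypical.unique {i j : ℕ} {x : ℂ} (hi : IsAtypical r i x) (hj : IsAtypical r j x) :
    i = j := by
  obtain ⟨hi, m, hm⟩ := hi
  obtain ⟨hj, n, hn⟩ := hj
  have key : ∀ d k : ℤ, d = 2 * r * k → |d| < 2 * r → d = 0 := by
    intro d k hd hlt
    by_contra h0
    have hk : 1 ≤ |k| := Int.one_le_abs (by rintro rfl; simp at hd; exact h0 hd)
    rw [hd, abs_mul, abs_of_nonneg (by positivity)] at hlt
    nlinarith
  rcases hm with h | h <;> rcases hn with h' | h' <;> rw [h] at h'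
  · have h2 : (i - j : ℤ) = 2 * r * (n - m) := by
      have : (i - j : ℂ) = 2 * r * (n - m) := by linear_combination h'
      exact_mod_cast this
    have := key _ _ h2 (by rw [abs_lt]; omega)
    omega
  · have h2 : (i + j + 2 : ℤ) = 2 * r * (n - m) := by
      have : (i + j + 2 : ℂ) = 2 * r * (n - m) := by linear_combination h'
      exact_mod_cast this
    have := key _ _ h2 (by rw [abs_lt]; omega)
    omega
  · have h2 : (-(i + j + 2) : ℤ) = 2 * r * (n - m) := by
      have : (-(i + j + 2) : ℂ) = 2 * r * (n - m) := by linear_combination h'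
      exact_mod_cast this
    have := key _ _ h2 (by rw [abs_lt]; omega)
    omega
  · have h2 : (j - i : ℤ) = 2 * r * (n - m) := by
      have : (j - i : ℂ) = 2 * r * (n - m) := by linear_combination h'
      exact_mod_cast this
    have := key _ _ h2 (by rw [abs_lt]; omega)
    omega

theorem IsAtypical.reflect {i : ℕ} {x y : ℂ} (hi : IsAtypical r i x) (m : ℤ)
    (h : x + y + 2 = 2 * r * m) : IsAtypical r i y := by
  obtain ⟨hi, n, hn⟩ := hi
  refine ⟨hi, m - n, ?_⟩
  push_cast
  rcases hn with rfl | rfl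
  · right; linear_combination h
  · left; linear_combination h

theorem IsAtypical.conj {i : ℕ} {x : ℂ} (hi : IsAtypical r i x) : starRingEnd ℂ x = x := by
  obtain ⟨-, n, rfl | rfl⟩ := hi <;> simp [map_ofNat]

open Classical in
/-- The eigenvalue of the half twist on a highest weight vector of weight `x`. -/
def halfVal (r : ℕ) (x : ℂ) : ℂ :=
  if h : ∃ i, IsAtypical r i x then qpow r ((h.choose : ℂ) * (h.choose + 2 - 2 * r) / 4)
  else qpow r (x ^ 2 / 4 - (r - 1) * x / 2)

theorem IsAtypical.halfVal {i : ℕ} {x : ℂ} (hi : IsAtypical r i x) :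
    halfVal r x = qpow r ((i : ℂ) * (i + 2 - 2 * r) / 4) := by
  have h : ∃ i, IsAtypical r i x := ⟨i, hi⟩
  rw [UnrolledSl2.halfVal, dif_pos h, h.choose_spec.unique hi]

theorem halfVal_of_not {x : ℂ} (h : ¬ ∃ i, IsAtypical r i x) :
    halfVal r x = qpow r (x ^ 2 / 4 - (r - 1) * x / 2) := dif_neg h

/-- The prescribed values square to the twist: exactly on the level of exponents outside the
atypical weights, and up to a multiple of `2r` on them. -/
theorem halfVal_sq_mul_twistVal (hr : r ≠ 0) (x : ℂ) : halfVal r x ^ 2 * twistVal r x = 1 := by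
  by_cases h : ∃ i, IsAtypical r i x
  · obtain ⟨i, hi⟩ := h
    rw [hi.halfVal, twistVal, sq, ← qpow_add, ← qpow_add]
    obtain ⟨-, m, rfl | rfl⟩ := hi
    · refine (qpow_congr hr (y := 0) (-(m * (i + r * m - r + 1))) ?_).trans (qpow_zero r)
      push_cast; ring
    · refine (qpow_congr hr (y := 0) (m * (i + 2 + r - r * m - 1) - (i + 1)) ?_).trans (qpow_zero r)
      push_cast; ring
  · rw [halfVal_of_not h, twistVal, sq, ← qpow_add, ← qpow_add]
    refine (congrArg _ ?_).trans (qpow_zero r)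
    ring

theorem halfVal_reflect (x : ℂ) : halfVal r (2 * r - 2 - x) = halfVal r x := by
  have hs : x + (2 * r - 2 - x) + 2 = 2 * r * (1 : ℤ) := by push_cast; ring
  have hs' : (2 * r - 2 - x) + x + 2 = 2 * r * (1 : ℤ) := by push_cast; ring
  by_cases h : ∃ i, IsAtypical r i x
  · obtain ⟨i, hi⟩ := h
    rw [hi.halfVal, (hi.reflect 1 hs).halfVal]
  · rw [halfVal_of_not h, halfVal_of_not fun ⟨i, hi⟩ => h ⟨i, hi.reflect 1 hs'⟩]
    congr 1; ring

/-- Conjugation sends `q^y` to `q^(-ȳ)`, and the exponents are real polynomials in the weight.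
Atypical weights are real. -/
theorem conj_halfVal_mul_halfVal (x : ℂ) :
    starRingEnd ℂ (halfVal r (starRingEnd ℂ x)) * halfVal r x = 1 := by
  by_cases h : ∃ i, IsAtypical r i x
  · obtain ⟨i, hi⟩ := h
    rw [hi.conj, hi.halfVal, conj_qpow, ← qpow_add]
    refine (congrArg _ ?_).trans (qpow_zero r)
    simp [map_ofNat]
  · have h' : ¬ ∃ i, IsAtypical r i (starRingEnd ℂ x) := fun ⟨i, hi⟩ => h ⟨i, by
      rw [← Complex.conj_conj x, hi.conj]; exact hi⟩
    rw [halfVal_of_not h, halfVal_of_not h', conj_qpow, ← qpow_add]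
    refine (congrArg _ ?_).trans (qpow_zero r)
    simp [map_ofNat]

/-- This makes interpolation at the Casimir eigenvalues consistent. Two distinct weights of the list
with the same eigenvalue are reflections of each other about `rm - 1`, so they are integral and
atypical with the same index. -/
theorem halfVal_eq_of_cas_eq {x : ℂ} {j k : ℕ} (hj : j < r) (hk : k < r)
    (h : cas r (x + 2 * j) = cas r (x + 2 * k)) :
    halfVal r (x + 2 * j) = halfVal r (x + 2 * k) := by
  have hr : r ≠ 0 := by omega
  by_cases hjk : j = k
  · rw [hjk]
  rw [← sub_eq_zero, cas_sub_cas, mul_eq_zero, qbr_eq_zero_iff hr, qbr_eq_zero_iff hr] at h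
  rcases h with ⟨m, hm⟩ | ⟨m, hm⟩
  · exact absurd (eq_of_sub_eq_mul hj hk m (by linear_combination hm)) hjk
  have hs : (x + 2 * j) + (x + 2 * k) + 2 = 2 * r * m := by linear_combination 2 * hm
  have hx : x + 2 * j = r * m - 1 + ((j : ℤ) - k : ℤ) := by push_cast; linear_combination hm
  suffices ∃ i, IsAtypical r i (x + 2 * j) by
    obtain ⟨i, hi⟩ := this
    rw [hi.halfVal, (hi.reflect m hs).halfVal]
  have hcast : ∀ (i : ℕ) (d : ℤ), (i : ℤ) = d → (i : ℂ) = d := fun i d h => by exact_mod_cast h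
  -- Since `x + 2j = rm - 1 + (j - k)`, the index is `|j - k| - 1` for even `m` and `r - 1 - |j -
  -- k|` for odd `m`; the sign of `j - k` selects the residue.
  obtain ⟨n, rfl | rfl⟩ := m.even_or_odd'
  · rcases lt_or_gt_of_ne hjk with hlt | hlt
    · refine ⟨k - j - 1, by omega, n, Or.inr ?_⟩
      rw [hx, hcast (k - j - 1) ((k : ℤ) - j - 1) (by omega)]; push_cast; ring
    · refine ⟨j - k - 1, by omega, n, Or.inl ?_⟩
      rw [hx, hcast (j - k - 1) ((j : ℤ) - k - 1) (by omega)]; push_cast; ring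
  · rcases lt_or_gt_of_ne hjk with hlt | hlt
    · refine ⟨r - 1 + j - k, by omega, n, Or.inl ?_⟩
      rw [hx, hcast (r - 1 + j - k) ((r : ℤ) - 1 + j - k) (by omega)]; push_cast; ring
    · refine ⟨r - 1 + k - j, by omega, n + 1, Or.inr ?_⟩
      rw [hx, hcast (r - 1 + k - j) ((r : ℤ) - 1 + k - j) (by omega)]; push_cast; ring

/-! ## Polynomials in the Casimir operator -/

open Polynomial

/-- Evaluation of continuous functions at `x`. -/
def evalC (x : ℂ) : C(ℂ, ℂ) →+* ℂ :=
  (Pi.evalRingHom (fun _ : ℂ => ℂ) x).comp ContinuousMap.coeFnRingHom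

theorem evalC_apply (x : ℂ) (f : C(ℂ, ℂ)) : evalC x f = f x := rfl

/-- A multiple of the minimal polynomial of the Casimir operator on vectors of weight `x`, for
`s = {0, …, r - 1}`. -/
def blockPoly (r : ℕ) (s : Finset ℕ) (x : ℂ) : ℂ[X] := ∏ j ∈ s, (X - C (cas r (x + 2 * j)))

/-- The function `x ↦ cas r (x + 2 k)`. -/
def casC (r k : ℕ) : C(ℂ, ℂ) := ⟨fun x => cas r (x + 2 * k), (continuous_cas r).comp (by fun_prop)⟩

theorem prod_dvd_of_eval {ι : Type*} {s : Finset ι} {a : ι → ℂ} (ha : Set.InjOn a s) {P : ℂ[X]}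
    (h : ∀ j ∈ s, P.eval (a j) = 0) : ∏ j ∈ s, (X - C (a j)) ∣ P := by
  refine Finset.prod_dvd_of_coprime (fun i hi j hj hij => ?_) fun i hi => dvd_iff_isRoot.mpr (h i hi)
  exact isCoprime_X_sub_C_of_isUnit_sub (sub_ne_zero.mpr fun e => hij (ha hi hj e)).isUnit

theorem isCoprime_prod_of_eval {ι : Type*} {s : Finset ι} {a : ι → ℂ} {P : ℂ[X]}
    (h : ∀ j ∈ s, P.eval (a j) ≠ 0) : IsCoprime (∏ j ∈ s, (X - C (a j))) P :=
  IsCoprime.prod_left fun j hj => (Irreducible.coprime_iff_not_dvd (irreducible_X_sub_C _)).mpr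
    fun hd => h j hj (dvd_iff_isRoot.mp hd)

theorem eval_eq_of_blockPoly_dvd {s : Finset ℕ} {x : ℂ} {P : ℂ[X]} (h : blockPoly r s x ∣ P) {j : ℕ}
    (hj : j ∈ s) : P.eval (cas r (x + 2 * j)) = 0 :=
  dvd_iff_isRoot.mp ((Finset.dvd_prod_of_mem (fun j : ℕ => X - C (cas r (x + 2 * j))) hj).trans h)

/-- A coincidence of two of these eigenvalues would force `x` to be an integer. Hence `blockPoly`
has simple roots for generic `x`. -/
theorem cas_injOn {x : ℂ} (hx : ∀ m : ℤ, x ≠ m) :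
    Set.InjOn (fun j : ℕ => cas r (x + 2 * j)) {j | j < r} := by
  intro j hj k hk h
  have hr : r ≠ 0 := by rintro rfl; simp at hj
  simp only at h
  rw [← sub_eq_zero, cas_sub_cas, mul_eq_zero, qbr_eq_zero_iff hr, qbr_eq_zero_iff hr] at h
  rcases h with ⟨m, hm⟩ | ⟨m, hm⟩
  · exact eq_of_sub_eq_mul hj hk m (by linear_combination hm)
  · exact absurd (show x = ((r * m - j - k - 1 : ℤ) : ℂ) by push_cast; linear_combination hm) (hx _)

/-- A divisibility between polynomials depending continuously on `x` can be checked for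
non-integral `x`. -/
theorem blockPoly_dvd_of_generic {s : Finset ℕ} (hs : ∀ j ∈ s, j < r) (P : C(ℂ, ℂ)[X])
    (h : ∀ x : ℂ, (∀ m : ℤ, x ≠ m) → ∀ j ∈ s, (P.map (evalC x)).eval (cas r (x + 2 * j)) = 0)
    (x : ℂ) : blockPoly r s x ∣ P.map (evalC x) := by
  set M : C(ℂ, ℂ)[X] := ∏ j ∈ s, (X - C (casC r j)) with hM
  have hmonic : M.Monic := monic_prod_of_monic _ _ fun j _ => monic_X_sub_C _
  have hmap : ∀ x, M.map (evalC x) = blockPoly r s x := by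
    intro x
    simp only [hM, Polynomial.map_prod, Polynomial.map_sub, map_X, map_C, blockPoly]; rfl
  -- Dividing by a monic polynomial keeps the coefficients of the remainder continuous in `x`. They
  -- vanish off `ℤ`, whose complement is dense, hence everywhere.
  have hrem : P %ₘ M = 0 := by
    ext k : 1
    rw [coeff_zero]
    have hdense : Dense (Set.range ((↑) : ℤ → ℂ))ᶜ :=
      (Set.countable_range _).dense_compl ℝ
    refine DFunLike.coe_injective (Continuous.ext_on hdense (ContinuousMap.continuous _)
      (ContinuousMap.continuous _) fun x hx => ?_)
    have hx' : ∀ m : ℤ, x ≠ m := fun m hm => hx ⟨m, hm.symm⟩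
    have h1 : (P %ₘ M).map (evalC x) = 0 := by
      rw [map_modByMonic _ hmonic, modByMonic_eq_zero_iff_dvd (hmonic.map _), hmap]
      exact prod_dvd_of_eval ((cas_injOn hx').mono hs) (h x hx')
    have h2 := congrArg (fun Q => Q.coeff k) h1
    simpa only [coeff_map, coeff_zero, evalC_apply, ContinuousMap.zero_apply] using h2
  rw [← hmap]
  exact Polynomial.map_dvd _ ((modByMonic_eq_zero_iff_dvd hmonic).mp hrem)

/-- The twist acts on vectors of weight `x` by this polynomial in the Casimir operator. -/
def twistPoly (r : ℕ) (x : ℂ) : ℂ[X] := ∑ n ∈ Finset.range r, C (twistCoeff r n x) *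
  ∏ k ∈ Finset.range n, (X - C (cas r (x + 2 * k)))

/-- The family of polynomials `twistPoly`. -/
def twistPolyC (r : ℕ) : C(ℂ, ℂ)[X] := ∑ n ∈ Finset.range r,
  C ⟨twistCoeff r n, continuous_const.mul ((continuous_qpow r).comp (by fun_prop))⟩ *
    ∏ k ∈ Finset.range n, (X - C (casC r k))

theorem map_twistPolyC (x : ℂ) : (twistPolyC r).map (evalC x) = twistPoly r x := by
  simp only [twistPolyC, twistPoly, Polynomial.map_sum, Polynomial.map_mul, Polynomial.map_prod,
    Polynomial.map_sub, map_X, map_C]; rfl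

theorem eval_twistPoly (hr : 2 ≤ r) (x : ℂ) {j : ℕ} (hj : j < r) :
    (twistPoly r x).eval (cas r (x + 2 * j)) = twistVal r (x + 2 * j) := by
  rw [← sum_twistCoeff_mul_prod hr hj]
  simp only [twistPoly, eval_finsetSum, eval_mul, eval_C, eval_prod, eval_sub, eval_X]

theorem twistVal_reflect (x : ℂ) : twistVal r (2 * r - 2 - x) = twistVal r x := by
  simp only [twistVal]; congr 1; ring

theorem cas_reflect (hr : r ≠ 0) (x : ℂ) : cas r (2 * r - 2 - x) = cas r x :=
  cas_eq_of_add hr 1 (by push_cast; ring)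

theorem conj_twistVal_mul_twistVal (x : ℂ) :
    starRingEnd ℂ (twistVal r (starRingEnd ℂ x)) * twistVal r x = 1 := by
  rw [twistVal, twistVal, conj_qpow, ← qpow_add]
  refine (congrArg _ ?_).trans (qpow_zero r)
  simp [map_ofNat]

/-- Substitution of a continuous function. -/
def substC (φ : C(ℂ, ℂ)) : C(ℂ, ℂ) →+* C(ℂ, ℂ) := (ContinuousMap.compRightAlgHom ℂ ℂ φ).toRingHom

theorem map_substC_twistPolyC (φ : C(ℂ, ℂ)) (x : ℂ) :
    ((twistPolyC r).map (substC φ)).map (evalC x) = twistPoly r (φ x) := by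
  rw [Polynomial.map_map, ← map_twistPolyC]; rfl

/-- The weights `y` and `2r - 2 - y` have the same Casimir eigenvalue, so the index reversal `j ↦ r
- 1 - j` matches the roots for `x` with those for `-x`. -/
theorem reflect_aux {j : ℕ} (hj : j < r) (x : ℂ) :
    2 * r - 2 - (x + 2 * j) = -x + 2 * (r - 1 - j : ℕ) := by
  rw [Nat.cast_sub (by omega), Nat.cast_sub (by omega)]; push_cast; ring

theorem blockPoly_neg (hr : r ≠ 0) (x : ℂ) :
    blockPoly r (Finset.range r) (-x) = blockPoly r (Finset.range r) x := by
  rw [blockPoly, ← Finset.prod_range_reflect]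
  refine Finset.prod_congr rfl fun j hj => ?_
  rw [← reflect_aux (Finset.mem_range.mp hj), cas_reflect hr]

theorem blockPoly_dvd_twistPoly_neg_sub (hr : 2 ≤ r) (x : ℂ) :
    blockPoly r (Finset.range r) x ∣ twistPoly r (-x) - twistPoly r x := by
  have h := blockPoly_dvd_of_generic (s := Finset.range r) (fun j hj => Finset.mem_range.mp hj)
    ((twistPolyC r).map (substC ⟨fun x => -x, by fun_prop⟩) - twistPolyC r) ?_ x
  · simpa only [Polynomial.map_sub, map_substC_twistPolyC, map_twistPolyC, ContinuousMap.coe_mk] using h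
  · intro x _ j hj
    rw [Finset.mem_range] at hj
    rw [Polynomial.map_sub, map_substC_twistPolyC, map_twistPolyC, eval_sub, eval_twistPoly hr x hj,
      ← cas_reflect (by omega), reflect_aux hj]
    refine (congrArg (· - _) (eval_twistPoly hr (-x) (by omega))).trans ?_
    rw [← reflect_aux hj, twistVal_reflect, sub_self]

/-- The root `j = 0` is left out: it is not a weight of the form `(x + 2) + 2k`, and on vectors `E
v` it is not needed either. -/
theorem blockPoly_dvd_twistPoly_add_two_sub (hr : 2 ≤ r) (x : ℂ) :
    blockPoly r (Finset.Ico 1 r) x ∣ twistPoly r (x + 2) - twistPoly r x := by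
  have h := blockPoly_dvd_of_generic (s := Finset.Ico 1 r) (fun j hj => (Finset.mem_Ico.mp hj).2)
    ((twistPolyC r).map (substC ⟨fun x => x + 2, by fun_prop⟩) - twistPolyC r) ?_ x
  · simpa only [Polynomial.map_sub, map_substC_twistPolyC, map_twistPolyC, ContinuousMap.coe_mk] using h
  · intro x _ j hj
    rw [Finset.mem_Ico] at hj
    obtain ⟨k, rfl⟩ : ∃ k, j = k + 1 := ⟨j - 1, by omega⟩
    have e : x + 2 * (k + 1 : ℕ) = x + 2 + 2 * k := by push_cast; ring
    rw [Polynomial.map_sub, map_substC_twistPolyC, map_twistPolyC, eval_sub,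
      eval_twistPoly hr x hj.2, e]
    refine (congrArg (· - _) (eval_twistPoly hr (x + 2) (by omega))).trans ?_
    exact sub_self _

theorem eval_map_conj (P : ℂ[X]) (x : ℂ) :
    (P.map (starRingEnd ℂ)).eval x = starRingEnd ℂ (P.eval (starRingEnd ℂ x)) := by
  rw [← eval_map_apply, Complex.conj_conj]

theorem conj_add_two_mul (x : ℂ) (j : ℕ) :
    starRingEnd ℂ (x + 2 * j) = starRingEnd ℂ x + 2 * j := by simp [map_ofNat]

theorem map_conj_blockPoly (s : Finset ℕ) (x : ℂ) :
    (blockPoly r s (starRingEnd ℂ x)).map (starRingEnd ℂ) = blockPoly r s x := by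
  simp only [blockPoly, Polynomial.map_prod, Polynomial.map_sub, map_X, map_C, conj_cas,
    conj_add_two_mul, Complex.conj_conj]

theorem blockPoly_dvd_conj_twistPoly_mul_sub (hr : 2 ≤ r) (x : ℂ) :
    blockPoly r (Finset.range r) x ∣
      (twistPoly r (starRingEnd ℂ x)).map (starRingEnd ℂ) * twistPoly r x - 1 := by
  have hmap : ∀ x, ((twistPolyC r).map ((starRingEnd C(ℂ, ℂ)).comp
      (substC ⟨fun x => starRingEnd ℂ x, Complex.continuous_conj⟩))).map (evalC x) =
      (twistPoly r (starRingEnd ℂ x)).map (starRingEnd ℂ) := by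
    intro x
    rw [Polynomial.map_map, ← map_twistPolyC, Polynomial.map_map]; rfl
  have h := blockPoly_dvd_of_generic (s := Finset.range r) (fun j hj => Finset.mem_range.mp hj)
    ((twistPolyC r).map ((starRingEnd C(ℂ, ℂ)).comp
      (substC ⟨fun x => starRingEnd ℂ x, Complex.continuous_conj⟩)) * twistPolyC r - 1) ?_ x
  · simpa only [Polynomial.map_sub, Polynomial.map_mul, hmap, map_twistPolyC,
      Polynomial.map_one] using h
  · intro x _ j hj
    rw [Finset.mem_range] at hj
    rw [Polynomial.map_sub, Polynomial.map_mul, hmap, map_twistPolyC, eval_sub, eval_mul,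
      eval_twistPoly hr x hj, eval_map_conj, conj_cas, conj_add_two_mul, eval_twistPoly hr _ hj,
      ← conj_add_two_mul, conj_twistVal_mul_twistVal, Polynomial.map_one, eval_one, sub_self]

/-! ## The half twist as a polynomial -/

open Classical in
/-- A polynomial which takes the values of the half twist at the eigenvalues of the Casimir
operator on vectors of weight `x`. -/
def interpPoly (r : ℕ) (x : ℂ) : ℂ[X] :=
  Lagrange.interpolate ((Finset.range r).image fun j : ℕ => cas r (x + 2 * j)) id fun c =>
    if h : ∃ j < r, c = cas r (x + 2 * j) then halfVal r (x + 2 * (h.choose : ℕ)) else 0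

theorem eval_interpPoly (x : ℂ) {j : ℕ} (hj : j < r) :
    (interpPoly r x).eval (cas r (x + 2 * j)) = halfVal r (x + 2 * j) := by
  classical
  have h : ∃ k < r, cas r (x + 2 * j) = cas r (x + 2 * k) := ⟨j, hj, rfl⟩
  rw [interpPoly]
  have hmem : cas r (x + 2 * j) ∈ (Finset.range r).image fun j : ℕ => cas r (x + 2 * j) :=
    Finset.mem_image_of_mem (fun j : ℕ => cas r (x + 2 * j)) (Finset.mem_range.mpr hj)
  refine (Lagrange.eval_interpolate_at_node (v := id) _ Function.injective_id.injOn hmem).trans ?_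
  rw [dif_pos h]
  exact (halfVal_eq_of_cas_eq hj h.choose_spec.1 h.choose_spec.2).symm

/-- The half twist acts on vectors of weight `x` by this polynomial in the Casimir operator. -/
def halfPoly (r : ℕ) (x : ℂ) : ℂ[X] :=
  -- One Newton step for the equation `p² T = 1`, with `T` equal to `twistPoly`. It leaves the
  -- values at the roots unchanged and squares the error, which suffices at double roots.
  C 2⁻¹ * interpPoly r x * (C 3 - interpPoly r x ^ 2 * twistPoly r x)

theorem eval_halfPoly (hr : 2 ≤ r) (x : ℂ) {j : ℕ} (hj : j < r) :
    (halfPoly r x).eval (cas r (x + 2 * j)) = halfVal r (x + 2 * j) := by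
  simp only [halfPoly, eval_mul, eval_C, eval_sub, eval_pow, eval_interpPoly x hj,
    eval_twistPoly hr x hj, halfVal_sq_mul_twistVal (show r ≠ 0 by omega)]
  norm_num
  ring

/-- No root of `blockPoly` has multiplicity above two. Three distinct indices `i, j, k` with one
eigenvalue would put `x + i + j + 1` and `x + i + k + 1` in `rℤ`, forcing `j = k`. -/
theorem blockPoly_dvd_sq_of_eval {x : ℂ} {P : ℂ[X]}
    (h : ∀ j < r, P.eval (cas r (x + 2 * j)) = 0) : blockPoly r (Finset.range r) x ∣ P ^ 2 := by
  classical
  -- The product is regrouped by distinct eigenvalues, each raised to the number of indices that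
  -- produce it.
  rw [blockPoly, Finset.prod_comp (s := Finset.range r) (fun c : ℂ => X - C c) (fun j : ℕ => cas r (x + 2 * j))]
  refine (Finset.prod_dvd_prod_of_dvd _ (fun c => (X - C c) ^ 2) fun c _ => pow_dvd_pow _ ?_).trans
    ((Finset.prod_pow _ 2 (fun c : ℂ => X - C c)).symm ▸ pow_dvd_pow_of_dvd (prod_dvd_of_eval
      (a := id) Function.injective_id.injOn ?_) 2)
  · by_contra! hc
    obtain ⟨i, hi, j, hj, k, hk, hij, hik, hjk⟩ := Finset.two_lt_card.mp hc
    simp only [Finset.mem_filter, Finset.mem_range] at hi hj hk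
    have hr : r ≠ 0 := by omega
    have key : ∀ j k : ℕ, j < r → k < r → j ≠ k → cas r (x + 2 * j) = cas r (x + 2 * k) →
        ∃ m : ℤ, x + j + k + 1 = r * m := by
      intro j k hj hk hjk h
      rw [← sub_eq_zero, cas_sub_cas, mul_eq_zero, qbr_eq_zero_iff hr, qbr_eq_zero_iff hr] at h
      rcases h with ⟨m, hm⟩ | ⟨m, hm⟩
      · exact absurd (eq_of_sub_eq_mul hj hk m (by linear_combination hm)) hjk
      · exact ⟨m, by linear_combination hm⟩
    obtain ⟨m, hm⟩ := key i j hi.1 hj.1 hij (hi.2.trans hj.2.symm)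
    obtain ⟨n, hn⟩ := key i k hi.1 hk.1 hik (hi.2.trans hk.2.symm)
    exact hjk (eq_of_sub_eq_mul hj.1 hk.1 (m - n) (by push_cast; linear_combination hm - hn))
  · intro c hc
    obtain ⟨j, hj, rfl⟩ := Finset.mem_image.mp hc
    exact h j (Finset.mem_range.mp hj)

theorem blockPoly_dvd_halfPoly_sq_mul_sub (hr : 2 ≤ r) (x : ℂ) :
    blockPoly r (Finset.range r) x ∣ halfPoly r x ^ 2 * twistPoly r x - 1 := by
  have h := blockPoly_dvd_sq_of_eval (r := r) (x := x)
    (P := interpPoly r x ^ 2 * twistPoly r x - 1) fun j hj => by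
      rw [eval_sub, eval_mul, eval_pow, eval_interpPoly x hj, eval_twistPoly hr x hj,
        halfVal_sq_mul_twistVal (by omega), eval_one, sub_self]
  -- With `u = p² T` the Newton step turns the error `u - 1` into `(u - 1)² (u - 4) / 4`.
  have e : halfPoly r x ^ 2 * twistPoly r x - 1 =
      (interpPoly r x ^ 2 * twistPoly r x - 1) ^ 2 *
        (C 4⁻¹ * (interpPoly r x ^ 2 * twistPoly r x - C 4)) := by
    have h1 : (C 2⁻¹ : ℂ[X]) ^ 2 = C 4⁻¹ := by rw [← C_pow]; norm_num
    have h2 : (C 4⁻¹ : ℂ[X]) * 4 = 1 := by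
      rw [show (4 : ℂ[X]) = C 4 from (map_ofNat C 4).symm, ← C_mul]; norm_num
    have h3 : (C 3 : ℂ[X]) = 3 := map_ofNat C 3
    have h4 : (C 4 : ℂ[X]) = 4 := map_ofNat C 4
    simp only [halfPoly, mul_pow, h1, h3, h4]
    linear_combination h2
  rw [e]
  exact h.mul_right _

/-- Uniqueness of square roots lifting given values. -/
theorem blockPoly_dvd_sub_of_sq {s : Finset ℕ} {x : ℂ} {A B T T' : ℂ[X]}
    (hA : blockPoly r s x ∣ A ^ 2 * T - 1) (hB : blockPoly r s x ∣ B ^ 2 * T' - 1)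
    (hT : blockPoly r s x ∣ T' - T)
    (h : ∀ j ∈ s, A.eval (cas r (x + 2 * j)) = B.eval (cas r (x + 2 * j))) :
    blockPoly r s x ∣ A - B := by
  -- Modulo `blockPoly`, both `A² T` and `B² T` are `1`. At each root `(A + B) T` takes the value `2
  -- A T`, which is nonzero because `A² T = 1` there, so this factor can be cancelled.
  have h1 : blockPoly r s x ∣ (A - B) * ((A + B) * T) := by
    have := (dvd_sub hA hB).add (hT.mul_left (B ^ 2))
    convert this using 1; ring
  refine IsCoprime.dvd_of_dvd_mul_right (isCoprime_prod_of_eval fun j hj => ?_) h1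
  have h2 := eval_eq_of_blockPoly_dvd hA hj
  rw [eval_sub, eval_mul, eval_pow, eval_one, sub_eq_zero] at h2
  rw [eval_mul, eval_add, ← h j hj, ← two_mul]
  intro h0
  rw [mul_assoc, mul_eq_zero] at h0
  rw [sq, mul_assoc, h0.resolve_left two_ne_zero, mul_zero] at h2
  exact zero_ne_one h2

/-- Weights of the dual module are negated, so this will give the compatibility of the half twist
with duals. -/
theorem blockPoly_dvd_halfPoly_neg_sub (hr : 2 ≤ r) (x : ℂ) :
    blockPoly r (Finset.range r) x ∣ halfPoly r (-x) - halfPoly r x := by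
  refine blockPoly_dvd_sub_of_sq (T := twistPoly r (-x)) (T' := twistPoly r x) ?_
    (blockPoly_dvd_halfPoly_sq_mul_sub hr x) ?_ fun j hj => ?_
  · rw [← blockPoly_neg (by omega)]; exact blockPoly_dvd_halfPoly_sq_mul_sub hr (-x)
  · rw [← neg_sub, dvd_neg]; exact blockPoly_dvd_twistPoly_neg_sub hr x
  · rw [Finset.mem_range] at hj
    rw [eval_halfPoly hr x hj, ← cas_reflect (by omega), reflect_aux hj]
    refine (eval_halfPoly hr (-x) (by omega)).trans ?_
    rw [← reflect_aux hj, halfVal_reflect]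

theorem blockPoly_Ico_dvd (x : ℂ) :
    blockPoly r (Finset.Ico 1 r) x ∣ blockPoly r (Finset.range r) x :=
  Finset.prod_dvd_prod_of_subset _ _ _ fun j hj => by
    rw [Finset.mem_Ico] at hj; exact Finset.mem_range.mpr hj.2

theorem blockPoly_Ico_eq (x : ℂ) :
    blockPoly r (Finset.Ico 1 r) x = blockPoly r (Finset.range (r - 1)) (x + 2) := by
  rw [blockPoly, Finset.prod_Ico_eq_prod_range, blockPoly]
  refine Finset.prod_congr rfl fun j _ => ?_
  congr 3; push_cast; ring

theorem blockPoly_Ico_dvd_add_two (x : ℂ) :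
    blockPoly r (Finset.Ico 1 r) x ∣ blockPoly r (Finset.range r) (x + 2) := by
  rw [blockPoly_Ico_eq]
  exact Finset.prod_dvd_prod_of_subset _ _ _ fun j hj => by
    rw [Finset.mem_range] at hj ⊢; omega

/-- The generators `E` and `F` shift weights by two, so this will make the half twist a module map.
-/
theorem blockPoly_dvd_halfPoly_add_two_sub (hr : 2 ≤ r) (x : ℂ) :
    blockPoly r (Finset.Ico 1 r) x ∣ halfPoly r (x + 2) - halfPoly r x := by
  refine blockPoly_dvd_sub_of_sq (T := twistPoly r (x + 2)) (T' := twistPoly r x)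
    ((blockPoly_Ico_dvd_add_two x).trans (blockPoly_dvd_halfPoly_sq_mul_sub hr (x + 2)))
    ((blockPoly_Ico_dvd x).trans (blockPoly_dvd_halfPoly_sq_mul_sub hr x)) ?_ fun j hj => ?_
  · rw [← neg_sub, dvd_neg]; exact blockPoly_dvd_twistPoly_add_two_sub hr x
  · rw [Finset.mem_Ico] at hj
    rw [eval_halfPoly hr x hj.2]
    obtain ⟨k, rfl⟩ : ∃ k, j = k + 1 := ⟨j - 1, by omega⟩
    have e : x + 2 * (k + 1 : ℕ) = x + 2 + 2 * k := by push_cast; ring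
    rw [e]
    exact eval_halfPoly hr (x + 2) (by omega)

/-- Taking adjoints conjugates the coefficients of a polynomial in the Casimir operator, so this
will make the half twist unitary. -/
theorem blockPoly_dvd_conj_halfPoly_mul_sub (hr : 2 ≤ r) (x : ℂ) :
    blockPoly r (Finset.range r) x ∣
      (halfPoly r (starRingEnd ℂ x)).map (starRingEnd ℂ) * halfPoly r x - 1 := by
  have h1 : blockPoly r (Finset.range r) x ∣
      (halfPoly r (starRingEnd ℂ x)).map (starRingEnd ℂ) ^ 2 *
        (twistPoly r (starRingEnd ℂ x)).map (starRingEnd ℂ) - 1 := by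
    have := Polynomial.map_dvd (starRingEnd ℂ)
      (blockPoly_dvd_halfPoly_sq_mul_sub hr (starRingEnd ℂ x))
    rw [map_conj_blockPoly] at this
    simpa only [Polynomial.map_sub, Polynomial.map_mul, Polynomial.map_pow,
      Polynomial.map_one] using this
  refine blockPoly_dvd_sub_of_sq
    (T := (twistPoly r (starRingEnd ℂ x)).map (starRingEnd ℂ) * twistPoly r x) (T' := 1) ?_ ?_ ?_
    fun j hj => ?_
  · have := (h1.mul_right (halfPoly r x ^ 2 * twistPoly r x)).add
      (blockPoly_dvd_halfPoly_sq_mul_sub hr x)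
    convert this using 1; ring
  · simp
  · rw [← neg_sub, dvd_neg]; exact blockPoly_dvd_conj_twistPoly_mul_sub hr x
  · rw [Finset.mem_range] at hj
    rw [eval_mul, eval_halfPoly hr x hj, eval_map_conj, conj_cas, conj_add_two_mul,
      eval_halfPoly hr _ hj, ← conj_add_two_mul, conj_halfVal_mul_halfVal, eval_one]

/-! ### Polynomials in an operator under linear maps, transposition and sesquilinear forms. -/

open Polynomial

theorem map_aeval_apply {M N : Type} [AddCommGroup M] [Module ℂ M] [AddCommGroup N] [Module ℂ N]
    {f : M →ₗ[ℂ] N} {a : Module.End ℂ M} {b : Module.End ℂ N} (h : ∀ v, f (a v) = b (f v))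
    (P : ℂ[X]) (v : M) : f (aeval a P v) = aeval b P (f v) := by
  induction P using Polynomial.induction_on' with
  | add p q hp hq => simp only [map_add, LinearMap.add_apply, hp, hq]
  | monomial n c =>
    simp only [aeval_monomial, Module.End.mul_apply, Module.algebraMap_end_apply, map_smul]
    congr 1
    induction n with
    | zero => rfl
    | succ n ih => rw [pow_succ', Module.End.mul_apply, h, ih, pow_succ', Module.End.mul_apply]

theorem dual_aeval_apply {M : Type} [AddCommGroup M] [Module ℂ M] {a : Module.End ℂ M}
    {b : Module.End ℂ (Module.Dual ℂ M)} (h : ∀ φ v, b φ v = φ (a v)) (P : ℂ[X])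
    (φ : Module.Dual ℂ M) (v : M) : aeval b P φ v = φ (aeval a P v) := by
  induction P using Polynomial.induction_on' with
  | add p q hp hq => simp only [map_add, LinearMap.add_apply, hp, hq]
  | monomial n c =>
    simp only [aeval_monomial, Module.End.mul_apply, Module.algebraMap_end_apply, map_smul,
      LinearMap.smul_apply]
    congr 1
    induction n generalizing v with
    | zero => rfl
    | succ n ih => rw [pow_succ', Module.End.mul_apply, h, ih, pow_succ, Module.End.mul_apply]

/-- The form is antilinear in its first variable, so a polynomial moved to the second variable has
its coefficients conjugated. -/
theorem form_aeval_apply {M N : Type} [AddCommGroup M] [Module ℂ M] [AddCommGroup N] [Module ℂ N]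
    {B : M →ₗ⋆[ℂ] N →ₗ[ℂ] ℂ} {a : Module.End ℂ M} {b : Module.End ℂ N}
    (h : ∀ v w, B (a v) w = B v (b w)) (P : ℂ[X]) (v : M) (w : N) :
    B (aeval a P v) w = B v (aeval b (P.map (starRingEnd ℂ)) w) := by
  induction P using Polynomial.induction_on' with
  | add p q hp hq => simp only [map_add, LinearMap.add_apply, hp, hq, Polynomial.map_add]
  | monomial n c =>
    simp only [aeval_monomial, Module.End.mul_apply, Module.algebraMap_end_apply, map_monomial,
      LinearMap.map_smulₛₗ, LinearMap.smul_apply, RingHom.id_apply]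
    congr 1
    induction n generalizing w with
    | zero => rfl
    | succ n ih => rw [pow_succ', Module.End.mul_apply, h, ih, pow_succ, Module.End.mul_apply]

theorem aeval_apply_of_eigen {M : Type} [AddCommGroup M] [Module ℂ M] {a : Module.End ℂ M} {c : ℂ}
    {v : M} (h : a v = c • v) (P : ℂ[X]) : aeval a P v = P.eval c • v := by
  induction P using Polynomial.induction_on' with
  | add p q hp hq => simp only [map_add, LinearMap.add_apply, hp, hq, eval_add, add_smul]
  | monomial n d =>
    simp only [aeval_monomial, Module.End.mul_apply, Module.algebraMap_end_apply, eval_monomial,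
      mul_smul]
    congr 1
    induction n with
    | zero => simp
    | succ n ih => rw [pow_succ', Module.End.mul_apply, ih, map_smul, h, smul_smul, pow_succ]

namespace UMod

variable {r : ℕ} {X Y : UMod}

/-! ## The Casimir operator -/

/-- The Casimir operator `{1}² F E + q K + q⁻¹ K⁻¹`. -/
def casimir (r : ℕ) (X : UMod) : Module.End ℂ X :=
  qbr r 1 ^ 2 • (X.F * X.E) + qpow r 1 • X.K + qpow r (-1) • X.Kinv

theorem aeval_blockPoly_range_succ (n : ℕ) (a b : ℂ) (hab : b = a + 2 * n) (v : X) :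
    aeval (casimir r X) (blockPoly r (Finset.range (n + 1)) a) v =
      aeval (casimir r X) (blockPoly r (Finset.range n) a) (casimir r X v - cas r b • v) := by
  rw [blockPoly, Finset.prod_range_succ, map_mul, Module.End.mul_apply, map_sub, aeval_X, aeval_C,
    LinearMap.sub_apply, Module.algebraMap_end_apply, hab]; rfl

section
variable (hX : IsWeight r X)
include hX

theorem casimir_apply {a : ℂ} {v : X} (hv : X.H v = a • v) :
    casimir r X v = qbr r 1 ^ 2 • X.F (X.E v) + cas r a • v := by
  simp only [casimir, LinearMap.add_apply, LinearMap.smul_apply, Module.End.mul_apply,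
    hX.K_apply hv, hX.Kinv_apply hv, cas, add_smul, smul_smul, ← qpow_add]
  rw [add_assoc]; congr 4 <;> ring

/-- The Casimir operator written through `E F` instead of `F E`. Having both expressions gives
centrality at once: one is used on `v`, the other on `E v` or `F v`. -/
theorem casimir_apply' (hr : 2 ≤ r) {a : ℂ} {v : X} (hv : X.H v = a • v) :
    casimir r X v = qbr r 1 ^ 2 • X.E (X.F v) + cas r (a - 2) • v := by
  have h1 := qbr_one_ne_zero hr
  rw [casimir_apply hX hv, hX.E_F_apply hv, smul_add, smul_smul, add_assoc, ← add_smul]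
  have h2 := cas_sub_cas r a (a - 2)
  rw [show (a - (a - 2)) / 2 = 1 by ring, show (a + (a - 2) + 2) / 2 = a by ring] at h2
  congr 2
  field_simp
  linear_combination h2

theorem casimir_E (hr : 2 ≤ r) (v : X) : casimir r X (X.E v) = X.E (casimir r X v) := by
  refine LinearMap.congr_fun (f := casimir r X ∘ₗ X.E) (g := X.E ∘ₗ casimir r X) ?_ v
  refine weight_ext hX.diag fun a v hv => ?_
  rw [LinearMap.comp_apply, LinearMap.comp_apply, casimir_apply' hX hr (hX.H_E_apply hv),
    casimir_apply hX hv, map_add, map_smul, map_smul, add_sub_cancel_right]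

theorem casimir_F (hr : 2 ≤ r) (v : X) : casimir r X (X.F v) = X.F (casimir r X v) := by
  refine LinearMap.congr_fun (f := casimir r X ∘ₗ X.F) (g := X.F ∘ₗ casimir r X) ?_ v
  refine weight_ext hX.diag fun a v hv => ?_
  rw [LinearMap.comp_apply, LinearMap.comp_apply, casimir_apply hX (hX.H_F_apply hv),
    casimir_apply' hX hr hv, map_add, map_smul, map_smul]

theorem casimir_H (v : X) : X.H (casimir r X v) = casimir r X (X.H v) := by
  refine LinearMap.congr_fun (f := X.H ∘ₗ casimir r X) (g := casimir r X ∘ₗ X.H) ?_ v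
  refine weight_ext hX.diag fun a v hv => ?_
  rw [LinearMap.comp_apply, LinearMap.comp_apply, hv, map_smul, casimir_apply hX hv, map_add,
    map_smul, map_smul, hX.H_F_apply (hX.H_E_apply hv), hv, smul_add, add_sub_cancel_right]
  rw [smul_comm a, smul_comm a]

theorem aeval_casimir_weight {a : ℂ} {v : X} (hv : X.H v = a • v) (P : ℂ[X]) :
    X.H (aeval (casimir r X) P v) = a • aeval (casimir r X) P v := by
  rw [map_aeval_apply (casimir_H hX), hv, map_smul]

theorem casimir_E_pow (hr : 2 ≤ r) (n : ℕ) (v : X) :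
    casimir r X ((X.E ^ n) v) = (X.E ^ n) (casimir r X v) := by
  induction n with
  | zero => rfl
  | succ n ih => rw [pow_succ', Module.End.mul_apply, casimir_E hX hr, ih]; rfl

theorem casimir_F_pow (hr : 2 ≤ r) (n : ℕ) (v : X) :
    casimir r X ((X.F ^ n) v) = (X.F ^ n) (casimir r X v) := by
  induction n with
  | zero => rfl
  | succ n ih => rw [pow_succ', Module.End.mul_apply, casimir_F hX hr, ih]; rfl

/-- The innermost `F E` in `F^(n+1) E^(n+1) v` acts on a vector of weight `a + 2n`, hence as `C -
cas (a + 2n)` up to `{1}²`; centrality moves this factor out. The nilpotency of `E` thus becomes a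
polynomial relation for the Casimir operator. -/
theorem F_pow_E_pow (hr : 2 ≤ r) (n : ℕ) {a : ℂ} {v : X} (hv : X.H v = a • v) :
    qbr r 1 ^ (2 * n) • (X.F ^ n) ((X.E ^ n) v) =
      aeval (casimir r X) (blockPoly r (Finset.range n) a) v := by
  induction n generalizing v with
  | zero => simp [blockPoly]
  | succ n ih =>
    have hw : X.H (casimir r X v - cas r (a + 2 * n) • v) =
        a • (casimir r X v - cas r (a + 2 * n) • v) := by
      rw [map_sub, casimir_H hX, map_smul, hv, map_smul, smul_sub, smul_comm a (cas _ _)]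
    rw [aeval_blockPoly_range_succ n a _ rfl, ← ih hw, map_sub, map_smul, ← casimir_E_pow hX hr,
      casimir_apply hX (hX.H_E_pow_apply n hv), add_sub_cancel_right, map_smul, smul_smul,
      ← pow_add, pow_succ X.F, pow_succ' X.E]
    rfl

theorem E_pow_F_pow (hr : 2 ≤ r) (n : ℕ) {a : ℂ} {v : X} (hv : X.H v = a • v) :
    qbr r 1 ^ (2 * n) • (X.E ^ n) ((X.F ^ n) v) =
      aeval (casimir r X) (blockPoly r (Finset.range n) (-a)) v := by
  induction n generalizing v with
  | zero => simp [blockPoly]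
  | succ n ih =>
    have hw : X.H (casimir r X v - cas r (-a + 2 * n) • v) =
        a • (casimir r X v - cas r (-a + 2 * n) • v) := by
      rw [map_sub, casimir_H hX, map_smul, hv, map_smul, smul_sub, smul_comm a (cas _ _)]
    -- The eigenvalue is invariant under `y ↦ -2 - y`, which rewrites the lowered weights as raised
    -- ones starting from `-a`.
    have hc : cas r (a - 2 * n - 2) = cas r (-a + 2 * n) :=
      cas_eq_of_add (by omega) 0 (by push_cast; ring)
    rw [aeval_blockPoly_range_succ n (-a) _ rfl, ← ih hw, map_sub, map_smul,
      ← casimir_F_pow hX hr, casimir_apply' hX hr (hX.H_F_pow_apply n hv), hc,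
      add_sub_cancel_right, map_smul, smul_smul, ← pow_add, pow_succ X.E, pow_succ' X.F]
    rfl

theorem aeval_blockPoly (hr : 2 ≤ r) {a : ℂ} {v : X} (hv : X.H v = a • v) :
    aeval (casimir r X) (blockPoly r (Finset.range r) a) v = 0 := by
  rw [← F_pow_E_pow hX hr r hv, hX.E_pow, LinearMap.zero_apply, map_zero, smul_zero]

/-- Since `E^(r-1)` already kills `E v`, one root fewer is needed on the image of `E`. -/
theorem aeval_blockPoly_E (hr : 2 ≤ r) {a : ℂ} {v : X} (hv : X.H v = a • v) :
    aeval (casimir r X) (blockPoly r (Finset.Ico 1 r) a) (X.E v) = 0 := by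
  rw [blockPoly_Ico_eq, ← F_pow_E_pow hX hr _ (hX.H_E_apply hv), ← Module.End.mul_apply (X.E ^ _),
    ← pow_succ, Nat.sub_add_cancel (by omega), hX.E_pow, LinearMap.zero_apply, map_zero, smul_zero]

theorem aeval_blockPoly_F (hr : 2 ≤ r) {a : ℂ} {v : X} (hv : X.H v = a • v) :
    aeval (casimir r X) (blockPoly r (Finset.Ico 1 r) (a - 2)) (X.F v) = 0 := by
  -- Reversing the order of the roots identifies the relation coming from `F^(r-1) (F v) = 0` with
  -- one indexed by raised weights.
  have h : blockPoly r (Finset.range (r - 1)) (-(a - 2)) = blockPoly r (Finset.range (r - 1)) a := by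
    rw [blockPoly, ← Finset.prod_range_reflect]
    refine Finset.prod_congr rfl fun j hj => ?_
    rw [Finset.mem_range] at hj
    congr 2
    refine cas_eq_of_add (by omega) 1 ?_
    rw [Nat.cast_sub (by omega), Nat.cast_sub (by omega), Nat.cast_sub (by omega)]
    push_cast; ring
  rw [blockPoly_Ico_eq, sub_add_cancel, ← h, ← E_pow_F_pow hX hr _ (hX.H_F_apply hv),
    ← Module.End.mul_apply (X.F ^ _), ← pow_succ, Nat.sub_add_cancel (by omega), hX.F_pow,
    LinearMap.zero_apply, map_zero, smul_zero]

end

theorem aeval_eq_of_dvd {a : Module.End ℂ X} {v : X} {M P Q : ℂ[X]} (hM : aeval a M v = 0)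
    (h : M ∣ P - Q) : aeval a P v = aeval a Q v := by
  obtain ⟨S, hS⟩ := h
  rw [← sub_eq_zero, ← LinearMap.sub_apply, ← map_sub, hS, mul_comm, map_mul, Module.End.mul_apply,
    hM, map_zero]

/-- The Casimir element is fixed by the antipode. Transposition reverses `F E` into `E F`, which is
why `casimir_apply'` appears. -/
theorem casimir_dual (hr : 2 ≤ r) (hX : IsWeight r X) (φ : Module.Dual ℂ X) (v : X) :
    (casimir r (dualR X) φ : Module.Dual ℂ X) v = φ (casimir r X v) := by
  refine LinearMap.congr_fun (f := (casimir r (dualR X) φ : Module.Dual ℂ X))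
    (g := φ ∘ₗ casimir r X) ?_ v
  refine weight_ext hX.diag fun a v hv => ?_
  have e : (casimir r (dualR X) φ : Module.Dual ℂ X) v =
      qbr r 1 ^ 2 * ((dualR X).F ((dualR X).E φ) : Module.Dual ℂ X) v +
      qpow r 1 * ((dualR X).K φ : Module.Dual ℂ X) v +
      qpow r (-1) * ((dualR X).Kinv φ : Module.Dual ℂ X) v := rfl
  rw [e, dual_F_apply, dual_E_apply, dual_K_apply, dual_Kinv_apply, hX.Kinv_K_apply, neg_neg,
    LinearMap.comp_apply, casimir_apply' hX hr hv, hX.K_apply hv, hX.Kinv_apply hv]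
  simp only [map_add, map_smul, smul_eq_mul]
  have : cas r (a - 2) = qpow r 1 * qpow r (-a) + qpow r (-1) * qpow r a := by
    simp only [cas, ← qpow_add]; ring_nf
  rw [this]; ring

theorem Hom.map_casimir (f : Hom X Y) (v : X) : f.map (casimir r X v) = casimir r Y (f.map v) := by
  have hE := LinearMap.congr_fun f.comm_E v
  have hF := LinearMap.congr_fun f.comm_F (X.E v)
  have hK := LinearMap.congr_fun f.comm_K v
  have hKi := LinearMap.congr_fun f.comm_Kinv v
  simp only [LinearMap.comp_apply] at hE hF hK hKi
  simp only [casimir, LinearMap.add_apply, LinearMap.smul_apply, Module.End.mul_apply, map_add,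
    map_smul, hE, hF, hK, hKi]

/-! ## Operators which are polynomials in the Casimir operator on each weight space -/

/-- `f` acts on vectors of weight `a` by `P a`, as a polynomial in the Casimir operator. -/
def IsCasimirPoly (r : ℕ) (X : UMod) (P : ℂ → ℂ[X]) (f : Module.End ℂ X) : Prop :=
  ∀ (a : ℂ) (v : X), X.H v = a • v → f v = aeval (casimir r X) (P a) v

theorem IsCasimirPoly.natural {P : ℂ → ℂ[X]} {f : Module.End ℂ X} {g : Module.End ℂ Y}
    (hf : IsCasimirPoly r X P f) (hg : IsCasimirPoly r Y P g) (hX : IsWeight r X) (u : Hom X Y)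
    (v : X) : u.map (f v) = g (u.map v) := by
  refine LinearMap.congr_fun (f := u.map ∘ₗ f) (g := g ∘ₗ u.map) ?_ v
  refine weight_ext hX.diag fun a v hv => ?_
  rw [LinearMap.comp_apply, LinearMap.comp_apply, hf a v hv, hg a _ (u.map_weight hv),
    map_aeval_apply u.map_casimir]

theorem IsCasimirPoly.dual {P : ℂ → ℂ[X]} {f : Module.End ℂ X} {g : Module.End ℂ (dualR X)}
    (hf : IsCasimirPoly r X P f) (hg : IsCasimirPoly r (dualR X) P g) (hr : 2 ≤ r)
    (hX : IsWeight r X) (hP : ∀ a, blockPoly r (Finset.range r) a ∣ P (-a) - P a)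
    (φ : Module.Dual ℂ X) (v : X) : (g φ : Module.Dual ℂ X) v = φ (f v) := by
  have key : g = Module.Dual.transpose (R := ℂ) f := by
    refine weight_ext (X := dualR X) hX.dual.diag fun b φ hφ => ?_
    refine weight_ext (σ := RingHom.id ℂ) hX.diag fun a v hv => ?_
    rw [hg b φ hφ]
    refine (dual_aeval_apply (casimir_dual hr hX) _ _ _).trans ?_
    change _ = φ (f v)
    rw [hf a v hv]
    -- A functional of weight `b` sees only vectors of weight `-b`; there the two polynomials agree
    -- modulo the annihilating one.
    by_cases hab : a = -b
    · rw [show b = -a by rw [hab, neg_neg], aeval_eq_of_dvd (aeval_blockPoly hX hr hv) (hP a)]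
    · rw [(dual_weight_apply hφ (aeval_casimir_weight hX hv _)).resolve_left hab,
        (dual_weight_apply hφ (aeval_casimir_weight hX hv _)).resolve_left hab]
  rw [key]; rfl

/-- A sesquilinear pairing compatible with `E ↦ F`, `F ↦ E`, `K ↦ K⁻¹`, `H ↦ H`. -/
structure IsInvariant (B : X →ₗ⋆[ℂ] Y →ₗ[ℂ] ℂ) : Prop where
  form_E : ∀ v w, B (X.F v) w = B v (Y.E w)
  form_F : ∀ v w, B (X.E v) w = B v (Y.F w)
  form_K : ∀ v w, B (X.Kinv v) w = B v (Y.K w)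
  form_Kinv : ∀ v w, B (X.K v) w = B v (Y.Kinv w)
  form_H : ∀ v w, B (X.H v) w = B v (Y.H w)

/-- The Casimir operator is self-adjoint: `F E` is its own adjoint, `q K` and `q⁻¹ K⁻¹` are
exchanged, and `{1}²` is real because conjugation changes the sign of `{1}`. -/
theorem IsInvariant.casimir {B : X →ₗ⋆[ℂ] Y →ₗ[ℂ] ℂ} (hB : IsInvariant B) (v : X) (w : Y) :
    B (casimir r X v) w = B v (casimir r Y w) := by
  simp only [UMod.casimir, LinearMap.add_apply, LinearMap.smul_apply, Module.End.mul_apply, map_add,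
    LinearMap.map_smulₛₗ, hB.form_E, hB.form_F, hB.form_K, hB.form_Kinv, map_pow, conj_qbr,
    conj_qpow, map_one, map_neg, neg_neg, RingHom.id_apply, neg_sq]
  ring

theorem IsInvariant.weight {B : X →ₗ⋆[ℂ] Y →ₗ[ℂ] ℂ} (hB : IsInvariant B) {a b : ℂ} {v : X} {w : Y}
    (hv : X.H v = a • v) (hw : Y.H w = b • w) : a = starRingEnd ℂ b ∨ B v w = 0 := by
  have h := hB.form_H v w
  rw [hv, hw, LinearMap.map_smulₛₗ, LinearMap.smul_apply, map_smul, smul_eq_mul, smul_eq_mul] at h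
  rcases mul_eq_mul_right_iff.mp h with h | h
  · left; rw [← h, Complex.conj_conj]
  · exact Or.inr h

/-- The adjoint of a polynomial in the Casimir operator is the conjugate polynomial, so the
congruence `hP` is unitarity. Two different modules are allowed because the product form pairs `X ⊗
Y` with `Y ⊗ X`. -/
theorem IsCasimirPoly.form {P : ℂ → ℂ[X]} {f : Module.End ℂ X} {g : Module.End ℂ Y}
    (hf : IsCasimirPoly r X P f) (hg : IsCasimirPoly r Y P g) (hr : 2 ≤ r) (hX : IsWeight r X)
    (hY : IsWeight r Y) (hP : ∀ a, blockPoly r (Finset.range r) a ∣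
      (P (starRingEnd ℂ a)).map (starRingEnd ℂ) * P a - 1)
    {B : X →ₗ⋆[ℂ] Y →ₗ[ℂ] ℂ} (hB : IsInvariant B) (v : X) (w : Y) : B (f v) (g w) = B v w := by
  have key : (B.comp f).compl₂ g = B := by
    refine weight_ext hX.diag fun a v hv => ?_
    refine weight_ext (σ := RingHom.id ℂ) hY.diag fun b w hw => ?_
    change B (f v) (g w) = B v w
    rw [hf a v hv, hg b w hw]
    rcases eq_or_ne a (starRingEnd ℂ b) with h | h
    · rw [form_aeval_apply hB.casimir, ← Module.End.mul_apply, ← map_mul, h,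
        aeval_eq_of_dvd (aeval_blockPoly hY hr hw) (hP b), map_one, Module.End.one_apply]
    · rw [(hB.weight hv hw).resolve_left h, (hB.weight (aeval_casimir_weight hX hv _)
        (aeval_casimir_weight hY hw _)).resolve_left h]
  exact LinearMap.congr_fun (LinearMap.congr_fun key v) w

/-- On a weight vector each summand of the Drinfeld element is a scalar times `Fⁿ Eⁿ`, which
`F_pow_E_pow` turns into a product of Casimir factors; `K^(r-1)` adds a scalar. -/
theorem isCasimirPoly_theta (hr : 2 ≤ r) (hX : IsWeight r X) :
    IsCasimirPoly r X (twistPoly r) (theta r X) := by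
  have h1 := qbr_one_ne_zero hr
  intro a v hv
  rw [theta_eq, Module.End.mul_apply, drinfeld_apply hX hv, map_sum, twistPoly, map_sum,
    LinearMap.sum_apply]
  refine Finset.sum_congr rfl fun n _ => ?_
  have h2 := F_pow_E_pow hX hr n hv
  rw [map_mul, Module.End.mul_apply, aeval_C, Module.algebraMap_end_apply]
  change _ = _ • aeval (casimir r X) (blockPoly r (Finset.range n) a) v
  have hw : X.H ((X.F ^ n) ((X.E ^ n) v)) = a • (X.F ^ n) ((X.E ^ n) v) := by
    rw [hX.H_F_pow_apply n (hX.H_E_pow_apply n hv), add_sub_cancel_right]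
  rw [← h2, hX.neg_K_F_pow_apply (hX.H_E_pow_apply n hv), map_smul, map_smul, K_pow_apply hX hw,
    smul_smul, smul_smul, smul_smul]
  congr 1
  have h3 : qpow r (-(a + 2 * n) ^ 2 / 2) * qpow r (n * (a + 2 * n) - n * (n + 1)) *
      qpow r ((r - 1 : ℕ) * a) = qpow r ((r - 1) * a - a ^ 2 / 2 - n * a - n * (n + 1)) := by
    rw [← qpow_add, ← qpow_add, Nat.cast_sub (by omega)]; congr 1; push_cast; ring
  rw [twistCoeff, ← h3]
  field_simp

/-! ## The half twist -/

open Classical in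
/-- The half twist. -/
def halfEnd (r : ℕ) (X : UMod) : Module.End ℂ X :=
  ∑ a ∈ X.weights, aeval (casimir r X) (halfPoly r a) * X.funH fun b => if b = a then 1 else 0

theorem isCasimirPoly_halfEnd (r : ℕ) (X : UMod) :
    IsCasimirPoly r X (halfPoly r) (halfEnd r X) := by
  classical
  intro a v hv
  by_cases h0 : v = 0
  · simp [h0]
  rw [halfEnd, LinearMap.sum_apply]
  simp only [Module.End.mul_apply, funH_apply X _ hv, map_smul]
  rw [Finset.sum_eq_single_of_mem a (mem_weights X hv h0) fun b _ hb => by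
    rw [if_neg (Ne.symm hb), zero_smul], if_pos rfl, one_smul]

theorem theta_halfEnd_halfEnd (hr : 2 ≤ r) (hX : IsWeight r X) :
    theta r X * halfEnd r X * halfEnd r X = 1 := by
  refine weight_ext hX.diag fun a v hv => ?_
  have h := isCasimirPoly_halfEnd r X
  have hw : X.H (halfEnd r X v) = a • halfEnd r X v := by
    rw [h a v hv, aeval_casimir_weight hX hv]
  have hw' : X.H (halfEnd r X (halfEnd r X v)) = a • halfEnd r X (halfEnd r X v) := by
    rw [h a _ hw, aeval_casimir_weight hX hw]
  rw [Module.End.mul_apply, Module.End.mul_apply, isCasimirPoly_theta hr hX a _ hw', h a _ hw,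
    h a v hv, ← Module.End.mul_apply, ← Module.End.mul_apply, ← map_mul, ← map_mul,
    aeval_eq_of_dvd (Q := 1) (aeval_blockPoly hX hr hv), map_one]
  have e : twistPoly r a * halfPoly r a * halfPoly r a = halfPoly r a ^ 2 * twistPoly r a := by
    ring
  rw [e]
  exact blockPoly_dvd_halfPoly_sq_mul_sub hr a

/-- The half twist as a morphism. -/
def halfHom (hr : 2 ≤ r) (hX : IsWeight r X) : Hom X X where
  map := halfEnd r X
  comm_E := weight_ext hX.diag fun a v hv => by
    rw [LinearMap.comp_apply, LinearMap.comp_apply, isCasimirPoly_halfEnd r X a v hv,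
      isCasimirPoly_halfEnd r X _ _ (hX.H_E_apply hv),
      aeval_eq_of_dvd (aeval_blockPoly_E hX hr hv) (blockPoly_dvd_halfPoly_add_two_sub hr a),
      map_aeval_apply fun v => (casimir_E hX hr v).symm]
  comm_F := weight_ext hX.diag fun a v hv => by
    -- The vector `F v` has weight `a - 2`, so the comparison of neighbouring weights is used one
    -- step lower.
    have h := blockPoly_dvd_halfPoly_add_two_sub hr (a - 2)
    rw [sub_add_cancel] at h
    rw [LinearMap.comp_apply, LinearMap.comp_apply, isCasimirPoly_halfEnd r X a v hv,
      isCasimirPoly_halfEnd r X _ _ (hX.H_F_apply hv),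
      ← aeval_eq_of_dvd (aeval_blockPoly_F hX hr hv) h,
      map_aeval_apply fun v => (casimir_F hX hr v).symm]
  comm_K := weight_ext hX.diag fun a v hv => by
    rw [LinearMap.comp_apply, LinearMap.comp_apply, hX.K_apply hv, map_smul,
      isCasimirPoly_halfEnd r X a v hv, hX.K_apply (aeval_casimir_weight hX hv _)]
  comm_Kinv := weight_ext hX.diag fun a v hv => by
    rw [LinearMap.comp_apply, LinearMap.comp_apply, hX.Kinv_apply hv, map_smul,
      isCasimirPoly_halfEnd r X a v hv, hX.Kinv_apply (aeval_casimir_weight hX hv _)]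
  comm_H := weight_ext hX.diag fun a v hv => by
    rw [LinearMap.comp_apply, LinearMap.comp_apply, hv, map_smul,
      isCasimirPoly_halfEnd r X a v hv, aeval_casimir_weight hX hv _]

theorem halfEnd_highest (hr : 2 ≤ r) (hX : IsWeight r X) {a : ℂ} {v : X} (hv : X.H v = a • v)
    (hE : X.E v = 0) : halfEnd r X v = halfVal r a • v := by
  have h : casimir r X v = cas r (a + 2 * (0 : ℕ)) • v := by
    rw [casimir_apply hX hv, hE, map_zero, smul_zero, zero_add]; simp
  rw [isCasimirPoly_halfEnd r X a v hv, aeval_apply_of_eigen h, eval_halfPoly hr a (by omega)]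
  simp

theorem IsLadder.induction {d : ℕ} {top : ℂ} {c : ℕ → ℂ} (hX : IsLadder d top c X) {p : X → Prop}
    (base : ∀ v, X.H v = top • v → X.E v = 0 → p v) (F : ∀ v, p v → p (X.F v))
    (add : ∀ v w, p v → p w → p (v + w)) (smul : ∀ (a : ℂ) v, p v → p (a • v)) (v : X) : p v := by
  obtain ⟨b, hH, hE, -, hF, -⟩ := hX
  have hb : ∀ i : ℕ, ∀ hi : i < d, p (b ⟨i, hi⟩) := by
    intro i
    induction i with
    | zero =>
      intro hi
      exact base _ (by rw [hH]; simp) (hE _ rfl)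
    | succ i ih =>
      intro hi
      rw [← hF ⟨i, by omega⟩ ⟨i + 1, hi⟩ rfl]
      exact F _ (ih _)
  rw [← b.sum_repr v]
  have h0 : p 0 := base 0 (by simp) (map_zero _)
  exact Finset.sum_induction _ p add h0 fun i _ => smul _ _ (hb i i.2)

open Classical in
/-- The half twist as a family of linear equivalences; it is the identity on objects that are not
weight modules. -/
def half (hr : 2 ≤ r) (X : UMod) : X ≃ₗ[ℂ] X :=
  -- As `theta` is the inverse of the twist, `theta` composed with the half twist is the inverse of
  -- the half twist.
  if hX : IsWeight r X then LinearEquiv.ofLinearMap (halfEnd r X) (theta r X * halfEnd r X)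
    (mul_eq_one_comm.mp (theta_halfEnd_halfEnd hr hX)) (theta_halfEnd_halfEnd hr hX)
  else LinearEquiv.refl ℂ X

theorem half_apply (hr : 2 ≤ r) (hX : IsWeight r X) (v : X) : half hr X v = halfEnd r X v := by
  rw [half, dif_pos hX]; rfl

theorem half_E (hr : 2 ≤ r) (hX : IsWeight r X) (v : X) : half hr X (X.E v) = X.E (half hr X v) := by
  rw [half_apply hr hX, half_apply hr hX]; exact LinearMap.congr_fun (halfHom hr hX).comm_E v

theorem half_F (hr : 2 ≤ r) (hX : IsWeight r X) (v : X) : half hr X (X.F v) = X.F (half hr X v) := by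
  rw [half_apply hr hX, half_apply hr hX]; exact LinearMap.congr_fun (halfHom hr hX).comm_F v

theorem half_highest (hr : 2 ≤ r) (hX : IsWeight r X) {a : ℂ} {v : X} (hv : X.H v = a • v)
    (hE : X.E v = 0) : half hr X v = halfVal r a • v := by
  rw [half_apply hr hX, halfEnd_highest hr hX hv hE]

theorem half_of_ladder (hr : 2 ≤ r) (hX : IsWeight r X) {d : ℕ} {top : ℂ} {c : ℕ → ℂ}
    (hL : IsLadder d top c X) (v : X) : half hr X v = halfVal r top • v :=
  hL.induction (fun v hv hE => half_highest hr hX hv hE)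
    (fun v h => by rw [half_F hr hX, h, map_smul]) (fun v w h h' => by rw [map_add, h, h', smul_add])
    (fun a v h => by rw [map_smul, h, smul_comm]) v

/-- Since `Y` has trivial `E` and `F`, tensoring with it only shifts the weights of the ladder: `F`
acts on the tensor product through the first factor. -/
theorem half_of_tensor (hr : 2 ≤ r) (hX : IsWeight r X) (hY : IsWeight r Y) {d : ℕ} {top a : ℂ}
    {c : ℕ → ℂ} (hL : IsLadder d top c X) (hE : Y.E = 0) (hF : Y.F = 0) (hH : ∀ y, Y.H y = a • y)
    (v : X ⊗[ℂ] Y) : half hr (tensorR X Y) v = halfVal r (top + a) • v := by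
  have hXY := hX.tensor hr hY
  induction v with
  | zero => rw [smul_zero]; exact map_zero _
  | add v w h h' => rw [smul_add, ← h, ← h']; exact map_add _ _ _
  | tmul x y =>
    refine hL.induction (p := fun x => half hr (tensorR X Y) (x ⊗ₜ y) =
      halfVal r (top + a) • (x ⊗ₜ[ℂ] y)) ?_ ?_ ?_ ?_ x
    · intro v hv hEv
      refine half_highest hr hXY (tensor_H_weight hv (hH y)) ?_
      rw [tensor_E_tmul, hE, hEv, LinearMap.zero_apply, tmul_zero, zero_tmul, add_zero]
    · intro v h
      have e : X.F v ⊗ₜ[ℂ] y = (tensorR X Y).F (v ⊗ₜ y) := by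
        rw [tensor_F_tmul, hF, LinearMap.zero_apply, tmul_zero, zero_add]
      rw [e]
      refine (half_F hr hXY _).trans ?_
      rw [h]; exact map_smul _ _ _
    · intro v w h h'
      rw [add_tmul, smul_add, ← h, ← h']; exact map_add _ _ _
    · intro b v h
      rw [← smul_tmul', smul_comm, ← h]; exact map_smul _ _ _

theorem half_unit (hr : 2 ≤ r) (z : unitR) : half hr unitR z = z := by
  have h : IsAtypical r 0 0 := ⟨by omega, 0, Or.inl (by simp)⟩
  rw [half_highest hr (IsWeight.unit hr) (a := 0) (show unitR.H z = (0 : ℂ) • z by rw [zero_smul]; rfl)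
    rfl, h.halfVal]
  simp [qpow_zero]

end UMod

open UMod

theorem isHalfTwist_half {r : ℕ} (hr : 2 ≤ r) : IsHalfTwist r (half hr) where
  natural X Y hX hY f v := by
    rw [half_apply hr hX, half_apply hr hY]
    exact (isCasimirPoly_halfEnd r X).natural (isCasimirPoly_halfEnd r Y) hX f v
  isHom X hX := ⟨halfHom hr hX, LinearMap.ext fun v => (half_apply hr hX v).symm⟩
  sq X hX v := by
    rw [half_apply hr hX, half_apply hr hX]
    exact LinearMap.congr_fun (theta_halfEnd_halfEnd hr hX) v
  dual X hX := LinearMap.ext fun φ => by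
    refine LinearMap.ext fun v => ?_
    have h1 : half hr X.dual φ = halfEnd r (dualR X) φ := half_apply hr hX.dual φ
    refine (congrArg (fun ψ : Module.Dual ℂ X => ψ v) h1).trans ?_
    refine ((isCasimirPoly_halfEnd r X).dual (isCasimirPoly_halfEnd r (dualR X)) hr hX
      (blockPoly_dvd_halfPoly_neg_sub hr) φ v).trans ?_
    exact congrArg (show Module.Dual ℂ X from φ) (half_apply hr hX v).symm
  unit z := half_unit hr z
  typical α hα X hX v := by
    rw [half_of_ladder hr hX.1 hX.2, halfVal_of_not, qpow]
    · rw [qpow]; congr 2; ring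
    -- The top weight `α + r - 1` is not atypical: that would make `α` an integer, and if `α = rn`
    -- it would make `r` divide `i + 1`, while `0 < i + 1 < r`.
    · rintro ⟨i, hi, m, hm⟩
      have key : α = (i + 1 - r + 2 * r * m : ℤ) ∨ α = (-1 - i - r + 2 * r * m : ℤ) := by
        push_cast
        rcases hm with hm | hm
        · left; linear_combination hm
        · right; linear_combination hm
      rcases hα with h | ⟨n, hn⟩
      · exact key.elim (h _) (h _)
      · rw [hn] at key
        have key' : (r * n : ℤ) = i + 1 - r + 2 * r * m ∨ (r * n : ℤ) = -1 - i - r + 2 * r * m := by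
          exact_mod_cast key
        rcases key' with h | h
        · have h2 : ((i + 1 : ℕ) - (0 : ℕ) : ℂ) = r * (n + 1 - 2 * m : ℤ) := by
            have : ((i + 1 : ℤ) : ℂ) = ((r * n + r - 2 * r * m : ℤ) : ℂ) := by
              congr 1; linear_combination -h
            push_cast at this ⊢; linear_combination this
          have := eq_of_sub_eq_mul (by omega) (by omega) _ h2
          omega
        · have h2 : ((0 : ℕ) - (i + 1 : ℕ) : ℂ) = r * (n + 1 - 2 * m : ℤ) := by
            have : ((i + 1 : ℤ) : ℂ) = ((-(r * n + r - 2 * r * m) : ℤ) : ℂ) := by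
              congr 1; linear_combination h
            push_cast at this ⊢; linear_combination -this
          have := eq_of_sub_eq_mul (by omega) (by omega) _ h2
          omega
  atypical_even i k hi hk X Y hX hY v := by
    obtain ⟨m, rfl⟩ := hk
    have h : IsAtypical r i (i + ((m + m : ℤ) : ℂ) * r) :=
      ⟨hi, m, Or.inl (by push_cast; ring)⟩
    rw [← h.halfVal]
    exact half_of_tensor hr hX.1 hY.1 hX.2 hY.2.2.1 hY.2.2.2.1 hY.2.2.2.2 v
  atypical_odd i j k hij hk X Y hX hY v := by
    obtain ⟨m, rfl⟩ := hk
    -- With `r = i + j + 2`, the weight `i + (2m + 1) r` equals `-2 - j + 2r(m + 1)`, so an odd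
    -- shift exchanges `i` with `j`.
    have h : IsAtypical r j (i + ((2 * m + 1 : ℤ) : ℂ) * r) :=
      ⟨by omega, m + 1, Or.inr (by rw [← hij]; push_cast; ring)⟩
    rw [← h.halfVal]
    exact half_of_tensor hr hX.1 hY.1 hX.2 hY.2.2.1 hY.2.2.2.1 hY.2.2.2.2 v

namespace UMod

variable {r : ℕ} {X Y : UMod}

/-! ## The half twist and the symmetry -/

theorem half_naturality (hr : 2 ≤ r) (hX : IsWeight r X) (hY : IsWeight r Y) (f : Hom X Y) (v : X) :
    f.map (half hr X v) = half hr Y (f.map v) := (isHalfTwist_half hr).natural X Y hX hY f v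

theorem half_symm_naturality (hr : 2 ≤ r) (hX : IsWeight r X) (hY : IsWeight r Y) (f : Hom X Y)
    (v : X) : f.map ((half hr X).symm v) = (half hr Y).symm (f.map v) := by
  rw [LinearEquiv.eq_symm_apply, ← half_naturality hr hX hY, LinearEquiv.apply_symm_apply]

theorem theta_eq_half_symm (hr : 2 ≤ r) (hX : IsWeight r X) (v : X) :
    theta r X v = (half hr X).symm ((half hr X).symm v) := by
  have h := (isHalfTwist_half hr).sq X hX ((half hr X).symm ((half hr X).symm v))
  rwa [LinearEquiv.apply_symm_apply, LinearEquiv.apply_symm_apply] at h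

theorem half_form (hr : 2 ≤ r) (hX : IsWeight r X) (hY : IsWeight r Y)
    {B : X →ₗ⋆[ℂ] Y →ₗ[ℂ] ℂ} (hB : IsInvariant B) (v : X) (w : Y) :
    B (half hr X v) (half hr Y w) = B v w := by
  rw [half_apply hr hX, half_apply hr hY]
  exact (isCasimirPoly_halfEnd r X).form (isCasimirPoly_halfEnd r Y) hr hX hY
    (blockPoly_dvd_conj_halfPoly_mul_sub hr) hB v w

/-- The half twist as an isomorphism. -/
def halfIso (hr : 2 ≤ r) (hX : IsWeight r X) : X ≅ X :=
  mkIso (half hr X)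
    (half_E hr hX) (half_F hr hX)
    (fun v => by rw [half_apply hr hX, half_apply hr hX]
                 exact LinearMap.congr_fun (halfHom hr hX).comm_K v)
    (fun v => by rw [half_apply hr hX, half_apply hr hX]
                 exact LinearMap.congr_fun (halfHom hr hX).comm_Kinv v)
    (fun v => by rw [half_apply hr hX, half_apply hr hX]
                 exact LinearMap.congr_fun (halfHom hr hX).comm_H v)

/-- The map `swapX` for the half twist. -/
def swap (hr : 2 ≤ r) (X Y : UMod) : X ⊗[ℂ] Y →ₗ[ℂ] Y ⊗[ℂ] X := swapX r (half hr) X Y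

theorem swap_apply (hr : 2 ≤ r) (v : X ⊗[ℂ] Y) : swap hr X Y v =
    (half hr (tensorR Y X)).symm (braid r X Y
      (TensorProduct.map (half hr X).toLinearMap (half hr Y).toLinearMap v)) := rfl

/-- The morphism with underlying map `c ∘ (√θ ⊗ √θ)`. -/
def braidHalfHom (hr : 2 ≤ r) (hX : IsWeight r X) (hY : IsWeight r Y) :
    Hom (tensorR X Y) (tensorR Y X) :=
  ((tensorHom (halfIso hr hX).hom (halfIso hr hY).hom : X ⊗ Y ⟶ X ⊗ Y) ≫
    (braidIso hr hX hY).hom : X ⊗ Y ⟶ Y ⊗ X)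

theorem braidHalfHom_apply (hr : 2 ≤ r) (hX : IsWeight r X) (hY : IsWeight r Y) (v : X ⊗[ℂ] Y) :
    (braidHalfHom hr hX hY).map v = braid r X Y
      (TensorProduct.map (half hr X).toLinearMap (half hr Y).toLinearMap v) := rfl

theorem braidHalf_naturality (hr : 2 ≤ r) (hX : IsWeight r X) (hY : IsWeight r Y) (v : X ⊗[ℂ] Y) :
    braid r X Y (TensorProduct.map (half hr X).toLinearMap (half hr Y).toLinearMap v) =
      TensorProduct.map (half hr Y).toLinearMap (half hr X).toLinearMap (braid r X Y v) :=
  LinearMap.congr_fun (braid_naturality hX hY hX hY (halfIso hr hX).hom (halfIso hr hY).hom) v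

/-- By naturality all half twists gather into full twists on the product and on the factors, and
`theta_tensor` cancels them against the double braiding. -/
theorem swap_swap (hr : 2 ≤ r) (hX : IsWeight r X) (hY : IsWeight r Y) (v : X ⊗[ℂ] Y) :
    swap hr Y X (swap hr X Y v) = v := by
  have hXY := hX.tensor hr hY
  have hYX := hY.tensor hr hX
  rw [swap_apply hr v, swap_apply hr]
  have h1 := half_symm_naturality hr hYX hXY (braidHalfHom hr hY hX) (braid r X Y
      (TensorProduct.map (half hr X).toLinearMap (half hr Y).toLinearMap v))
  refine (congrArg _ h1).trans ?_
  rw [← theta_eq_half_symm hr hXY, braidHalfHom_apply, ← braidHalf_naturality hr hX hY]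
  refine (LinearMap.congr_fun (theta_tensor hr hX hY) _).trans ?_
  rw [← LinearMap.comp_apply, ← TensorProduct.map_comp, ← LinearMap.comp_apply,
    ← TensorProduct.map_comp]
  have h2 : ∀ {Z : UMod}, IsWeight r Z → (theta r Z ∘ₗ (half hr Z).toLinearMap) ∘ₗ
      (half hr Z).toLinearMap = LinearMap.id := fun {Z} hZ =>
    LinearMap.ext fun v => (isHalfTwist_half hr).sq Z hZ v
  rw [h2 hX, h2 hY, TensorProduct.map_id, LinearMap.id_apply]

/-- `swap` as a morphism. -/
def swapHom (hr : 2 ≤ r) (hX : IsWeight r X) (hY : IsWeight r Y) :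
    Hom (tensorR X Y) (tensorR Y X) :=
  (show X ⊗ Y ⟶ Y ⊗ X from braidHalfHom hr hX hY) ≫ (halfIso hr (hY.tensor hr hX)).inv

theorem swap_naturality {X' Y' : UMod} (hr : 2 ≤ r) (hX : IsWeight r X) (hY : IsWeight r Y)
    (hX' : IsWeight r X') (hY' : IsWeight r Y') (f : Hom X X') (g : Hom Y Y') (v : X ⊗[ℂ] Y) :
    swap hr X' Y' (TensorProduct.map f.map g.map v) =
      TensorProduct.map g.map f.map (swap hr X Y v) := by
  rw [swap_apply, swap_apply]
  have h1 := half_symm_naturality hr (hY.tensor hr hX) (hY'.tensor hr hX') (tensorHom g f)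
    (braid r X Y (TensorProduct.map (half hr X).toLinearMap (half hr Y).toLinearMap v))
  refine Eq.trans (congrArg _ ?_) h1.symm
  refine Eq.trans ?_ (LinearMap.congr_fun (braid_naturality hX hY hX' hY' f g) _)
  rw [LinearMap.comp_apply]
  congr 1
  rw [← LinearMap.comp_apply, ← LinearMap.comp_apply, ← TensorProduct.map_comp,
    ← TensorProduct.map_comp]
  congr 2
  · exact LinearMap.ext fun v => (half_naturality hr hX hX' f v).symm
  · exact LinearMap.ext fun v => (half_naturality hr hY hY' g v).symm

/-! ## Pairings on tensor products -/

/-- The pairing `(x ⊗ y, y' ⊗ x') ↦ B(x, x') B'(y, y')`. -/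
def pairing {X X' Y Y' : UMod} (B : X →ₗ⋆[ℂ] X' →ₗ[ℂ] ℂ) (B' : Y →ₗ⋆[ℂ] Y' →ₗ[ℂ] ℂ) :
    X ⊗[ℂ] Y →ₗ⋆[ℂ] Y' ⊗[ℂ] X' →ₗ[ℂ] ℂ :=
  ((TensorProduct.map₂ B B').compr₂ₛₗ (LinearMap.mul' ℂ ℂ)).compl₂
    (TensorProduct.comm ℂ Y' X').toLinearMap

section
variable {X' Y' : UMod} {B : X →ₗ⋆[ℂ] X' →ₗ[ℂ] ℂ} {B' : Y →ₗ⋆[ℂ] Y' →ₗ[ℂ] ℂ}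

theorem pairing_tmul (x : X) (y : Y) (x' : X') (y' : Y') :
    pairing B B' (x ⊗ₜ y) (y' ⊗ₜ x') = B x x' * B' y y' := rfl

theorem pairing_ext {σ : ℂ →+* ℂ} {Z W : UMod} {P Q : X ⊗[ℂ] Y →ₛₗ[σ] Z ⊗[ℂ] W →ₗ[ℂ] ℂ}
    (h : ∀ x y z w, P (x ⊗ₜ y) (z ⊗ₜ w) = Q (x ⊗ₜ y) (z ⊗ₜ w)) (v : X ⊗[ℂ] Y) (u : Z ⊗[ℂ] W) :
    P v u = Q v u := by
  induction v with
  | zero => simp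
  | add v w hv hw => rw [map_add, map_add, LinearMap.add_apply, LinearMap.add_apply, hv, hw]
  | tmul x y =>
    induction u with
    | zero => simp
    | add v w hv hw => rw [map_add, map_add, hv, hw]
    | tmul z w => exact h x y z w

/-- The anti-automorphism takes `Δ E` to `Δ F` with its factors exchanged. So the product form is
invariant between `X ⊗ Y` and `Y ⊗ X`, not on `X ⊗ Y` itself. -/
theorem IsInvariant.pairing (hB : IsInvariant B) (hB' : IsInvariant B') :
    IsInvariant (X := tensorR X Y) (Y := tensorR Y' X') (pairing B B') where
  form_E v w := pairing_ext (P := (UMod.pairing B B').comp (tensorR X Y).F)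
    (Q := (UMod.pairing B B').compl₂ (tensorR Y' X').E) (fun x y z w => by
      change UMod.pairing B B' ((tensorR X Y).F (x ⊗ₜ y)) (z ⊗ₜ w) =
        UMod.pairing B B' (x ⊗ₜ y) ((tensorR Y' X').E (z ⊗ₜ w))
      rw [tensor_F_tmul, tensor_E_tmul, map_add, map_add, LinearMap.add_apply, pairing_tmul,
        pairing_tmul, pairing_tmul, pairing_tmul, hB'.form_E, hB.form_E, hB.form_K, add_comm]) v w
  form_F v w := pairing_ext (P := (UMod.pairing B B').comp (tensorR X Y).E)
    (Q := (UMod.pairing B B').compl₂ (tensorR Y' X').F) (fun x y z w => by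
      change UMod.pairing B B' ((tensorR X Y).E (x ⊗ₜ y)) (z ⊗ₜ w) =
        UMod.pairing B B' (x ⊗ₜ y) ((tensorR Y' X').F (z ⊗ₜ w))
      rw [tensor_F_tmul, tensor_E_tmul, map_add, map_add, LinearMap.add_apply, pairing_tmul,
        pairing_tmul, pairing_tmul, pairing_tmul, hB'.form_F, hB.form_F, hB'.form_Kinv,
        add_comm]) v w
  form_K v w := pairing_ext (P := (UMod.pairing B B').comp (tensorR X Y).Kinv)
    (Q := (UMod.pairing B B').compl₂ (tensorR Y' X').K) (fun x y z w => by
      change UMod.pairing B B' ((tensorR X Y).Kinv (x ⊗ₜ y)) (z ⊗ₜ w) =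
        UMod.pairing B B' (x ⊗ₜ y) ((tensorR Y' X').K (z ⊗ₜ w))
      rw [tensor_Kinv_tmul, tensor_K_tmul, pairing_tmul, pairing_tmul, hB'.form_K, hB.form_K]) v w
  form_Kinv v w := pairing_ext (P := (UMod.pairing B B').comp (tensorR X Y).K)
    (Q := (UMod.pairing B B').compl₂ (tensorR Y' X').Kinv) (fun x y z w => by
      change UMod.pairing B B' ((tensorR X Y).K (x ⊗ₜ y)) (z ⊗ₜ w) =
        UMod.pairing B B' (x ⊗ₜ y) ((tensorR Y' X').Kinv (z ⊗ₜ w))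
      rw [tensor_Kinv_tmul, tensor_K_tmul, pairing_tmul, pairing_tmul, hB'.form_Kinv,
        hB.form_Kinv]) v w
  form_H v w := pairing_ext (P := (UMod.pairing B B').comp (tensorR X Y).H)
    (Q := (UMod.pairing B B').compl₂ (tensorR Y' X').H) (fun x y z w => by
      change UMod.pairing B B' ((tensorR X Y).H (x ⊗ₜ y)) (z ⊗ₜ w) =
        UMod.pairing B B' (x ⊗ₜ y) ((tensorR Y' X').H (z ⊗ₜ w))
      rw [tensor_H_tmul, tensor_H_tmul, map_add, map_add, LinearMap.add_apply, pairing_tmul,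
        pairing_tmul, pairing_tmul, pairing_tmul, hB'.form_H, hB.form_H, add_comm]) v w

theorem IsInvariant.form_E_pow (hB : IsInvariant B) (n : ℕ) (v : X) (w : X') :
    B v ((X'.E ^ n) w) = B ((X.F ^ n) v) w := by
  induction n generalizing v with
  | zero => rfl
  | succ n ih =>
    rw [pow_succ', Module.End.mul_apply, ← hB.form_E, ih, pow_succ, Module.End.mul_apply]

theorem IsInvariant.form_F_pow (hB : IsInvariant B) (n : ℕ) (v : X) (w : X') :
    B v ((X'.F ^ n) w) = B ((X.E ^ n) v) w := by
  induction n generalizing v with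
  | zero => rfl
  | succ n ih =>
    rw [pow_succ', Module.End.mul_apply, ← hB.form_F, ih, pow_succ, Module.End.mul_apply]

end

theorem pairing_symm {B : X →ₗ⋆[ℂ] X →ₗ[ℂ] ℂ} {B' : Y →ₗ⋆[ℂ] Y →ₗ[ℂ] ℂ}
    (hB : ∀ v w, B v w = starRingEnd ℂ (B w v)) (hB' : ∀ v w, B' v w = starRingEnd ℂ (B' w v))
    (v : X ⊗[ℂ] Y) (u : Y ⊗[ℂ] X) :
    pairing B B' v u = starRingEnd ℂ (pairing B' B u v) := by
  induction v with
  | zero => simp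
  | add v w hv hw => rw [map_add, LinearMap.add_apply, hv, hw, map_add, map_add]
  | tmul x y =>
    induction u with
    | zero => simp
    | add v w hv hw => rw [map_add, hv, hw, map_add, LinearMap.add_apply, map_add]
    | tmul z w => rw [pairing_tmul, pairing_tmul, map_mul, ← hB, ← hB', mul_comm]

/-- The adjoint of `Eⁿ ⊗ Fⁿ` is `Fⁿ ⊗ Eⁿ`, and conjugate coefficients are those of the inverse.
Hence the adjoint of `c_{X,Y}` is the inverse of `c_{Y,X}`. -/
theorem pairing_braid (hX : IsWeight r X) (hY : IsWeight r Y)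
    {B : X →ₗ⋆[ℂ] X →ₗ[ℂ] ℂ} {B' : Y →ₗ⋆[ℂ] Y →ₗ[ℂ] ℂ} (hi : IsInvariant B) (hi' : IsInvariant B')
    (hB : ∀ v w, B v w = starRingEnd ℂ (B w v)) (hB' : ∀ v w, B' v w = starRingEnd ℂ (B' w v))
    (v u : X ⊗[ℂ] Y) :
    pairing B B' v (braid r X Y u) = starRingEnd ℂ (pairing B B' u (braidInv r Y X v)) := by
  refine tensor_weight_induction hX.diag hY.diag
    (p := fun v => pairing B B' v (braid r X Y u) =
      starRingEnd ℂ (pairing B B' u (braidInv r Y X v))) (fun a b x y hx hy => ?_)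
    (fun v w hv hw => by rw [map_add, LinearMap.add_apply, hv, hw, map_add, map_add, map_add]) v
  refine tensor_weight_induction hX.diag hY.diag
    (p := fun u => pairing B B' (x ⊗ₜ y) (braid r X Y u) =
      starRingEnd ℂ (pairing B B' u (braidInv r Y X (x ⊗ₜ y)))) (fun c d z w hz hw => ?_)
    (fun v w hv hw => by
      rw [map_add, map_add, hv, hw, map_add, LinearMap.add_apply, map_add]) u
  rw [braid_tmul hX hY hz hw, braidInv_tmul hy hx, map_sum, map_sum, map_sum]
  refine Finset.sum_congr rfl fun n _ => ?_
  rw [map_smul, map_smul, pairing_tmul, pairing_tmul, smul_eq_mul, smul_eq_mul, map_mul, map_mul,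
    map_mul, Complex.conj_conj, conj_qpow, hi.form_F_pow, hi'.form_E_pow, ← hB, ← hB']
  rw [show B x ((X.E ^ n) z) = B ((X.F ^ n) x) z from hi.form_E_pow n x z]
  -- Only vectors of conjugate weights pair nontrivially, and for these the Cartan exponents agree.
  rcases hi.weight (hX.H_F_pow_apply n hx) hz with ha | h0
  · rcases hi'.weight hy (hY.H_F_pow_apply n hw) with hb | h0
    · congr 3
      have ha' : a = starRingEnd ℂ c + 2 * n := by linear_combination ha
      rw [ha', hb]
      simp [map_ofNat, mul_comm]
    · rw [h0]; simp
  · rw [h0]; simp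

end UMod

open UMod

namespace HMod

variable {r : ℕ} {X Y : HMod}

/-! ## Hermitian modules -/

theorem IsHermitian.invariant (hX : X.IsHermitian) :
    IsInvariant (X := X.toUMod) (Y := X.toUMod) X.form where
  form_E := hX.form_E
  form_F := hX.form_F
  form_K := hX.form_K
  form_Kinv := hX.form_Kinv
  form_H := hX.form_H

/-- A kernel vector of the Gram matrix would be the coordinate vector of an element of the radical
of the form. -/
theorem IsHermitian.isUnit_det (hX : X.IsHermitian) :
    IsUnit (Matrix.of fun a b => X.form (dualBasisL X a) (dualBasisL X b)).det := by
  rw [isUnit_iff_ne_zero]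
  intro h0
  obtain ⟨c, hc, h⟩ := Matrix.exists_mulVec_eq_zero_iff.mpr h0
  refine hc ?_
  have h1 : ∀ a, X.form (dualBasisL X a) (∑ b, c b • dualBasisL X b) = 0 := by
    intro a
    have h2 := congrFun h a
    rw [map_sum]
    refine Eq.trans (Finset.sum_congr rfl fun b _ => ?_) h2
    rw [map_smul, smul_eq_mul, mul_comm]; rfl
  have h3 : ∑ b, c b • dualBasisL X b = 0 := by
    refine hX.nondeg _ fun w => ?_
    have h4 : X.form.flip (∑ b, c b • dualBasisL X b) = 0 :=
      (Module.finBasis ℂ X.carrier).ext h1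
    rw [hX.symm]
    exact (congrArg _ (LinearMap.congr_fun h4 w)).trans (map_zero _)
  have h5 := (Module.finBasis ℂ X.carrier).linearIndependent
  exact funext (Fintype.linearIndependent_iff.mp h5 c h3)

theorem IsHermitian.form_dualBasis (hX : X.IsHermitian) (i j : Fin (Module.finrank ℂ X.carrier)) :
    X.form (dualBasisR X i) (dualBasisL X j) = if i = j then 1 else 0 := by
  have h := congrFun (congrFun (Matrix.nonsing_inv_mul _ hX.isUnit_det) i) j
  rw [Matrix.mul_apply, Matrix.one_apply] at h
  rw [← h, dualBasisR, map_sum, LinearMap.sum_apply]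
  refine Finset.sum_congr rfl fun k _ => ?_
  rw [LinearMap.map_smulₛₗ, LinearMap.smul_apply, Complex.conj_conj]; rfl

theorem IsHermitian.ext_form (hX : X.IsHermitian) {v w : X.carrier}
    (h : ∀ j, X.form v (dualBasisL X j) = X.form w (dualBasisL X j)) : v = w := by
  rw [← sub_eq_zero]
  refine hX.nondeg _ fun u => ?_
  have : X.form v = X.form w := (Module.finBasis ℂ X.carrier).ext h
  rw [map_sub, this, sub_self]; rfl

theorem IsHermitian.exists_form_eq (hX : X.IsHermitian) (ψ : Module.Dual ℂ X.carrier) :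
    ∃ y, X.form y = ψ := by
  refine ⟨∑ i, starRingEnd ℂ (ψ (dualBasisL X i)) • dualBasisR X i,
    (Module.finBasis ℂ X.carrier).ext fun k => ?_⟩
  change X.form _ (dualBasisL X k) = ψ (dualBasisL X k)
  rw [map_sum, LinearMap.sum_apply]
  simp only [LinearMap.map_smulₛₗ, LinearMap.smul_apply, Complex.conj_conj, hX.form_dualBasis,
    smul_eq_mul, mul_ite, mul_one, mul_zero, Finset.sum_ite_eq', Finset.mem_univ, if_true]

theorem IsHermitian.sum_dualBasis (hX : X.IsHermitian) (x : X.carrier) :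
    ∑ i, X.form (dualBasisL X i) x • dualBasisR X i = x := by
  refine hX.ext_form fun k => ?_
  rw [map_sum, LinearMap.sum_apply]
  simp only [LinearMap.map_smulₛₗ, LinearMap.smul_apply, hX.form_dualBasis, ← hX.symm,
    smul_eq_mul, mul_ite, mul_one, mul_zero, Finset.sum_ite_eq', Finset.mem_univ, if_true]

/-- The basis-free description of the dual form: writing a functional as `(x, ·)`, the pairing with
`ψ` is `ψ x`. Together with `exists_form_eq` it replaces all computations with dual bases. -/
theorem IsHermitian.dualForm_form (hX : X.IsHermitian) (x : X.carrier)
    (ψ : Module.Dual ℂ X.carrier) : dualForm X (X.form x) ψ = ψ x := by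
  have e : dualForm X (X.form x) ψ =
      ∑ i, starRingEnd ℂ (X.form x (dualBasisL X i)) * ψ (dualBasisR X i) := rfl
  rw [e]
  conv_rhs => rw [← hX.sum_dualBasis x, map_sum]
  refine Finset.sum_congr rfl fun i _ => ?_
  rw [← hX.symm, map_smul, smul_eq_mul]

theorem IsHermitian.dual_invariant (hX : X.IsHermitian) :
    IsInvariant (X := dualR X.toUMod) (Y := dualR X.toUMod) (dualForm X) := by
  have key : ∀ {a : Module.End ℂ X.carrier} {b c : Module.End ℂ (Module.Dual ℂ X.carrier)},
      (∀ x, ∃ y, b (X.form x) = X.form y ∧ ∀ ψ : Module.Dual ℂ X.carrier, ψ y = c ψ x) →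
      ∀ v w, dualForm X (b v) w = dualForm X v (c w) := by
    intro a b c h v w
    obtain ⟨x, rfl⟩ := hX.exists_form_eq v
    obtain ⟨y, hy, hc⟩ := h x
    rw [hy, hX.dualForm_form, hX.dualForm_form, hc]
  -- The witnesses come from moving the antipode across the form: for instance `F` sends `(x, ·)` to
  -- `-(x, K F ·) = (-E K⁻¹ x, ·)`.
  refine ⟨key (a := X.E) fun x => ⟨-X.E (X.Kinv x), ?_, fun ψ => ?_⟩,
    key (a := X.E) fun x => ⟨-X.K (X.F x), ?_, fun ψ => ?_⟩,
    key (a := X.E) fun x => ⟨X.Kinv x, ?_, fun ψ => rfl⟩,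
    key (a := X.E) fun x => ⟨X.K x, ?_, fun ψ => rfl⟩,
    key (a := X.E) fun x => ⟨-X.H x, ?_, fun ψ => ?_⟩⟩
  · refine LinearMap.ext fun v => (dual_F_apply (X := X.toUMod) _ _).trans ?_
    rw [map_neg, LinearMap.neg_apply, hX.form_F, hX.form_K]
  · exact (map_neg _ _).trans (dual_E_apply (X := X.toUMod) _ _).symm
  · refine LinearMap.ext fun v => (dual_E_apply (X := X.toUMod) _ _).trans ?_
    rw [map_neg, LinearMap.neg_apply, hX.form_Kinv, hX.form_E]
  · exact (map_neg _ _).trans (dual_F_apply (X := X.toUMod) _ _).symm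
  · exact LinearMap.ext fun v => (hX.form_K x v).symm
  · exact LinearMap.ext fun v => (hX.form_Kinv x v).symm
  · refine LinearMap.ext fun v => (dual_H_apply (X := X.toUMod) _ _).trans ?_
    rw [map_neg, LinearMap.neg_apply, hX.form_H]
  · exact (map_neg _ _).trans (dual_H_apply (X := X.toUMod) _ _).symm

theorem IsHermitian.dual (hX : X.IsHermitian) : X.dual.IsHermitian where
  symm v w := by
    obtain ⟨x, rfl⟩ := hX.exists_form_eq v
    obtain ⟨y, rfl⟩ := hX.exists_form_eq w
    exact (hX.dualForm_form x (X.form y)).trans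
      ((hX.symm y x).trans (congrArg _ (hX.dualForm_form y (X.form x)).symm))
  nondeg v h := by
    obtain ⟨x, rfl⟩ := hX.exists_form_eq v
    have hx : x = 0 := dual_ext fun ψ => by
      rw [map_zero, ← hX.dualForm_form x ψ]; exact h ψ
    rw [hx]; exact map_zero _
  form_E := hX.dual_invariant.form_E
  form_F := hX.dual_invariant.form_F
  form_K := hX.dual_invariant.form_K
  form_Kinv := hX.dual_invariant.form_Kinv
  form_H := hX.dual_invariant.form_H

theorem unitForm_apply (z w : ℂ) : unitForm z w = starRingEnd ℂ z * w := rfl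

theorem unitForm_symm (z w : ℂ) : unitForm z w = starRingEnd ℂ (unitForm w z) := by
  rw [unitForm_apply, unitForm_apply, map_mul, Complex.conj_conj, mul_comm]

theorem unitForm_nondeg (z : ℂ) (h : unitForm z 1 = 0) : z = 0 := by
  rw [unitForm_apply, mul_one] at h
  exact (map_eq_zero _).mp h

theorem isHermitian_unit : HMod.unit.IsHermitian where
  symm v w := unitForm_symm v w
  nondeg v h := unitForm_nondeg v (h (1 : ℂ))
  form_E v w := show unitForm 0 w = unitForm v 0 by rw [map_zero, map_zero]; rfl
  form_F v w := show unitForm 0 w = unitForm v 0 by rw [map_zero, map_zero]; rfl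
  form_K _ _ := rfl
  form_Kinv _ _ := rfl
  form_H v w := show unitForm 0 w = unitForm v 0 by rw [map_zero, map_zero]; rfl

/-- The form on the tensor product. -/
def tensorForm (hr : 2 ≤ r) (X Y : HMod) :
    X.carrier ⊗[ℂ] Y.carrier →ₗ⋆[ℂ] X.carrier ⊗[ℂ] Y.carrier →ₗ[ℂ] ℂ :=
  (pairing (X := X.toUMod) (X' := X.toUMod) (Y := Y.toUMod) (Y' := Y.toUMod) X.form Y.form).compl₂
    (swap hr X.toUMod Y.toUMod)

theorem tensorForm_apply (hr : 2 ≤ r) (v w : X.carrier ⊗[ℂ] Y.carrier) : tensorForm hr X Y v w =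
    pairing (X := X.toUMod) (X' := X.toUMod) (Y := Y.toUMod) (Y' := Y.toUMod) X.form Y.form v
      (swap hr X.toUMod Y.toUMod w) := rfl

theorem tensor_form_eq (hr : 2 ≤ r) (X Y : HMod) :
    (HMod.tensor r (half hr) X Y).form = tensorForm hr X Y := rfl

theorem pairing_nondeg (hX : X.IsHermitian) (hY : Y.IsHermitian) {v : X.carrier ⊗[ℂ] Y.carrier}
    (h : ∀ u, pairing (X := X.toUMod) (X' := X.toUMod) (Y := Y.toUMod) (Y' := Y.toUMod)
      X.form Y.form v u = 0) : v = 0 := by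
  refine dualTensorMap_separates (X := X.toUMod) (Y := Y.toUMod) fun f g => ?_
  obtain ⟨x, rfl⟩ := hX.exists_form_eq f
  obtain ⟨y, rfl⟩ := hY.exists_form_eq g
  rw [map_zero]
  have h1 := h (y ⊗ₜ x)
  rw [← map_eq_zero (starRingEnd ℂ)] at h1
  rw [← h1]
  clear h h1
  induction v with
  | zero => simp
  | add v w hv hw => rw [map_add, hv, hw, map_add, LinearMap.add_apply, map_add]
  | tmul a b =>
    rw [pairing_tmul, map_mul, ← hX.symm, ← hY.symm]
    exact dualTensorMap_tmul (X := X.toUMod) (Y := Y.toUMod) _ _ _ _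

theorem pairing_map_half (hr : 2 ≤ r) (hwX : IsWeight r X.toUMod) (hwY : IsWeight r Y.toUMod)
    (hX : X.IsHermitian) (hY : Y.IsHermitian) (a : X.carrier ⊗[ℂ] Y.carrier)
    (b : Y.carrier ⊗[ℂ] X.carrier) :
    pairing (X := X.toUMod) (X' := X.toUMod) (Y := Y.toUMod) (Y' := Y.toUMod) X.form Y.form
      (TensorProduct.map (half hr X.toUMod).toLinearMap (half hr Y.toUMod).toLinearMap a)
      (TensorProduct.map (half hr Y.toUMod).toLinearMap (half hr X.toUMod).toLinearMap b) =
    pairing (X := X.toUMod) (X' := X.toUMod) (Y := Y.toUMod) (Y' := Y.toUMod) X.form Y.form a b := by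
  set P := pairing (X := X.toUMod) (X' := X.toUMod) (Y := Y.toUMod) (Y' := Y.toUMod) X.form Y.form
    with hP
  refine pairing_ext (X := X.toUMod) (Y := Y.toUMod) (Z := Y.toUMod) (W := X.toUMod)
    (P := (P.comp (TensorProduct.map (half hr X.toUMod).toLinearMap
    (half hr Y.toUMod).toLinearMap)).compl₂ (TensorProduct.map (half hr Y.toUMod).toLinearMap
    (half hr X.toUMod).toLinearMap)) (Q := P) (fun x y z w => ?_) a b
  change X.form (half hr X.toUMod x) (half hr X.toUMod w) *
    Y.form (half hr Y.toUMod y) (half hr Y.toUMod z) = X.form x w * Y.form y z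
  exact congrArg₂ _ (half_form hr hwX hwX hX.invariant x w) (half_form hr hwY hwY hY.invariant y z)

/-- Unitarity of the half twist moves `√θ⁻¹` to the other variable, and `pairing_braid` moves the
braiding there as an inverse braiding. By `swap_swap`, what then stands in the other variable is `√θ
⊗ √θ` applied to the swapped vector; the remaining half twists cancel in pairs. -/
theorem tensorForm_symm (hr : 2 ≤ r) (hwX : IsWeight r X.toUMod) (hwY : IsWeight r Y.toUMod)
    (hX : X.IsHermitian) (hY : Y.IsHermitian) (v w : X.carrier ⊗[ℂ] Y.carrier) :
    tensorForm hr X Y v w = starRingEnd ℂ (tensorForm hr X Y w v) := by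
  have hXY := hwX.tensor hr hwY
  have hYX := hwY.tensor hr hwX
  set P := pairing (X := X.toUMod) (X' := X.toUMod) (Y := Y.toUMod) (Y' := Y.toUMod) X.form Y.form
    with hP
  have hPi : IsInvariant (X := tensorR X.toUMod Y.toUMod) (Y := tensorR Y.toUMod X.toUMod) P :=
    hX.invariant.pairing hY.invariant
  rw [tensorForm_apply, tensorForm_apply, swap_apply, ← hP]
  have h1 := half_form hr hXY hYX hPi v ((half hr (tensorR Y.toUMod X.toUMod)).symm
    (braid r X.toUMod Y.toUMod (TensorProduct.map (half hr X.toUMod).toLinearMap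
      (half hr Y.toUMod).toLinearMap w)))
  rw [LinearEquiv.apply_symm_apply] at h1
  refine h1.symm.trans ?_
  rw [hP, pairing_braid hwX hwY hX.invariant hY.invariant hX.symm hY.symm, ← hP]
  congr 1
  have h2 : half hr (tensorR X.toUMod Y.toUMod) v = braid r Y.toUMod X.toUMod
      (TensorProduct.map (half hr Y.toUMod).toLinearMap (half hr X.toUMod).toLinearMap
        (swap hr X.toUMod Y.toUMod v)) := by
    have h3 := swap_swap hr hwX hwY v
    rw [swap_apply hr (swap hr X.toUMod Y.toUMod v), LinearEquiv.symm_apply_eq] at h3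
    exact h3.symm
  rw [h2]
  refine Eq.trans (congrArg _ (LinearMap.congr_fun (braidInv_braid hwY hwX hr) _)) ?_
  rw [LinearMap.id_apply]
  exact pairing_map_half hr hwX hwY hX hY _ _

theorem tensorForm_invariant (hr : 2 ≤ r) (hwX : IsWeight r X.toUMod) (hwY : IsWeight r Y.toUMod)
    (hX : X.IsHermitian) (hY : Y.IsHermitian) :
    IsInvariant (X := tensorR X.toUMod Y.toUMod) (Y := tensorR X.toUMod Y.toUMod)
      (tensorForm hr X Y) := by
  have hPi := hX.invariant.pairing hY.invariant
  constructor <;> intro v w <;> rw [tensorForm_apply, tensorForm_apply]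
  · exact (hPi.form_E v _).trans
      (congrArg _ (LinearMap.congr_fun (swapHom hr hwX hwY).comm_E w).symm)
  · exact (hPi.form_F v _).trans
      (congrArg _ (LinearMap.congr_fun (swapHom hr hwX hwY).comm_F w).symm)
  · exact (hPi.form_K v _).trans
      (congrArg _ (LinearMap.congr_fun (swapHom hr hwX hwY).comm_K w).symm)
  · exact (hPi.form_Kinv v _).trans
      (congrArg _ (LinearMap.congr_fun (swapHom hr hwX hwY).comm_Kinv w).symm)
  · exact (hPi.form_H v _).trans
      (congrArg _ (LinearMap.congr_fun (swapHom hr hwX hwY).comm_H w).symm)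

theorem IsHermitian.tensor (hr : 2 ≤ r) (hwX : IsWeight r X.toUMod) (hwY : IsWeight r Y.toUMod)
    (hX : X.IsHermitian) (hY : Y.IsHermitian) :
    (HMod.tensor r (half hr) X Y).IsHermitian where
  symm := tensorForm_symm hr hwX hwY hX hY
  nondeg v h := pairing_nondeg hX hY fun u => by
    -- Every `u` is the swap of a vector, so degeneracy of the new form would pass to the product
    -- pairing.
    have h1 := h (swap hr Y.toUMod X.toUMod u)
    rw [tensor_form_eq] at h1
    refine Eq.trans (congrArg _ ?_) h1
    exact (swap_swap hr hwY hwX u).symm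
  form_E := (tensorForm_invariant hr hwX hwY hX hY).form_E
  form_F := (tensorForm_invariant hr hwX hwY hX hY).form_F
  form_K := (tensorForm_invariant hr hwX hwY hX hY).form_K
  form_Kinv := (tensorForm_invariant hr hwX hwY hX hY).form_Kinv
  form_H := (tensorForm_invariant hr hwX hwY hX hY).form_H

end HMod

namespace UMod

variable {r : ℕ} {X Y Z : UMod}

/-! ## Closure properties of `𝒟` -/

theorem InA.isWeight (h : InA r X) : IsWeight r X := by
  cases h with
  | V α hα X h => exact h.1
  | S n hn X h => exact h.1
  | P i hi X h => exact h.1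
  | C a X h => exact h.1

theorem TensorWord.isWeight (hr : 2 ≤ r) (h : TensorWord r X) : IsWeight r X := by
  induction h with
  | of X h => exact h.isWeight
  | ofDual X h => exact h.isWeight.dual
  | tensor X Y _ _ hX hY => exact hX.tensor hr hY

theorem Hom.comp_map {X Y Z : UMod} (f : Hom X Y) (g : Hom Y Z) :
    ∃ u : Hom X Z, u.map = g.map ∘ₗ f.map :=
  ⟨(show X ⟶ Y from f) ≫ (show Y ⟶ Z from g), rfl⟩

theorem IsRetract.trans (h : IsRetract X Y) (h' : IsRetract Y Z) : IsRetract X Z := by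
  obtain ⟨i, p, hp⟩ := h
  obtain ⟨i', p', hp'⟩ := h'
  obtain ⟨u, hu⟩ := i.comp_map i'
  obtain ⟨v, hv⟩ := p'.comp_map p
  refine ⟨u, v, ?_⟩
  rw [hu, hv, LinearMap.comp_assoc, ← LinearMap.comp_assoc _ i'.map, hp', LinearMap.id_comp, hp]

theorem IsRetract.of_iso (e : X ≅ Y) : IsRetract X Y :=
  ⟨e.hom, e.inv, congrArg Hom.map e.hom_inv_id⟩

theorem IsRetract.refl (X : UMod) : IsRetract X X := IsRetract.of_iso (Iso.refl X)

theorem IsRetract.tensor {X' Y' : UMod} (h : IsRetract X Y) (h' : IsRetract X' Y') :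
    IsRetract (X.tensor X') (Y.tensor Y') := by
  obtain ⟨i, p, hp⟩ := h
  obtain ⟨i', p', hp'⟩ := h'
  refine ⟨tensorHom i i', tensorHom p p', ?_⟩
  refine (TensorProduct.map_comp _ _ _ _).symm.trans ?_
  rw [hp, hp', TensorProduct.map_id]; rfl

/-- The transpose of a morphism. -/
def Hom.dual (f : Hom X Y) : Hom (dualR Y) (dualR X) where
  map := Module.Dual.transpose (R := ℂ) f.map
  comm_E := LinearMap.ext fun φ => LinearMap.ext fun v => by
    have hE := LinearMap.congr_fun f.comm_E (X.Kinv v)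
    have hK := LinearMap.congr_fun f.comm_Kinv v
    simp only [LinearMap.comp_apply] at hE hK
    change ((dualR Y).E φ : Module.Dual ℂ Y) (f.map v) =
      ((dualR X).E (Module.Dual.transpose (R := ℂ) f.map φ) : Module.Dual ℂ X) v
    rw [dual_E_apply, dual_E_apply, ← hK, ← hE]; rfl
  comm_F := LinearMap.ext fun φ => LinearMap.ext fun v => by
    have hF := LinearMap.congr_fun f.comm_F v
    have hK := LinearMap.congr_fun f.comm_K (X.F v)
    simp only [LinearMap.comp_apply] at hF hK
    change ((dualR Y).F φ : Module.Dual ℂ Y) (f.map v) =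
      ((dualR X).F (Module.Dual.transpose (R := ℂ) f.map φ) : Module.Dual ℂ X) v
    rw [dual_F_apply, dual_F_apply, ← hF, ← hK]; rfl
  comm_K := LinearMap.ext fun φ => LinearMap.ext fun v =>
    congrArg (show Module.Dual ℂ Y from φ) (LinearMap.congr_fun f.comm_Kinv v).symm
  comm_Kinv := LinearMap.ext fun φ => LinearMap.ext fun v =>
    congrArg (show Module.Dual ℂ Y from φ) (LinearMap.congr_fun f.comm_K v).symm
  comm_H := LinearMap.ext fun φ => LinearMap.ext fun v => by
    have hH := LinearMap.congr_fun f.comm_H v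
    simp only [LinearMap.comp_apply] at hH
    change ((dualR Y).H φ : Module.Dual ℂ Y) (f.map v) =
      ((dualR X).H (Module.Dual.transpose (R := ℂ) f.map φ) : Module.Dual ℂ X) v
    rw [dual_H_apply, dual_H_apply, ← hH]; rfl

theorem IsRetract.dual (h : IsRetract X Y) : IsRetract X.dual Y.dual := by
  obtain ⟨i, p, hp⟩ := h
  refine ⟨p.dual, i.dual, ?_⟩
  refine LinearMap.ext fun φ => LinearMap.ext fun v => ?_
  exact congrArg (show Module.Dual ℂ X from φ) (LinearMap.congr_fun hp v)

/-- `(X ⊗ Y)* ≅ Y* ⊗ X*`. -/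
def dualTensorIso (hX : IsWeight r X) (hY : IsWeight r Y) :
    tensorR (dualR Y) (dualR X) ≅ dualR (tensorR X Y) :=
  mkIso (X := tensorR (dualR Y) (dualR X)) (Y := dualR (tensorR X Y)) (dualTensorEquiv X Y)
    (LinearMap.congr_fun (dualTensorHom hX hY).comm_E)
    (LinearMap.congr_fun (dualTensorHom hX hY).comm_F)
    (LinearMap.congr_fun (dualTensorHom hX hY).comm_K)
    (LinearMap.congr_fun (dualTensorHom hX hY).comm_Kinv)
    (LinearMap.congr_fun (dualTensorHom hX hY).comm_H)

/-- `K` as a linear equivalence. -/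
def KEquiv (hX : IsWeight r X) : X ≃ₗ[ℂ] X :=
  LinearEquiv.ofLinearMap X.K X.Kinv hX.K_Kinv hX.Kinv_K

/-- The pivotal isomorphism `X ≃ X**`. -/
def doubleDualEquiv (hX : IsWeight r X) : X ≃ₗ[ℂ] Module.Dual ℂ (Module.Dual ℂ X) :=
  (KEquiv hX).trans (Module.evalEquiv ℂ X)

theorem doubleDualEquiv_apply (hX : IsWeight r X) (v : X) (φ : Module.Dual ℂ X) :
    doubleDualEquiv hX v φ = φ (X.K v) := rfl

/-- The pivotal isomorphism `X ≅ X**`. -/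
def doubleDualIso (hX : IsWeight r X) : X ≅ dualR (dualR X) :=
  -- The square of the antipode is conjugation by `K`, so evaluation becomes a module map after
  -- applying `K`.
  mkIso (Y := dualR (dualR X)) (doubleDualEquiv hX)
    (fun v => LinearMap.ext fun φ => by
      refine Eq.trans ?_ (dual_E_apply (X := dualR X) _ _).symm
      rw [doubleDualEquiv_apply]
      refine Eq.trans ?_ (congrArg Neg.neg (doubleDualEquiv_apply hX v _)).symm
      rw [dual_E_apply, dual_Kinv_apply, hX.Kinv_K_apply, neg_neg])
    (fun v => LinearMap.ext fun φ => by
      refine Eq.trans ?_ (dual_F_apply (X := dualR X) _ _).symm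
      rw [doubleDualEquiv_apply]
      refine Eq.trans ?_ (congrArg Neg.neg (doubleDualEquiv_apply hX v _)).symm
      rw [dual_K_apply, dual_F_apply, neg_neg]
      rw [hX.Kinv_K_apply])
    (fun v => LinearMap.ext fun φ => by
      refine Eq.trans ?_ (dual_K_apply (X := dualR X) _ _).symm
      rw [doubleDualEquiv_apply]
      refine Eq.trans ?_ (doubleDualEquiv_apply hX v _).symm
      rw [dual_Kinv_apply])
    (fun v => LinearMap.ext fun φ => by
      refine Eq.trans ?_ (dual_Kinv_apply (X := dualR X) _ _).symm
      rw [doubleDualEquiv_apply]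
      refine Eq.trans ?_ (doubleDualEquiv_apply hX v _).symm
      rw [dual_K_apply, hX.Kinv_K_apply, hX.K_Kinv_apply])
    (fun v => LinearMap.ext fun φ => by
      refine Eq.trans ?_ (dual_H_apply (X := dualR X) _ _).symm
      rw [doubleDualEquiv_apply]
      refine Eq.trans ?_ (congrArg Neg.neg (doubleDualEquiv_apply hX v _)).symm
      rw [dual_H_apply, neg_neg]
      exact congrArg φ (LinearMap.congr_fun hX.H_K v).symm)

/-- The dual of a word is the word of duals in reverse order, and the pivotal isomorphism returns
double duals to the generating set. -/
theorem TensorWord.exists_dual (hr : 2 ≤ r) (h : TensorWord r X) :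
    ∃ Y, TensorWord r Y ∧ IsRetract X.dual Y := by
  induction h with
  | of X h => exact ⟨X.dual, .ofDual X h, .refl _⟩
  | ofDual X h => exact ⟨X, .of X h, .of_iso (doubleDualIso h.isWeight).symm⟩
  | tensor X Y hX hY ihX ihY =>
    obtain ⟨X', hX', hr1⟩ := ihX
    obtain ⟨Y', hY', hr2⟩ := ihY
    refine ⟨Y'.tensor X', .tensor _ _ hY' hX', IsRetract.trans ?_ (hr2.tensor hr1)⟩
    exact .of_iso (dualTensorIso (hX.isWeight hr) (hY.isWeight hr)).symm

theorem InD.of_fintype {ι : Type} [Fintype ι] (Y : ι → UMod) (i : ∀ a, Hom (Y a) X)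
    (p : ∀ a, Hom X (Y a)) (h1 : ∀ a, ∃ W, TensorWord r W ∧ IsRetract (Y a) W)
    (h2 : ∀ a, (p a).map ∘ₗ (i a).map = LinearMap.id)
    (h3 : ∀ a b, a ≠ b → (p a).map ∘ₗ (i b).map = 0)
    (h4 : ∑ a, (i a).map ∘ₗ (p a).map = LinearMap.id) : InD r X := by
  let e := (Fintype.equivFin ι).symm
  refine ⟨Fintype.card ι, fun a => Y (e a), fun a => i (e a), fun a => p (e a), fun a => h1 _,
    fun a => h2 _, fun a b hab => h3 _ _ fun h => hab (e.injective h), ?_⟩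
  rw [← h4]
  exact e.sum_comp fun a => (i a).map ∘ₗ (p a).map

theorem InD.of_tensorWord (h : TensorWord r X) : InD r X :=
  InD.of_fintype (ι := Unit) (fun _ => X) (fun _ => (𝟙 X : X ⟶ X)) (fun _ => (𝟙 X : X ⟶ X))
    (fun _ => ⟨X, h, .refl X⟩) (fun _ => rfl) (fun _ _ h => absurd rfl h) (by simp; rfl)

theorem inD_unit (hr : 2 ≤ r) : InD r unit := by
  -- The unit is the generator `ℂ^H_{ar}` with `a = 0`.
  refine InD.of_tensorWord (.of _ (.C 0 _ ⟨IsWeight.unit hr, Module.finrank_self ℂ, rfl, rfl, ?_⟩))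
  intro v
  have : ∀ z : ℂ, (0 : ℂ) = ((((0 : ℤ) : ℂ) * r) • z) := by simp
  exact this v

theorem sum_map_tensor {ι κ V W : Type} [Fintype ι] [Fintype κ] [AddCommGroup V] [Module ℂ V]
    [AddCommGroup W] [Module ℂ W] (f : ι → Module.End ℂ V) (g : κ → Module.End ℂ W) :
    ∑ a : ι × κ, TensorProduct.map (f a.1) (g a.2) = TensorProduct.map (∑ a, f a) (∑ b, g b) := by
  refine TensorProduct.ext' fun x y => ?_
  rw [LinearMap.sum_apply, Fintype.sum_prod_type]
  simp only [TensorProduct.map_tmul, LinearMap.sum_apply, sum_tmul, tmul_sum]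
  exact Finset.sum_comm

theorem InD.tensor (hX : InD r X) (hY : InD r Y) : InD r (X.tensor Y) := by
  obtain ⟨n, A, i, p, h1, h2, h3, h4⟩ := hX
  obtain ⟨m, B, j, q, k1, k2, k3, k4⟩ := hY
  refine InD.of_fintype (ι := Fin n × Fin m) (fun a => (A a.1).tensor (B a.2))
    (fun a => tensorHom (i a.1) (j a.2)) (fun a => tensorHom (p a.1) (q a.2)) ?_ ?_ ?_ ?_
  · rintro ⟨a, b⟩
    obtain ⟨W, hW, hr1⟩ := h1 a
    obtain ⟨W', hW', hr2⟩ := k1 b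
    exact ⟨W.tensor W', .tensor _ _ hW hW', hr1.tensor hr2⟩
  · rintro ⟨a, b⟩
    refine (TensorProduct.map_comp _ _ _ _).symm.trans ?_
    rw [h2, k2, TensorProduct.map_id]; rfl
  · rintro ⟨a, b⟩ ⟨a', b'⟩ hab
    refine (TensorProduct.map_comp _ _ _ _).symm.trans ?_
    by_cases h : a = a'
    · rw [k3 b b' fun h' => hab (by rw [h, h']), TensorProduct.map_zero_right]; rfl
    · rw [h3 a a' h, TensorProduct.map_zero_left]; rfl
  · have e : ∀ a : Fin n × Fin m, (tensorHom (i a.1) (j a.2)).map ∘ₗ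
        (tensorHom (p a.1) (q a.2)).map = TensorProduct.map
          ((i a.1).map ∘ₗ (p a.1).map) ((j a.2).map ∘ₗ (q a.2).map) :=
      fun a => (TensorProduct.map_comp _ _ _ _).symm
    refine (Finset.sum_congr rfl fun a _ => e a).trans
      ((sum_map_tensor (fun a => (i a).map ∘ₗ (p a).map) fun b => (j b).map ∘ₗ (q b).map).trans ?_)
    rw [h4, k4, TensorProduct.map_id]; rfl

theorem InD.dual (hr : 2 ≤ r) (hX : InD r X) : InD r X.dual := by
  obtain ⟨n, A, i, p, h1, h2, h3, h4⟩ := hX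
  refine ⟨n, fun a => (A a).dual, fun a => (p a).dual, fun a => (i a).dual, ?_, ?_, ?_, ?_⟩
  · intro a
    obtain ⟨W, hW, hr1⟩ := h1 a
    obtain ⟨W', hW', hr2⟩ := hW.exists_dual hr
    exact ⟨W', hW', hr1.dual.trans hr2⟩
  · exact fun a => LinearMap.ext fun φ => LinearMap.ext fun v =>
      congrArg (show Module.Dual ℂ (A a) from φ) (LinearMap.congr_fun (h2 a) v)
  · refine fun a b hab => LinearMap.ext fun φ => LinearMap.ext fun v => ?_
    exact (congrArg (show Module.Dual ℂ (A b) from φ)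
      (LinearMap.congr_fun (h3 b a (Ne.symm hab)) v)).trans (map_zero (show Module.Dual ℂ (A b) from φ))
  · have key : ∑ a, Module.Dual.transpose (R := ℂ) ((i a).map ∘ₗ (p a).map) = LinearMap.id := by
      rw [← map_sum, h4]; rfl
    exact key

end UMod

open UMod

theorem closedUnderTensor {r : ℕ} (hr : 2 ≤ r) : ClosedUnderTensor r (half hr) where
  unit := ⟨IsWeight.unit hr, inD_unit hr, HMod.isHermitian_unit⟩
  tensor _ _ hX hY := ⟨hX.isWeight.tensor hr hY.isWeight, hX.inD.tensor hY.inD,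
    hX.isHermitian.tensor hr hX.isWeight hY.isWeight hY.isHermitian⟩
  dual _ hX := ⟨hX.isWeight.dual, hX.inD.dual hr, hX.isHermitian.dual⟩

theorem comp_inv_of_comp_hom {C : Type*} [Category C] {t : ∀ X : C, X ≅ X}
    (ht : ∀ {X Y : C} (f : X ⟶ Y), f ≫ (t Y).hom = (t X).hom ≫ f) {X Y : C} (f : X ⟶ Y) :
    f ≫ (t Y).inv = (t X).inv ≫ f := by
  rw [Iso.comp_inv_eq, Category.assoc, ht, Iso.inv_hom_id_assoc]

/-! ### The coboundary structure given by a square root of the twist. -/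

section Coboundary

open BraidedCategory

variable {C : Type*} [Category C] [MonoidalCategory C] [BraidedCategory C] (t : ∀ X : C, X ≅ X)

/-- The map `t⁻¹ ∘ c ∘ (t ⊗ t)`, for an automorphism `t` of the identity functor. -/
def coboundary (X Y : C) : X ⊗ Y ⟶ Y ⊗ X :=
  ((t X).hom ⊗ₘ (t Y).hom) ≫ (β_ X Y).hom ≫ (t (Y ⊗ X)).inv

variable {t} (ht : ∀ {X Y : C} (f : X ⟶ Y), f ≫ (t Y).hom = (t X).hom ≫ f)
include ht

/-- By naturality the intermediate automorphisms cancel. Each side becomes `t ⊗ t ⊗ t`, a braiding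
reversing three strands, and `t⁻¹` of the triple product; the two braidings agree by the Yang–Baxter
relation. -/
theorem coboundary_hexagon (X Y Z : C) :
    coboundary t X (Y ⊗ Z) ≫ coboundary t Y Z ▷ X =
      (α_ X Y Z).inv ≫ coboundary t (X ⊗ Y) Z ≫ Z ◁ coboundary t X Y ≫ (α_ Z Y X).inv := by
  have h1 : coboundary t X (Y ⊗ Z) ≫ coboundary t Y Z ▷ X =
      ((t X).hom ⊗ₘ ((t Y).hom ⊗ₘ (t Z).hom)) ≫ X ◁ (β_ Y Z).hom ≫ (β_ X (Z ⊗ Y)).hom ≫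
        (t ((Z ⊗ Y) ⊗ X)).inv := by
    simp only [coboundary, Category.assoc]
    rw [← comp_inv_of_comp_hom ht, ← braiding_naturality_right_assoc,
      ← MonoidalCategory.id_tensorHom, MonoidalCategory.tensorHom_comp_tensorHom_assoc,
      Category.comp_id, ← Category.assoc ((t Y).hom ⊗ₘ _), comp_inv_of_comp_hom ht,
      Iso.hom_inv_id_assoc, ← MonoidalCategory.id_tensorHom,
      MonoidalCategory.tensorHom_comp_tensorHom_assoc, Category.comp_id]
  have h2 : coboundary t (X ⊗ Y) Z ≫ Z ◁ coboundary t X Y =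
      (((t X).hom ⊗ₘ (t Y).hom) ⊗ₘ (t Z).hom) ≫ (β_ X Y).hom ▷ Z ≫ (β_ (Y ⊗ X) Z).hom ≫
        (t (Z ⊗ (Y ⊗ X))).inv := by
    simp only [coboundary, Category.assoc]
    rw [← comp_inv_of_comp_hom ht, ← braiding_naturality_left_assoc,
      ← MonoidalCategory.tensorHom_id, MonoidalCategory.tensorHom_comp_tensorHom_assoc,
      Category.comp_id, ← Category.assoc ((t X).hom ⊗ₘ _), comp_inv_of_comp_hom ht,
      Iso.hom_inv_id_assoc, ← MonoidalCategory.tensorHom_id,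
      MonoidalCategory.tensorHom_comp_tensorHom_assoc, Category.comp_id]
  rw [← Category.assoc (coboundary t (X ⊗ Y) Z), h1, h2]
  simp only [Category.assoc]
  rw [← comp_inv_of_comp_hom ht (α_ Z Y X).inv, ← associator_inv_naturality_assoc,
    braiding_tensor_right_hom, braiding_tensor_left_hom]
  have h3 := yang_baxter X Y Z
  simp only [Category.assoc]
  congr 1
  rw [← reassoc_of% h3]

theorem coboundary_rightUnitor (h1 : (t (𝟙_ C)).hom = 𝟙 _) (X : C) :
    coboundary t (𝟙_ C) X ≫ (ρ_ X).hom = (λ_ X).hom := by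
  simp only [coboundary, Category.assoc]
  rw [← comp_inv_of_comp_hom ht, h1, MonoidalCategory.id_tensorHom,
    braiding_rightUnitor_assoc, leftUnitor_naturality_assoc, Iso.hom_inv_id, Category.comp_id]

theorem coboundary_leftUnitor (h1 : (t (𝟙_ C)).hom = 𝟙 _) (X : C) :
    coboundary t X (𝟙_ C) ≫ (λ_ X).hom = (ρ_ X).hom := by
  simp only [coboundary, Category.assoc]
  rw [← comp_inv_of_comp_hom ht, h1, MonoidalCategory.tensorHom_id,
    braiding_leftUnitor_assoc, rightUnitor_naturality_assoc, Iso.hom_inv_id, Category.comp_id]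

end Coboundary

namespace UMod

variable {r : ℕ} {X Y Z : UMod}

/-- The half twist on the category of weight modules. -/
def WMod.half [hr : Fact (2 ≤ r)] (V : WMod r) : V ≅ V := WMod.isoOf (halfIso hr.out V.isWeight)

theorem WMod.half_naturality [hr : Fact (2 ≤ r)] {V W : WMod r} (f : V ⟶ W) :
    f ≫ (WMod.half W).hom = (WMod.half V).hom ≫ f :=
  Hom.ext' (LinearMap.ext fun v =>
    (UMod.half_naturality hr.out V.isWeight W.isWeight f v).symm)

theorem swap_hexagon (hr : 2 ≤ r) (hX : IsWeight r X) (hY : IsWeight r Y) (hZ : IsWeight r Z)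
    (x : X ⊗[ℂ] (Y ⊗[ℂ] Z)) :
    TensorProduct.map (swap hr Y Z) LinearMap.id (swap hr X (tensorR Y Z) x) =
      (TensorProduct.assoc ℂ Z Y X).symm (TensorProduct.map LinearMap.id (swap hr X Y)
        (swap hr (tensorR X Y) Z ((TensorProduct.assoc ℂ X Y Z).symm x))) := by
  have : Fact (2 ≤ r) := ⟨hr⟩
  have h := coboundary_hexagon (C := WMod r) (t := WMod.half) WMod.half_naturality
    ⟨X, hX⟩ ⟨Y, hY⟩ ⟨Z, hZ⟩
  exact LinearMap.congr_fun (congrArg Hom.map h) x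

theorem WMod.half_unit [hr : Fact (2 ≤ r)] : (WMod.half (𝟙_ (WMod r))).hom = 𝟙 _ :=
  Hom.ext' (LinearMap.ext fun v => UMod.half_unit hr.out v)

theorem swap_unit_left (hr : 2 ≤ r) (hX : IsWeight r X) (x : ℂ ⊗[ℂ] X) :
    swap hr unitR X x = TensorProduct.lid ℂ X x ⊗ₜ (1 : ℂ) := by
  have : Fact (2 ≤ r) := ⟨hr⟩
  have h := coboundary_rightUnitor (C := WMod r) (t := WMod.half) WMod.half_naturality
    WMod.half_unit ⟨X, hX⟩
  have h2 : TensorProduct.rid ℂ X (swap hr unitR X x) = TensorProduct.lid ℂ X x :=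
    LinearMap.congr_fun (congrArg Hom.map h) x
  rw [← h2, ← TensorProduct.rid_symm_apply, LinearEquiv.symm_apply_apply]

theorem swap_unit_right (hr : 2 ≤ r) (hX : IsWeight r X) (x : X ⊗[ℂ] ℂ) :
    swap hr X unitR x = (1 : ℂ) ⊗ₜ TensorProduct.rid ℂ X x := by
  have : Fact (2 ≤ r) := ⟨hr⟩
  have h := coboundary_leftUnitor (C := WMod r) (t := WMod.half) WMod.half_naturality
    WMod.half_unit ⟨X, hX⟩
  have h2 : TensorProduct.lid ℂ X (swap hr X unitR x) = TensorProduct.rid ℂ X x :=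
    LinearMap.congr_fun (congrArg Hom.map h) x
  rw [← h2, ← TensorProduct.lid_symm_apply, LinearEquiv.symm_apply_apply]

/-! ## Coevaluation -/

/-- The functional `a ⊗ ψ ↦ φ a * ψ v`. -/
def matrixCoeff (φ : Module.Dual ℂ X) (v : X) : X ⊗[ℂ] Module.Dual ℂ X →ₗ[ℂ] ℂ :=
  TensorProduct.dualDistrib ℂ X (Module.Dual ℂ X) (φ ⊗ₜ Module.Dual.eval ℂ X v)

theorem matrixCoeff_tmul (φ : Module.Dual ℂ X) (v a : X) (ψ : Module.Dual ℂ X) :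
    matrixCoeff φ v (a ⊗ₜ ψ) = φ a * ψ v := rfl

theorem matrixCoeff_ext {x y : X ⊗[ℂ] Module.Dual ℂ X}
    (h : ∀ φ v, matrixCoeff φ v x = matrixCoeff φ v y) : x = y := by
  refine dualTensorMap_separates (Y := dualR X) fun f g => ?_
  obtain ⟨v, rfl⟩ := (Module.evalEquiv ℂ X).surjective g
  exact h f v

theorem coev_apply (z : ℂ) : coev X z = z • coev X 1 := by
  rw [← map_smul, smul_eq_mul, mul_one]

theorem coev_one {X : UMod} :
    coev X 1 = ∑ i, Module.Basis.ofVectorSpace ℂ X i ⊗ₜ[ℂ]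
      ((Module.Basis.ofVectorSpace ℂ X).coord i : Module.Dual ℂ X) :=
  coevaluation_apply_one ℂ X

/-- This characterises the coevaluation without bases; by `matrixCoeff_ext`, its module map property
and its exchange rule with transposes are checked on matrix coefficients. -/
theorem matrixCoeff_coev (φ : Module.Dual ℂ X) (v : X) : matrixCoeff φ v (coev X 1) = φ v := by
  rw [coev_one, map_sum]
  simp only [matrixCoeff_tmul]
  conv_rhs => rw [← (Module.Basis.ofVectorSpace ℂ X).sum_repr v, map_sum]
  refine Finset.sum_congr rfl fun i _ => ?_
  rw [map_smul, smul_eq_mul, mul_comm]; rfl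

theorem map_transpose_coev (f : Module.End ℂ X) (z : ℂ) :
    TensorProduct.map LinearMap.id (Module.Dual.transpose (R := ℂ) f) (coev X z) =
      TensorProduct.map f LinearMap.id (coev X z) := by
  rw [coev_apply, map_smul, map_smul]
  congr 1
  refine matrixCoeff_ext fun φ v => ?_
  have h1 : ∀ x, matrixCoeff φ v (TensorProduct.map LinearMap.id
      (Module.Dual.transpose (R := ℂ) f) x) = matrixCoeff φ (f v) x :=
    LinearMap.congr_fun (f := matrixCoeff φ v ∘ₗ TensorProduct.map LinearMap.id
      (Module.Dual.transpose (R := ℂ) f)) (TensorProduct.ext' fun _ _ => rfl)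
  have h2 : ∀ x, matrixCoeff φ v (TensorProduct.map f LinearMap.id x) = matrixCoeff (φ ∘ₗ f) v x :=
    LinearMap.congr_fun (f := matrixCoeff φ v ∘ₗ TensorProduct.map f LinearMap.id)
      (TensorProduct.ext' fun _ _ => rfl)
  rw [h1, h2, matrixCoeff_coev, matrixCoeff_coev]; rfl

/-- The coevaluation as a morphism. -/
def coevHom (hX : IsWeight r X) : Hom unitR (tensorR X (dualR X)) where
  map := coev X
  comm_E := LinearMap.ext fun z => by
    have h : ∀ φ v x, matrixCoeff φ v ((tensorR X (dualR X)).E x) =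
        -matrixCoeff φ (X.E (X.Kinv v)) x + matrixCoeff (φ ∘ₗ X.E) (X.Kinv v) x := fun φ v =>
      LinearMap.congr_fun (f := matrixCoeff φ v ∘ₗ (tensorR X (dualR X)).E)
        (g := -matrixCoeff φ (X.E (X.Kinv v)) + matrixCoeff (φ ∘ₗ X.E) (X.Kinv v))
        (TensorProduct.ext' fun a ψ => by
          rw [LinearMap.comp_apply, tensor_E_tmul, map_add, matrixCoeff_tmul, matrixCoeff_tmul,
            dual_E_apply, dual_K_apply, mul_neg]; rfl)
    rw [LinearMap.comp_apply, LinearMap.comp_apply, coev_apply z, map_smul, LinearMap.zero_apply,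
      map_zero]
    refine (smul_eq_zero_of_right z (matrixCoeff_ext fun φ v => ?_)).symm
    rw [h, matrixCoeff_coev, matrixCoeff_coev, map_zero, LinearMap.comp_apply, neg_add_cancel]
  comm_F := LinearMap.ext fun z => by
    have h : ∀ φ v x, matrixCoeff φ v ((tensorR X (dualR X)).F x) =
        -matrixCoeff (φ ∘ₗ X.Kinv) (X.K (X.F v)) x + matrixCoeff (φ ∘ₗ X.F) v x := fun φ v =>
      LinearMap.congr_fun (f := matrixCoeff φ v ∘ₗ (tensorR X (dualR X)).F)
        (g := -matrixCoeff (φ ∘ₗ X.Kinv) (X.K (X.F v)) + matrixCoeff (φ ∘ₗ X.F) v)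
        (TensorProduct.ext' fun a ψ => by
          rw [LinearMap.comp_apply, tensor_F_tmul, map_add, matrixCoeff_tmul, matrixCoeff_tmul,
            dual_F_apply, mul_neg]; rfl)
    rw [LinearMap.comp_apply, LinearMap.comp_apply, coev_apply z, map_smul, LinearMap.zero_apply,
      map_zero]
    refine (smul_eq_zero_of_right z (matrixCoeff_ext fun φ v => ?_)).symm
    rw [h, matrixCoeff_coev, matrixCoeff_coev, map_zero, LinearMap.comp_apply, LinearMap.comp_apply,
      hX.Kinv_K_apply, neg_add_cancel]
  comm_K := LinearMap.ext fun z => by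
    have h : ∀ φ v x, matrixCoeff φ v ((tensorR X (dualR X)).K x) =
        matrixCoeff (φ ∘ₗ X.K) (X.Kinv v) x := fun φ v =>
      LinearMap.congr_fun (f := matrixCoeff φ v ∘ₗ (tensorR X (dualR X)).K)
        (TensorProduct.ext' fun a ψ => rfl)
    rw [LinearMap.comp_apply, LinearMap.comp_apply, coev_apply z, map_smul, LinearMap.id_apply,
      coev_apply z]
    refine congrArg (z • ·) (matrixCoeff_ext fun φ v => ?_)
    rw [h, matrixCoeff_coev, matrixCoeff_coev, LinearMap.comp_apply, hX.K_Kinv_apply]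
  comm_Kinv := LinearMap.ext fun z => by
    have h : ∀ φ v x, matrixCoeff φ v ((tensorR X (dualR X)).Kinv x) =
        matrixCoeff (φ ∘ₗ X.Kinv) (X.K v) x := fun φ v =>
      LinearMap.congr_fun (f := matrixCoeff φ v ∘ₗ (tensorR X (dualR X)).Kinv)
        (TensorProduct.ext' fun a ψ => rfl)
    rw [LinearMap.comp_apply, LinearMap.comp_apply, coev_apply z, map_smul, LinearMap.id_apply,
      coev_apply z]
    refine congrArg (z • ·) (matrixCoeff_ext fun φ v => ?_)
    rw [h, matrixCoeff_coev, matrixCoeff_coev, LinearMap.comp_apply, hX.Kinv_K_apply]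
  comm_H := LinearMap.ext fun z => by
    have h : ∀ φ v x, matrixCoeff φ v ((tensorR X (dualR X)).H x) =
        matrixCoeff (φ ∘ₗ X.H) v x - matrixCoeff φ (X.H v) x := fun φ v =>
      LinearMap.congr_fun (f := matrixCoeff φ v ∘ₗ (tensorR X (dualR X)).H)
        (g := matrixCoeff (φ ∘ₗ X.H) v - matrixCoeff φ (X.H v))
        (TensorProduct.ext' fun a ψ => by
          rw [LinearMap.comp_apply, tensor_H_tmul, map_add, matrixCoeff_tmul, matrixCoeff_tmul,
            dual_H_apply, mul_neg, ← sub_eq_add_neg]; rfl)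
    rw [LinearMap.comp_apply, LinearMap.comp_apply, coev_apply z, map_smul, LinearMap.zero_apply,
      map_zero]
    refine (smul_eq_zero_of_right z (matrixCoeff_ext fun φ v => ?_)).symm
    rw [h, matrixCoeff_coev, matrixCoeff_coev, map_zero, LinearMap.comp_apply, sub_self]

theorem ev_map_transpose (f : Module.End ℂ X) (x : Module.Dual ℂ X ⊗[ℂ] X) :
    ev X (TensorProduct.map (Module.Dual.transpose (R := ℂ) f) LinearMap.id x) =
      ev X (TensorProduct.map LinearMap.id f x) :=
  LinearMap.congr_fun (f := ev X ∘ₗ TensorProduct.map (Module.Dual.transpose (R := ℂ) f)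
    LinearMap.id) (g := ev X ∘ₗ TensorProduct.map LinearMap.id f)
    (TensorProduct.ext' fun φ v => by
      rw [LinearMap.comp_apply, LinearMap.comp_apply, TensorProduct.map_tmul,
        TensorProduct.map_tmul, ev_comp, ev_comp]; rfl) x

/-- The inverse of the twist. -/
def twist (hr : 2 ≤ r) (X : UMod) : Module.End ℂ X :=
  (half hr X).toLinearMap ∘ₗ (half hr X).toLinearMap

theorem half_dual (hr : 2 ≤ r) (hX : IsWeight r X) : (half hr (dualR X)).toLinearMap =
    Module.Dual.transpose (R := ℂ) (half hr X).toLinearMap := (isHalfTwist_half hr).dual X hX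

theorem ev_map_half (hr : 2 ≤ r) (hX : IsWeight r X) (y : Module.Dual ℂ X ⊗[ℂ] X) :
    ev X (TensorProduct.map (half hr (dualR X)).toLinearMap (half hr X).toLinearMap y) =
      ev X (TensorProduct.map LinearMap.id (twist hr X) y) := by
  have e1 : TensorProduct.map (half hr (dualR X)).toLinearMap (half hr X).toLinearMap =
      TensorProduct.map (Module.Dual.transpose (R := ℂ) (half hr X).toLinearMap) LinearMap.id ∘ₗ
        TensorProduct.map LinearMap.id (half hr X).toLinearMap := by
    rw [half_dual hr hX, ← TensorProduct.map_comp]; rfl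
  rw [e1, LinearMap.comp_apply, ev_map_transpose]
  exact congrArg (ev X) (LinearMap.congr_fun (TensorProduct.map_comp LinearMap.id
    (half hr X).toLinearMap LinearMap.id (half hr X).toLinearMap) y).symm

/-- The half twist is trivial on the unit, so naturality of evaluation removes `√θ⁻¹`. The half
twist on the dual is a transpose, and transferring it to the other factor makes a full twist. -/
theorem ev_swap (hr : 2 ≤ r) (hX : IsWeight r X) (x : X ⊗[ℂ] Module.Dual ℂ X) :
    ev X (swap hr X (dualR X) x) =
      ev X (braid r X (dualR X) (TensorProduct.map (twist hr X) LinearMap.id x)) := by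
  have hD := hX.dual
  have h1 := half_symm_naturality hr (hD.tensor hr hX) (IsWeight.unit hr) (evHom hX)
    (braid r X (dualR X) (TensorProduct.map (half hr X).toLinearMap
      (half hr (dualR X)).toLinearMap x))
  have h2 : ∀ z : ℂ, (half hr unitR).symm z = z := fun z => by
    rw [LinearEquiv.symm_apply_eq]; exact (half_unit hr z).symm
  refine (h1.trans (h2 _)).trans ?_
  have h3 := braidHalf_naturality hr hX hD x
  refine (congrArg (ev X) h3).trans ?_
  have h4 := LinearMap.congr_fun (braid_naturality hX hD hX hD
    (show X ⟶ X from (halfIso hr hX).hom ≫ (halfIso hr hX).hom) (𝟙 (dualR X) : dualR X ⟶ dualR X)) x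
  refine Eq.trans ?_ (congrArg (ev X) h4).symm
  exact ev_map_half hr hX _

/-- The mirror image of `ev_swap`: naturality of coevaluation removes `√θ⁻¹`, and the transposed
half twist moves to the other factor. -/
theorem swap_coev (hr : 2 ≤ r) (hX : IsWeight r X) (z : ℂ) :
    swap hr X (dualR X) (coev X z) =
      TensorProduct.map LinearMap.id (twist hr X) (braid r X (dualR X) (coev X z)) := by
  have hD := hX.dual
  have h1 := half_symm_naturality hr (IsWeight.unit hr) (hD.tensor hr hX)
    (show (unitR : UMod) ⟶ tensorR (dualR X) X from
      (show unitR ⟶ tensorR X (dualR X) from coevHom hX) ≫ braidHalfHom hr hX hD) z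
  have h2 : ∀ z : ℂ, (half hr unitR).symm z = z := fun z => by
    rw [LinearEquiv.symm_apply_eq]; exact (half_unit hr z).symm
  rw [h2] at h1
  refine h1.symm.trans ?_
  have h3 : TensorProduct.map (half hr X).toLinearMap (half hr (dualR X)).toLinearMap (coev X z) =
      TensorProduct.map (twist hr X) LinearMap.id (coev X z) := by
    have e1 : TensorProduct.map (half hr X).toLinearMap (half hr (dualR X)).toLinearMap =
        TensorProduct.map (half hr X).toLinearMap LinearMap.id ∘ₗ
          TensorProduct.map LinearMap.id (Module.Dual.transpose (R := ℂ) (half hr X).toLinearMap) := by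
      rw [half_dual hr hX, ← TensorProduct.map_comp]; rfl
    rw [e1, LinearMap.comp_apply, map_transpose_coev, ← LinearMap.comp_apply,
      ← TensorProduct.map_comp]; rfl
  refine (congrArg (braid r X (dualR X)) h3).trans ?_
  exact LinearMap.congr_fun (braid_naturality hX hD hX hD
    (show X ⟶ X from (halfIso hr hX).hom ≫ (halfIso hr hX).hom) (𝟙 (dualR X) : dualR X ⟶ dualR X)) _

end UMod

open UMod

/-! ### The twist on tensor products and duals, and regrouping of pairings. -/

namespace UMod

variable {r : ℕ} {X Y : UMod}

theorem theta_twist (hr : 2 ≤ r) (hX : IsWeight r X) (v : X) : theta r X (twist hr X v) = v :=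
  (isHalfTwist_half hr).sq X hX v

/-- The twist as an isomorphism. -/
def twistIso (hr : 2 ≤ r) (hX : IsWeight r X) : X ≅ X := halfIso hr hX ≪≫ halfIso hr hX

theorem twistIso_inv (hr : 2 ≤ r) (hX : IsWeight r X) :
    Hom.map (twistIso hr hX).inv = theta r X :=
  LinearMap.ext fun v => (theta_eq_half_symm hr hX v).symm

/-- The inverse of `theta_tensor`, with the twists moved past the double braiding by naturality. -/
theorem twist_tensor (hr : 2 ≤ r) (hX : IsWeight r X) (hY : IsWeight r Y) :
    twist hr (tensorR X Y) =
      TensorProduct.map (twist hr X) (twist hr Y) ∘ₗ braid r Y X ∘ₗ braid r X Y := by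
  have hXY := hX.tensor hr hY
  have h1 : TensorProduct.map (theta r X) (theta r Y) ∘ₗ
      TensorProduct.map (twist hr X) (twist hr Y) = LinearMap.id := by
    rw [← TensorProduct.map_comp, ← TensorProduct.map_id]
    exact congrArg₂ _ (LinearMap.ext (theta_twist hr hX)) (LinearMap.ext (theta_twist hr hY))
  rw [← LinearMap.comp_assoc]
  have h2 := braid_naturality hX hY hX hY (twistIso hr hX).hom (twistIso hr hY).hom
  have h3 := braid_naturality hY hX hY hX (twistIso hr hY).hom (twistIso hr hX).hom
  refine LinearMap.ext fun v => ?_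
  have e : TensorProduct.map (twist hr X) (twist hr Y) (braid r Y X (braid r X Y v)) =
      braid r Y X (braid r X Y (TensorProduct.map (twist hr X) (twist hr Y) v)) :=
    (LinearMap.congr_fun h3 _).symm.trans (congrArg (braid r Y X) (LinearMap.congr_fun h2 v).symm)
  refine Eq.trans ?_ e.symm
  have h4 := (LinearMap.congr_fun (theta_tensor hr hX hY)
    (TensorProduct.map (twist hr X) (twist hr Y) v)).trans (LinearMap.congr_fun h1 v)
  have h5 := theta_eq_half_symm hr hXY (braid r Y X (braid r X Y
    (TensorProduct.map (twist hr X) (twist hr Y) v)))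
  have h6 := h5.symm.trans h4
  rw [LinearEquiv.symm_apply_eq, LinearEquiv.symm_apply_eq] at h6
  exact h6.symm

theorem twist_dual (hr : 2 ≤ r) (hX : IsWeight r X) :
    twist hr (dualR X) = Module.Dual.transpose (R := ℂ) (twist hr X) := by
  have h := half_dual hr hX
  have e : twist hr (dualR X) = (half hr (dualR X)).toLinearMap ∘ₗ
    (half hr (dualR X)).toLinearMap := rfl
  rw [e, h]; rfl

theorem pairing_compl₂_left {X X' X'' Y Y' : UMod} (B : X →ₗ⋆[ℂ] X' →ₗ[ℂ] ℂ)
    (B' : Y →ₗ⋆[ℂ] Y' →ₗ[ℂ] ℂ) (s : X'' →ₗ[ℂ] X') (v : X ⊗[ℂ] Y) (u : Y' ⊗[ℂ] X'') :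
    pairing (B.compl₂ s) B' v u = pairing B B' v (TensorProduct.map LinearMap.id s u) :=
  pairing_ext (P := pairing (B.compl₂ s) B')
    (Q := (pairing B B').compl₂ (TensorProduct.map LinearMap.id s)) (fun _ _ _ _ => rfl) v u

theorem pairing_compl₂_right {X X' Y Y' Y'' : UMod} (B : X →ₗ⋆[ℂ] X' →ₗ[ℂ] ℂ)
    (B' : Y →ₗ⋆[ℂ] Y' →ₗ[ℂ] ℂ) (s : Y'' →ₗ[ℂ] Y') (v : X ⊗[ℂ] Y) (u : Y'' ⊗[ℂ] X') :
    pairing B (B'.compl₂ s) v u = pairing B B' v (TensorProduct.map s LinearMap.id u) :=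
  pairing_ext (P := pairing B (B'.compl₂ s))
    (Q := (pairing B B').compl₂ (TensorProduct.map s LinearMap.id)) (fun _ _ _ _ => rfl) v u

theorem pairing_assoc {X X' Y Y' Z Z' : UMod} (A : X →ₗ⋆[ℂ] X' →ₗ[ℂ] ℂ)
    (B : Y →ₗ⋆[ℂ] Y' →ₗ[ℂ] ℂ) (C : Z →ₗ⋆[ℂ] Z' →ₗ[ℂ] ℂ) (v : (X ⊗[ℂ] Y) ⊗[ℂ] Z)
    (u : (Z' ⊗[ℂ] Y') ⊗[ℂ] X') :
    pairing (Y := tensorR Y Z) (Y' := tensorR Z' Y') A (pairing B C)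
        (TensorProduct.assoc ℂ X Y Z v) u =
      pairing (X := tensorR X Y) (X' := tensorR Y' X') (pairing A B) C v
        (TensorProduct.assoc ℂ Z' Y' X' u) := by
  have h1 : ∀ x y z c b a, pairing (Y := tensorR Y Z) (Y' := tensorR Z' Y') A (pairing B C)
      (x ⊗ₜ (y ⊗ₜ z)) ((c ⊗ₜ b) ⊗ₜ a) = pairing (X := tensorR X Y) (X' := tensorR Y' X')
      (pairing A B) C ((x ⊗ₜ y) ⊗ₜ z) (c ⊗ₜ (b ⊗ₜ a)) := fun x y z c b a =>
    show A x a * (B y b * C z c) = A x a * B y b * C z c from (mul_assoc _ _ _).symm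
  refine LinearMap.congr_fun (LinearMap.congr_fun
    (f := ((pairing (Y := tensorR Y Z) (Y' := tensorR Z' Y') A (pairing B C)).comp
      (TensorProduct.assoc ℂ X Y Z).toLinearMap))
    (g := (pairing (X := tensorR X Y) (X' := tensorR Y' X') (pairing A B) C).compl₂
      (TensorProduct.assoc ℂ Z' Y' X').toLinearMap) ?_ v) u
  refine LinearMap.ext fun v => TensorProduct.ext_threefold fun c b a => ?_
  induction v with
  | zero => rw [map_zero, map_zero]
  | add v w hv hw => rw [map_add, map_add, LinearMap.add_apply, LinearMap.add_apply, hv, hw]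
  | tmul p z =>
    induction p with
    | zero => rw [TensorProduct.zero_tmul, map_zero, map_zero]
    | add v w hv hw =>
      rw [TensorProduct.add_tmul, map_add, map_add, LinearMap.add_apply, LinearMap.add_apply, hv,
        hw]
    | tmul x y => exact h1 x y z c b a

end UMod

namespace HMod

variable {r : ℕ} {X Y Z : HMod}

/-! ## Adjoints -/

theorem IsHermitian.form_injective (hX : X.IsHermitian) {v w : X.carrier}
    (h : ∀ u, X.form v u = X.form w u) : v = w := hX.ext_form fun _ => h _

/-- Adjunction exchanges `E` with `F` and `K` with `K⁻¹` in source and target alike, so the adjoint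
again commutes with all generators. -/
theorem IsHermitian.exists_adjoint (hX : X.IsHermitian) (hY : Y.IsHermitian)
    (f : Hom X.toUMod Y.toUMod) :
    ∃ g : Hom Y.toUMod X.toUMod, ∀ w v, Y.form w (f.map v) = X.form (g.map w) v := by
  -- The adjoint is first chosen pointwise; nondegeneracy then forces its linearity.
  choose g hg using fun w => hX.exists_form_eq ((Y.form w).comp f.map)
  have hg' : ∀ w v, X.form (g w) v = Y.form w (f.map v) := fun w => LinearMap.congr_fun (hg w)
  have key : ∀ {a b : Module.End ℂ Y.carrier} {c d : Module.End ℂ X.carrier},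
      (∀ v w, Y.form (a v) w = Y.form v (b w)) → (∀ v w, X.form (c v) w = X.form v (d w)) →
      f.map ∘ₗ d = b ∘ₗ f.map → ∀ w, g (a w) = c (g w) := fun ha hc h w =>
    hX.form_injective fun u => by
      rw [hg', ha, hc, hg']
      exact congrArg _ (LinearMap.congr_fun h u).symm
  refine ⟨⟨⟨⟨g, fun v w => hX.form_injective fun u => ?_⟩,
    fun c v => hX.form_injective fun u => ?_⟩, LinearMap.ext (key hY.form_F hX.form_F f.comm_F),
    LinearMap.ext (key hY.form_E hX.form_E f.comm_E),
    LinearMap.ext (key hY.form_Kinv hX.form_Kinv f.comm_Kinv),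
    LinearMap.ext (key hY.form_K hX.form_K f.comm_K),
    LinearMap.ext (key hY.form_H hX.form_H f.comm_H)⟩, fun w v => (hg' w v).symm⟩
  · rw [hg', map_add, LinearMap.add_apply, map_add, LinearMap.add_apply, hg', hg']
  · rw [hg', RingHom.id_apply, LinearMap.map_smulₛₗ, LinearMap.smul_apply, LinearMap.map_smulₛₗ,
      LinearMap.smul_apply, hg']

theorem tensorForm_map {X' Y' : HMod} (hr : 2 ≤ r) (hwX : IsWeight r X.toUMod)
    (hwY : IsWeight r Y.toUMod) (hwX' : IsWeight r X'.toUMod) (hwY' : IsWeight r Y'.toUMod)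
    {f : Hom X.toUMod X'.toUMod} {g : Hom Y.toUMod Y'.toUMod} {f' : Hom X'.toUMod X.toUMod}
    {g' : Hom Y'.toUMod Y.toUMod} (hf : ∀ w v, X'.form w (f.map v) = X.form (f'.map w) v)
    (hg : ∀ w v, Y'.form w (g.map v) = Y.form (g'.map w) v) (w : X'.carrier ⊗[ℂ] Y'.carrier)
    (v : X.carrier ⊗[ℂ] Y.carrier) :
    tensorForm hr X' Y' w (TensorProduct.map f.map g.map v) =
      tensorForm hr X Y (TensorProduct.map f'.map g'.map w) v := by
  rw [tensorForm_apply, tensorForm_apply]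
  refine (congrArg _ (swap_naturality hr hwX hwY hwX' hwY' f g v)).trans ?_
  refine pairing_ext (X := X'.toUMod) (Y := Y'.toUMod) (Z := Y.toUMod) (W := X.toUMod)
    (P := (pairing (X := X'.toUMod) (X' := X'.toUMod) (Y := Y'.toUMod) (Y' := Y'.toUMod)
      X'.form Y'.form).compl₂ (TensorProduct.map g.map f.map))
    (Q := (pairing (X := X.toUMod) (X' := X.toUMod) (Y := Y.toUMod) (Y' := Y.toUMod)
      X.form Y.form).comp (TensorProduct.map f'.map g'.map)) (fun x y z w => ?_) w _
  change X'.form x (f.map w) * Y'.form y (g.map z) = X.form (f'.map x) w * Y.form (g'.map y) z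
  rw [hf, hg]

/-! ## Unitarity of the structural isomorphisms -/

/-- Both forms are the threefold product pairing composed with a reversal of the three factors; the
two reversals agree by the coboundary hexagon. -/
theorem tensorForm_assoc (hr : 2 ≤ r) (hwX : IsWeight r X.toUMod)
    (hwY : IsWeight r Y.toUMod) (hwZ : IsWeight r Z.toUMod)
    (v w : (X.carrier ⊗[ℂ] Y.carrier) ⊗[ℂ] Z.carrier) :
    tensorForm hr X (HMod.tensor r (UMod.half hr) Y Z)
        (TensorProduct.assoc ℂ X.carrier Y.carrier Z.carrier v)
        (TensorProduct.assoc ℂ X.carrier Y.carrier Z.carrier w) =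
      tensorForm hr (HMod.tensor r (UMod.half hr) X Y) Z v w := by
  refine (pairing_compl₂_right (X := X.toUMod) (X' := X.toUMod)
    (Y := tensorR Y.toUMod Z.toUMod) (Y' := tensorR Z.toUMod Y.toUMod)
    (Y'' := tensorR Y.toUMod Z.toUMod) X.form
    (pairing (X := Y.toUMod) (X' := Y.toUMod) (Y := Z.toUMod) (Y' := Z.toUMod) Y.form Z.form)
    (swap hr Y.toUMod Z.toUMod) _ _).trans ?_
  refine (congrArg _ (swap_hexagon hr hwX hwY hwZ _)).trans ?_
  rw [LinearEquiv.symm_apply_apply]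
  refine (pairing_assoc (X := X.toUMod) (X' := X.toUMod) (Y := Y.toUMod) (Y' := Y.toUMod)
    (Z := Z.toUMod) (Z' := Z.toUMod) X.form Y.form Z.form v _).trans ?_
  refine Eq.trans (congrArg _ (LinearEquiv.apply_symm_apply _ _)) ?_
  exact (pairing_compl₂_left (X := tensorR X.toUMod Y.toUMod) (X' := tensorR Y.toUMod X.toUMod)
    (X'' := tensorR X.toUMod Y.toUMod) (Y := Z.toUMod) (Y' := Z.toUMod)
    (pairing (X := X.toUMod) (X' := X.toUMod) (Y := Y.toUMod) (Y' := Y.toUMod) X.form Y.form)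
    Z.form (swap hr X.toUMod Y.toUMod) _ _).symm

theorem tensorForm_unit_left (hr : 2 ≤ r) (hwX : IsWeight r X.toUMod) (v w : ℂ ⊗[ℂ] X.carrier) :
    tensorForm hr HMod.unit X v w =
      X.form (TensorProduct.lid ℂ X.carrier v) (TensorProduct.lid ℂ X.carrier w) := by
  have h : ∀ (v : ℂ ⊗[ℂ] X.carrier) y, pairing (X := unitR) (X' := unitR) (Y := X.toUMod)
      (Y' := X.toUMod) unitForm X.form v (y ⊗ₜ (1 : ℂ)) =
        X.form (TensorProduct.lid ℂ X.carrier v) y := by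
    intro v y
    induction v with
    | zero => simp
    | add v w hv hw => rw [map_add, LinearMap.add_apply, hv, hw, map_add, map_add]; rfl
    | tmul z x =>
      rw [TensorProduct.lid_tmul, LinearMap.map_smulₛₗ, LinearMap.smul_apply, smul_eq_mul]
      refine (pairing_tmul (X := unitR) (X' := unitR) (Y := X.toUMod) (Y' := X.toUMod)
        (B := unitForm) (B' := X.form) z x (1 : ℂ) y).trans ?_
      rw [unitForm_apply, mul_one]
  exact (congrArg _ (swap_unit_left hr hwX w)).trans (h v _)

theorem tensorForm_unit_right (hr : 2 ≤ r) (hwX : IsWeight r X.toUMod) (v w : X.carrier ⊗[ℂ] ℂ) :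
    tensorForm hr X HMod.unit v w =
      X.form (TensorProduct.rid ℂ X.carrier v) (TensorProduct.rid ℂ X.carrier w) := by
  have h : ∀ (v : X.carrier ⊗[ℂ] ℂ) y, pairing (X := X.toUMod) (X' := X.toUMod) (Y := unitR)
      (Y' := unitR) X.form unitForm v ((1 : ℂ) ⊗ₜ y) =
        X.form (TensorProduct.rid ℂ X.carrier v) y := by
    intro v y
    induction v with
    | zero => simp
    | add v w hv hw => rw [map_add, LinearMap.add_apply, hv, hw, map_add, map_add]; rfl
    | tmul x z =>
      rw [TensorProduct.rid_tmul, LinearMap.map_smulₛₗ, LinearMap.smul_apply, smul_eq_mul]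
      refine (pairing_tmul (X := X.toUMod) (X' := X.toUMod) (Y := unitR) (Y' := unitR)
        (B := X.form) (B' := unitForm) x z y (1 : ℂ)).trans ?_
      rw [unitForm_apply, mul_one, mul_comm]
  exact (congrArg _ (swap_unit_right hr hwX w)).trans (h v _)

/-- Since the symmetry squares to the identity, its unitarity is only a restatement of Hermitian
symmetry. -/
theorem tensorForm_swap (hr : 2 ≤ r) (hwX : IsWeight r X.toUMod) (hwY : IsWeight r Y.toUMod)
    (hX : X.IsHermitian) (hY : Y.IsHermitian) (v w : X.carrier ⊗[ℂ] Y.carrier) :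
    tensorForm hr Y X (swap hr X.toUMod Y.toUMod v) (swap hr X.toUMod Y.toUMod w) =
      tensorForm hr X Y v w := by
  rw [tensorForm_apply]
  refine (congrArg _ (swap_swap hr hwX hwY w)).trans ?_
  rw [pairing_symm (X := Y.toUMod) (Y := X.toUMod) hY.symm hX.symm]
  exact (tensorForm_symm hr hwX hwY hX hY v w).symm

theorem tensorForm_braid (hr : 2 ≤ r) (hwX : IsWeight r X.toUMod) (hwY : IsWeight r Y.toUMod)
    (hX : X.IsHermitian) (hY : Y.IsHermitian) (v w : X.carrier ⊗[ℂ] Y.carrier) :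
    tensorForm hr Y X (braid r X.toUMod Y.toUMod v) (braid r X.toUMod Y.toUMod w) =
      tensorForm hr X Y v w := by
  -- Writing both vectors as images under `√θ ⊗ √θ` turns the braiding into the symmetry followed by
  -- a half twist, and both are unitary.
  set e := TensorProduct.congr (UMod.half hr X.toUMod) (UMod.half hr Y.toUMod) with he
  obtain ⟨v, rfl⟩ := e.surjective v
  obtain ⟨w, rfl⟩ := e.surjective w
  have h1 : ∀ v, braid r X.toUMod Y.toUMod (e v) = UMod.half hr (tensorR Y.toUMod X.toUMod)
      (swap hr X.toUMod Y.toUMod v) := fun v => by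
    rw [swap_apply]; exact (LinearEquiv.apply_symm_apply _ _).symm
  rw [h1, h1]
  refine (half_form hr (hwY.tensor hr hwX) (hwY.tensor hr hwX)
    (tensorForm_invariant hr hwY hwX hY hX) _ _).trans ?_
  rw [tensorForm_swap hr hwX hwY hX hY, tensorForm_apply, tensorForm_apply]
  have h2 := swap_naturality hr hwX hwY hwX hwY (halfIso hr hwX).hom (halfIso hr hwY).hom w
  exact ((congrArg _ h2).trans (pairing_map_half hr hwX hwY hX hY v _)).symm

theorem twist_form (hr : 2 ≤ r) (hwX : IsWeight r X.toUMod) (hX : X.IsHermitian)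
    (v w : X.carrier) : X.form (twist hr X.toUMod v) (twist hr X.toUMod w) = X.form v w :=
  (half_form hr hwX hwX hX.invariant _ _).trans (half_form hr hwX hwX hX.invariant v w)

/-! ## Evaluation and coevaluation -/

/-- For the plain product pairing coevaluation and evaluation are adjoint. The braiding and twist in
the ribbon formulas enter only through the symmetry, by `ev_swap` and `swap_coev`. -/
theorem pairing_coev (hX : X.IsHermitian) (z : ℂ) (u : Module.Dual ℂ X.carrier ⊗[ℂ] X.carrier) :
    pairing (X := X.toUMod) (X' := X.toUMod) (Y := dualR X.toUMod) (Y' := dualR X.toUMod)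
      X.form (dualForm X) (coev X.toUMod z) u = starRingEnd ℂ z * ev X.toUMod u := by
  rw [coev_apply, LinearMap.map_smulₛₗ, LinearMap.smul_apply, smul_eq_mul]
  congr 1
  induction u with
  | zero => rw [map_zero, map_zero]
  | add v w hv hw => rw [map_add, hv, hw, map_add]
  | tmul ψ v =>
    obtain ⟨y, rfl⟩ := hX.exists_form_eq ψ
    rw [coev_one, map_sum, LinearMap.sum_apply, ev_comp (X := X.toUMod)]
    conv_rhs => rw [← (Module.Basis.ofVectorSpace ℂ X.carrier).sum_repr y, map_sum,
      LinearMap.sum_apply]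
    refine Finset.sum_congr rfl fun i _ => ?_
    rw [LinearMap.map_smulₛₗ, LinearMap.smul_apply, smul_eq_mul, mul_comm]
    refine congrArg (X.form _ v * ·) ?_
    exact (hX.dual.symm _ _).trans (congrArg _ (hX.dualForm_form y _))

theorem tensorForm_coev (hr : 2 ≤ r) (hwX : IsWeight r X.toUMod) (hX : X.IsHermitian) (z : ℂ)
    (x : X.carrier ⊗[ℂ] Module.Dual ℂ X.carrier) :
    tensorForm hr X X.dual x (coev X.toUMod z) =
      starRingEnd ℂ (ev X.toUMod (braid r X.toUMod (dualR X.toUMod)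
        (TensorProduct.map (twist hr X.toUMod) LinearMap.id x))) * z := by
  refine (tensorForm_symm hr hwX hwX.dual hX hX.dual x (coev X.toUMod z)).trans ?_
  refine (congrArg _ (pairing_coev hX z _)).trans ?_
  rw [map_mul, Complex.conj_conj, mul_comm]
  exact congrArg (starRingEnd ℂ · * z) (ev_swap hr hwX x)

theorem tensorForm_ev (hr : 2 ≤ r) (hwX : IsWeight r X.toUMod) (hX : X.IsHermitian) (z : ℂ)
    (x : Module.Dual ℂ X.carrier ⊗[ℂ] X.carrier) :
    tensorForm hr X.dual X (TensorProduct.map LinearMap.id (twist hr X.toUMod)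
        (braid r X.toUMod (dualR X.toUMod) (coev X.toUMod z))) x =
      starRingEnd ℂ z * ev X.toUMod x := by
  rw [← pairing_coev hX]
  refine (congrArg (fun u => tensorForm hr X.dual X u x) (swap_coev hr hwX z).symm).trans ?_
  refine (tensorForm_symm hr hwX.dual hwX hX.dual hX _ x).trans ?_
  refine Eq.trans ?_ (pairing_symm (X := X.toUMod) (Y := dualR X.toUMod) hX.symm hX.dual.symm
    (coev X.toUMod z) x).symm
  exact congrArg (starRingEnd ℂ) (congrArg (pairing (X := dualR X.toUMod)
    (X' := dualR X.toUMod) (Y := X.toUMod) (Y' := X.toUMod) (dualForm X) X.form x)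
      (swap_swap hr hwX hwX.dual (coev X.toUMod z)))

end HMod

open UMod

namespace DDagger

variable {r : ℕ}

/-! ## The conjugation -/

/-- The Hermitian adjoint. -/
def dagger {V W : DDagger r} (f : V ⟶ W) : W ⟶ V :=
  (V.mem.isHermitian.exists_adjoint W.mem.isHermitian f).choose

theorem form_dagger {V W : DDagger r} (f : V ⟶ W) (w : W.obj.carrier) (v : V.obj.carrier) :
    W.obj.form w (toLin f v) = V.obj.form (toLin (dagger f) w) v :=
  (V.mem.isHermitian.exists_adjoint W.mem.isHermitian f).choose_spec w v

theorem dagger_eq {V W : DDagger r} {f : V ⟶ W} {g : W ⟶ V}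
    (h : ∀ w v, W.obj.form w (toLin f v) = V.obj.form (toLin g w) v) : dagger f = g :=
  Hom.ext' (LinearMap.ext fun w => V.mem.isHermitian.form_injective fun v =>
    (form_dagger f w v).symm.trans (h w v))

theorem dagger_dagger {V W : DDagger r} (f : V ⟶ W) : dagger (dagger f) = f :=
  dagger_eq fun v w => by
    rw [V.mem.isHermitian.symm, ← form_dagger, W.mem.isHermitian.symm, Complex.conj_conj]

theorem dagger_comp {U V W : DDagger r} (f : V ⟶ W) (g : U ⟶ V) :
    dagger (g ≫ f) = dagger f ≫ dagger g :=
  dagger_eq fun w v => (form_dagger f w _).trans (form_dagger g _ v)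

theorem dagger_iso {V W : DDagger r} (e : V ≅ W)
    (h : ∀ v v', W.obj.form (toLin e.hom v) (toLin e.hom v') = V.obj.form v v') :
    dagger e.hom = e.inv :=
  dagger_eq fun w v => by
    rw [← h (toLin e.inv w) v]
    exact congrArg (fun w => W.obj.form w (toLin e.hom v))
      (LinearMap.congr_fun (congrArg toLin e.inv_hom_id) w).symm

/-! ## The ribbon structure -/

/-- The twist. -/
def twist (hr : 2 ≤ r) (V : DDagger r) : V ≅ V := isoOf (twistIso hr V.mem.isWeight)

/-- The braiding on `𝒟†`. -/
@[reducible]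
def braided (hr : 2 ≤ r) :
    letI := monoidal (closedUnderTensor hr)
    BraidedCategory (DDagger r) :=
  letI := monoidal (closedUnderTensor hr)
  { braiding := fun V W => isoOf (V := V ⊗ W) (W := W ⊗ V)
      (braidIso hr V.mem.isWeight W.mem.isWeight)
    braiding_naturality_right := fun X Y Z f =>
      braidIso_naturality_right hr X.mem.isWeight Y.mem.isWeight Z.mem.isWeight f
    braiding_naturality_left := fun {X Y} f Z =>
      braidIso_naturality_left hr X.mem.isWeight Y.mem.isWeight Z.mem.isWeight f
    hexagon_forward := fun X Y Z =>
      braidIso_hexagon_forward hr X.mem.isWeight Y.mem.isWeight Z.mem.isWeight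
    hexagon_reverse := fun X Y Z =>
      braidIso_hexagon_reverse hr X.mem.isWeight Y.mem.isWeight Z.mem.isWeight }

/-- The duality between `V` and `V*`. -/
@[reducible]
def exactPairing (hr : 2 ≤ r) (V : DDagger r) :
    letI := monoidal (closedUnderTensor hr)
    ExactPairing V (dual (closedUnderTensor hr) V) :=
  letI := monoidal (closedUnderTensor hr)
  { coevaluation' := coevHom V.mem.isWeight
    evaluation' := evHom V.mem.isWeight
    coevaluation_evaluation' := Hom.ext' (contractLeft_assoc_coevaluation ℂ V.obj.carrier)
    evaluation_coevaluation' := Hom.ext' (contractLeft_assoc_coevaluation' ℂ V.obj.carrier) }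

/-- `𝒟†` is a ribbon category. -/
def ribbon (hr : 2 ≤ r) :
    letI := monoidal (closedUnderTensor hr)
    RibbonStructure (DDagger r) (dual (closedUnderTensor hr)) :=
  letI := monoidal (closedUnderTensor hr)
  { braided := braided hr
    pairing := exactPairing hr
    twist := twist hr
    twist_naturality := fun {V W} f => Hom.ext' (LinearMap.ext fun v =>
      ((half_naturality hr V.mem.isWeight W.mem.isWeight f _).trans
        (congrArg _ (half_naturality hr V.mem.isWeight W.mem.isWeight f v))).symm)
    twist_tensor := fun V W => Hom.ext' (twist_tensor hr V.mem.isWeight W.mem.isWeight)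
    twist_dual := fun V => Hom.ext' (LinearMap.ext fun z =>
      (map_transpose_coev (UMod.twist hr V.obj.toUMod) z).symm.trans
        (congrArg (fun g => TensorProduct.map LinearMap.id g (coev V.obj.toUMod z))
          (twist_dual hr V.mem.isWeight).symm)) }

/-- `𝒟†` is a Hermitian ribbon category. -/
def hermitianRibbon (hr : 2 ≤ r) :
    letI := monoidal (closedUnderTensor hr)
    HermitianRibbonStructure (DDagger r) (dual (closedUnderTensor hr)) :=
  letI := monoidal (closedUnderTensor hr)
  { toRibbonStructure := ribbon hr
    dagger := dagger
    dagger_dagger := dagger_dagger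
    dagger_tensor := fun {V W V' W'} f g => dagger_eq (V := V ⊗ V') (W := W ⊗ W')
      (HMod.tensorForm_map hr V.mem.isWeight V'.mem.isWeight W.mem.isWeight W'.mem.isWeight
        (form_dagger f) (form_dagger g))
    dagger_comp := dagger_comp
    dagger_associator := fun U V W => dagger_iso (α_ U V W)
      (HMod.tensorForm_assoc hr U.mem.isWeight V.mem.isWeight W.mem.isWeight)
    dagger_leftUnitor := fun V => dagger_iso (λ_ V) fun v w =>
      (HMod.tensorForm_unit_left hr V.mem.isWeight v w).symm
    dagger_rightUnitor := fun V => dagger_iso (ρ_ V) fun v w =>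
      (HMod.tensorForm_unit_right hr V.mem.isWeight v w).symm
    dagger_braiding := fun V W => dagger_iso ((braided hr).braiding V W)
      (HMod.tensorForm_braid hr V.mem.isWeight W.mem.isWeight V.mem.isHermitian W.mem.isHermitian)
    dagger_twist := fun V => dagger_iso (twist hr V)
      (HMod.twist_form hr V.mem.isWeight V.mem.isHermitian)
    dagger_coev := fun V => dagger_eq (V := 𝟙_ _) (W := V ⊗ dual (closedUnderTensor hr) V)
      fun x z => HMod.tensorForm_coev hr V.mem.isWeight V.mem.isHermitian z x
    dagger_ev := fun V => dagger_eq (V := dual (closedUnderTensor hr) V ⊗ V) (W := 𝟙_ _)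
      fun z x => (HMod.tensorForm_ev hr V.mem.isWeight V.mem.isHermitian z x).symm }

end DDagger

end UnrolledSl2

end

theorem mainTheorem1 (r : ℕ) (hr : 2 ≤ r) :
    ∃ h : ∀ X : UMod, X ≃ₗ[ℂ] X, IsHalfTwist r h ∧
    ∃ hc : ClosedUnderTensor r h,
    letI := DDagger.monoidal hc
    ∃ R : HermitianRibbonStructure (DDagger r) (DDagger.dual hc),
      (∀ V W : DDagger r, DDagger.toLin (R.braided.braiding V W).hom =
        UMod.braid r V.obj.toUMod W.obj.toUMod) ∧
      (∀ V : DDagger r, DDagger.toLin (R.twist V).inv = UMod.theta r V.obj.toUMod) ∧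
      (∀ V : DDagger r, DDagger.toLin (R.pairing V).coevaluation' = UMod.coev V.obj.toUMod) ∧
      (∀ V : DDagger r, DDagger.toLin (R.pairing V).evaluation' = UMod.ev V.obj.toUMod) ∧
      (∀ (V W : DDagger r) (f : V ⟶ W) (w : W.obj.carrier) (v : V.obj.carrier),
        W.obj.form w (DDagger.toLin f v) =
          V.obj.form (DDagger.toLin (R.dagger f) w) v) := by
  exact ⟨UMod.half hr, isHalfTwist_half hr, closedUnderTensor hr, DDagger.hermitianRibbon hr,
    fun _ _ => rfl, fun V => UMod.twistIso_inv hr V.mem.isWeight, fun _ => rfl, fun _ => rfl,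
    fun _ _ f w v => DDagger.form_dagger f w v⟩
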